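/- Let $\Omega\subset\mathbb R^2$ be a polygonal domain and let $\Gamma$ be a finite union of regular $C^1$ curves (open or closed, parametrized by arc length, possibly ending inside $\Omega$ or on $\partial\Omega$, otherwise running inside $\Omega$, pairwise meeting in at most finitely many points). Let $V=H^1_0(\Omega)\cap H^1(\Gamma)$ be the space of $v\in H^1_0(\Omega)$ whose trace on $\Gamma$ is continuous on $\Gamma$ and $H^1$ on each of the curves, and write $\nabla_\tau$ for the tangential derivative along $\Gamma$ and $\|\cdot\|_\omega$ for the $L^2$ norm over $\omega$. Let the scalar permeabilities $A$ on $\Omega$ and $A_\Gamma$ on $\Gamma$ be measurable with $0<\alpha\le A\le\beta<\infty$ and $\alpha\le A_\Gamma\le\beta$ almost everywhere, and let $$a(u,w)=\int_\Omega A\nabla u\cdot\nabla w+\int_\Gamma A_\Gamma\nabla_\tau u\,\nabla_\tau w .$$ Let $\mathcal T_H$ be a conforming triangulation of $\Omega$ into closed triangles of diameter at most $H>0$ such that $H/d_T\le\gamma$ and $d_{T'}/d_T\le\gamma$ for all $T,T'\in\mathcal T_H$, where $d_T$ is the diameter of the inscribed circle of $T$. Put $U(\omega)=\bigcup\{T\in\mathcal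 T_H: T\cap\omega\neq\emptyset\}$, $U^0(T)=T$, $U^{k}(T)=U(U^{k-1}(T))$, $\Gamma_T=\Gamma\cap T$, $U_\Gamma(T)=U(T)\cap\Gamma$. Let $V_H\subset V$ be the continuous piecewise affine functions on $\mathcal T_H$ vanishing on $\partial\Omega$, and let $\mathcal I_H:V\to V_H$ be a linear projection onto $V_H$ such that, for all $v\in V$ and $T\in\mathcal T_H$, $$\|v-\mathcal I_Hv\|_T+\|v-\mathcal I_Hv\|_{\Gamma_T}\le C_{\mathcal I}H\big(\|\nabla v\|_{U(T)}+\|\nabla_\tau v\|_{U_\Gamma(T)}\big),$$ $$\|\nabla\mathcal I_Hv\|_T+\|\nabla_\tau\mathcal I_Hv\|_{\Gamma_T}\le C_{\mathcal I}\big(\|\nabla v\|_{U(T)}+\|\nabla_\tau v\|_{U_\Gamma(T)}\big).$$ Let $V_{\mathrm f}=\{v\in V:\mathcal I_Hv=0\}$ and $V_{\mathrm f}(U^k(T))=\{v\in V_{\mathrm f}:\operatorname{supp}v\subset U^k(T)\}$. For $v\in V_H$ and $T\in\mathcal T_H$ put $$a_T(v,w)=\int_TA\nabla v\cdot\nabla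 w+\int_{\Gamma_T}A_\Gamma\nabla_\tau v\,\nabla_\tau w .$$ Let the corrector $\phi_T\in V_{\mathrm f}$ satisfy $a(\phi_T,w)=a_T(v,w)$ for all $w\in V_{\mathrm f}$, and let the localized corrector $\phi_T^k\in V_{\mathrm f}(U^k(T))$ satisfy $$\int_{U^k(T)}A\nabla \phi_T^k\cdot\nabla w+\int_{\Gamma\cap U^k(T)}A_\Gamma\nabla_\tau \phi_T^k\,\nabla_\tau w=a_T(v,w)\quad\text{for all }w\in V_{\mathrm f}(U^k(T)).$$ Then there are constants $C,c>0$ that depend only on $\alpha,\beta,\gamma$ and $C_{\mathcal I}$ (not on $\Omega$, $\Gamma$, $A$, $A_\Gamma$, $\mathcal T_H$, $H$, $\mathcal I_H$, $v$, $T$ or $k$) such that, for every $T\in\mathcal T_H$, every $v\in V_H$ and every integer $k\ge7$, $$\|\nabla(\phi_T-\phi_T^k)\|_\Omega+\|\nabla_\tau(\phi_T-\phi_T^k)\|_\Gamma\le C\,e^{-ck}\big(\|\nabla v\|_T+\|\nabla_\tau v\|_{\Gamma_T}\big).$$ -/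

import Mathlib

open MeasureTheory Set Filter Topology
open scoped ENNReal ContDiff

noncomputable section

namespace LODInterface

/-- The Euclidean plane. -/
abbrev Plane : Type := EuclideanSpace ℝ (Fin 2)

/-! ### The domain and the interface -/

/-- A (bounded) polygonal domain: a bounded connected open set that is the interior of its closure
and whose boundary is a finite union of line segments. -/
structure IsPolygonalDomain (Ω : Set Plane) : Prop where
  isOpen : IsOpen Ω
  isConnected : IsConnected Ω
  isBounded : Bornology.IsBounded Ω
  interior_closure : interior (closure Ω) = Ω
  frontier_eq : ∃ F : Finset (Plane × Plane), frontier Ω = ⋃ p ∈ F, segment ℝ p.1 p.2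

/-- An interface in `Ω`: a finite union of regular `C¹` curves, each parametrized by arc length,
that run inside `Ω` (their end points lie in `Ω` or on its boundary) and pairwise meet in finitely
many points. A curve may be closed, several curves may cross or meet in a common end
point, and a curve may end inside `Ω`. -/
structure Interface (Ω : Set Plane) where
  /-- The number of curves. -/
  n : ℕ
  /-- The arc length parametrizations. -/
  curve : Fin n → ℝ → Plane
  /-- The lengths of the curves. -/
  length : Fin n → ℝ
  length_pos : ∀ i, 0 < length i
  contDiffOn : ∀ i, ContDiffOn ℝ 1 (curve i) (Icc 0 (length i))
  unit_speed : ∀ i, ∀ s ∈ Icc 0 (length i), ‖derivWithin (curve i) (Icc 0 (length i)) s‖ = 1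
  injOn : ∀ i, InjOn (curve i) (Ico 0 (length i))
  mem_domain : ∀ i, ∀ s ∈ Ioo 0 (length i), curve i s ∈ Ω
  finite_inter : ∀ i j, i ≠ j →
    (curve i '' Icc 0 (length i) ∩ curve j '' Icc 0 (length j)).Finite

namespace Interface

variable {Ω : Set Plane} (Γ : Interface Ω)

/-- The interface as a set of points. -/
def carrier : Set Plane := ⋃ i, Γ.curve i '' Icc 0 (Γ.length i)

/-- The restriction of `v` to the interface, in the arc length parameter of each curve. -/
def restr (v : Plane → ℝ) (i : Fin Γ.n) (s : ℝ) : ℝ := v (Γ.curve i s)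

/-- The tangential derivative of `v` along the interface. -/
def tanDeriv (v : Plane → ℝ) (i : Fin Γ.n) (s : ℝ) : ℝ := deriv (Γ.restr v i) s

/-- The integral over `Γ ∩ S`, with respect to arc length, of a function given in the arc length
parameter of each curve. -/
def integralOn (S : Set Plane) (f : Fin Γ.n → ℝ → ℝ) : ℝ :=
  ∑ i, ∫ s in Icc 0 (Γ.length i) ∩ Γ.curve i ⁻¹' S, f i s

/-- The `L²` norm over `Γ ∩ S`. -/
def l2Norm (S : Set Plane) (f : Fin Γ.n → ℝ → ℝ) : ℝ :=
  Real.sqrt (Γ.integralOn S fun i s => f i s ^ 2)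

end Interface

/-! ### Weak gradients and the energy space -/

/-- Smooth functions with compact support in `Ω`. -/
structure IsTestFunction (Ω : Set Plane) (ψ : Plane → ℝ) : Prop where
  contDiff : ContDiff ℝ ∞ ψ
  hasCompactSupport : HasCompactSupport ψ
  tsupport_subset : tsupport ψ ⊆ Ω

/-- `G ∈ L²(Ω)` is the weak gradient of `u` on `Ω`. -/
structure IsWeakGradient (Ω : Set Plane) (u : Plane → ℝ) (G : Plane → Plane) : Prop where
  memLp : MemLp G 2 (volume.restrict Ω)
  integral_eq : ∀ ψ, IsTestFunction Ω ψ →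
    ∫ x in Ω, u x • gradient ψ x = - ∫ x in Ω, ψ x • G x

open Classical in
/-- The weak gradient of `u` on `Ω` (determined up to a null set; `0` if there is none). -/
def weakGrad (Ω : Set Plane) (u : Plane → ℝ) : Plane → Plane :=
  if h : ∃ G, IsWeakGradient Ω u G then h.choose else 0

/-- The `L²` norm over `Ω ∩ S`. -/
def l2Norm {F : Type} [NormedAddCommGroup F] (Ω S : Set Plane) (f : Plane → F) : ℝ :=
  Real.sqrt (∫ x in Ω ∩ S, ‖f x‖ ^ 2)

/-- Membership in `V = H¹₀(Ω) ∩ H¹(Γ)`. One function represents both the function on `Ω` (up to null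
sets) and its trace on `Γ`: it is an `H¹(Ω)` limit of test functions whose restrictions to `Γ`
converge to it in `L²(Γ)`. On `Γ` it is continuous, and on each curve absolutely continuous with
square integrable derivative, which is `H¹` in one variable. Functions are extended by zero
outside `Ω`. -/
structure MemEnergySpace {Ω : Set Plane} (Γ : Interface Ω) (v : Plane → ℝ) : Prop where
  eq_zero : ∀ x, x ∉ Ω → v x = 0
  memLp : MemLp v 2 (volume.restrict Ω)
  approx : ∃ G, IsWeakGradient Ω v G ∧ ∃ ψ : ℕ → Plane → ℝ, (∀ j, IsTestFunction Ω (ψ j)) ∧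
    Tendsto (fun j => eLpNorm (ψ j - v) 2 (volume.restrict Ω)) atTop (𝓝 0) ∧
    Tendsto (fun j => eLpNorm (gradient (ψ j) - G) 2 (volume.restrict Ω)) atTop (𝓝 0) ∧
    ∀ i, Tendsto (fun j => eLpNorm (Γ.restr (ψ j) i - Γ.restr v i) 2
      (volume.restrict (Icc 0 (Γ.length i)))) atTop (𝓝 0)
  continuousOn : ContinuousOn v Γ.carrier
  absCont : ∀ i, AbsolutelyContinuousOnInterval (Γ.restr v i) 0 (Γ.length i)
  memLp_tanDeriv : ∀ i, MemLp (Γ.tanDeriv v i) 2 (volume.restrict (Icc 0 (Γ.length i)))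

theorem gradient_add_of_test {Ω : Set Plane} {φ ψ : Plane → ℝ} (hφ : IsTestFunction Ω φ)
    (hψ : IsTestFunction Ω ψ) : gradient (φ + ψ) = gradient φ + gradient ψ := by
  funext x
  have h1 := (hφ.contDiff.differentiable (by simp)) x
  have h2 := (hψ.contDiff.differentiable (by simp)) x
  simp [gradient, fderiv_add h1 h2]

theorem gradient_smul_of_test {Ω : Set Plane} {φ : Plane → ℝ} (hφ : IsTestFunction Ω φ) (a : ℝ) :
    gradient (a • φ) = a • gradient φ := by
  funext x
  have h1 := (hφ.contDiff.differentiable (by simp)) x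
  simp [gradient, fderiv_const_smul h1 a]

theorem IsTestFunction.add {Ω : Set Plane} {φ ψ : Plane → ℝ} (hφ : IsTestFunction Ω φ)
    (hψ : IsTestFunction Ω ψ) : IsTestFunction Ω (φ + ψ) :=
  ⟨hφ.contDiff.add hψ.contDiff, hφ.hasCompactSupport.add hψ.hasCompactSupport,
    (tsupport_add φ ψ).trans (union_subset hφ.tsupport_subset hψ.tsupport_subset)⟩

theorem IsTestFunction.smul {Ω : Set Plane} {φ : Plane → ℝ} (hφ : IsTestFunction Ω φ) (a : ℝ) :
    IsTestFunction Ω (a • φ) :=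
  ⟨hφ.contDiff.const_smul a, hφ.hasCompactSupport.smul_left (f := fun _ => a),
    (tsupport_smul_subset_right (fun _ => a) φ).trans hφ.tsupport_subset⟩

theorem IsTestFunction.memLp_gradient {Ω : Set Plane} {ψ : Plane → ℝ} (hψ : IsTestFunction Ω ψ) :
    MemLp (gradient ψ) 2 (volume.restrict Ω) := by
  have hc : Continuous (gradient ψ) :=
    (InnerProductSpace.toDual ℝ Plane).symm.continuous.comp
      (hψ.contDiff.continuous_fderiv (by simp))
  have hs : HasCompactSupport (gradient ψ) :=
    (hψ.hasCompactSupport.fderiv (𝕜 := ℝ)).comp_left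
      (g := (InnerProductSpace.toDual ℝ Plane).symm) (map_zero _)
  exact (hc.memLp_of_hasCompactSupport hs).restrict Ω

theorem IsTestFunction.memLp {Ω : Set Plane} {ψ : Plane → ℝ} (hψ : IsTestFunction Ω ψ) :
    MemLp ψ 2 (volume.restrict Ω) :=
  (hψ.contDiff.continuous.memLp_of_hasCompactSupport hψ.hasCompactSupport).restrict Ω

theorem IsWeakGradient.add {Ω : Set Plane} {u v : Plane → ℝ} {G K : Plane → Plane}
    (hu2 : MemLp u 2 (volume.restrict Ω)) (hv2 : MemLp v 2 (volume.restrict Ω))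
    (hu : IsWeakGradient Ω u G) (hv : IsWeakGradient Ω v K) :
    IsWeakGradient Ω (u + v) (G + K) := by
  refine ⟨hu.memLp.add hv.memLp, fun ψ hψ => ?_⟩
  have e1 : ∫ x in Ω, (u + v) x • gradient ψ x
      = (∫ x in Ω, u x • gradient ψ x) + ∫ x in Ω, v x • gradient ψ x := by
    rw [← integral_add]
    · simp [add_smul]
    · exact memLp_one_iff_integrable.1 (MemLp.smul (p := 2) (q := 2) hψ.memLp_gradient hu2)
    · exact memLp_one_iff_integrable.1 (MemLp.smul (p := 2) (q := 2) hψ.memLp_gradient hv2)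
  have e2 : ∫ x in Ω, ψ x • (G + K) x
      = (∫ x in Ω, ψ x • G x) + ∫ x in Ω, ψ x • K x := by
    rw [← integral_add]
    · simp [smul_add]
    · exact memLp_one_iff_integrable.1 (MemLp.smul (p := 2) (q := 2) hu.memLp hψ.memLp)
    · exact memLp_one_iff_integrable.1 (MemLp.smul (p := 2) (q := 2) hv.memLp hψ.memLp)
  rw [e1, e2, hu.integral_eq ψ hψ, hv.integral_eq ψ hψ]
  abel

theorem IsWeakGradient.smul {Ω : Set Plane} {u : Plane → ℝ} {G : Plane → Plane}
    (hu : IsWeakGradient Ω u G) (a : ℝ) : IsWeakGradient Ω (a • u) (a • G) := by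
  refine ⟨hu.memLp.const_smul a, fun ψ hψ => ?_⟩
  have h := hu.integral_eq ψ hψ
  simp only [Pi.smul_apply, smul_eq_mul, mul_smul, smul_comm _ a (G _)]
  rw [integral_smul, integral_smul, h, smul_neg]

theorem tendsto_eLpNorm_add {X F : Type} [MeasurableSpace X] [NormedAddCommGroup F]
    {μ : Measure X} {f g : ℕ → X → F} {u v : X → F}
    (hf : ∀ j, AEStronglyMeasurable (f j - u) μ) (hg : ∀ j, AEStronglyMeasurable (g j - v) μ)
    (h1 : Tendsto (fun j => eLpNorm (f j - u) 2 μ) atTop (𝓝 0))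
    (h2 : Tendsto (fun j => eLpNorm (g j - v) 2 μ) atTop (𝓝 0)) :
    Tendsto (fun j => eLpNorm ((f j + g j) - (u + v)) 2 μ) atTop (𝓝 0) := by
  have h12 := h1.add h2
  rw [add_zero] at h12
  refine tendsto_of_tendsto_of_tendsto_of_le_of_le tendsto_const_nhds h12
    (fun _ => zero_le) (fun j => ?_)
  have e : (f j + g j) - (u + v) = (f j - u) + (g j - v) := by abel
  simp only [e]
  exact eLpNorm_add_le (hf j) (hg j) (by norm_num)

theorem tendsto_eLpNorm_smul {X F : Type} [MeasurableSpace X] [NormedAddCommGroup F]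
    [NormedSpace ℝ F] {μ : Measure X} {f : ℕ → X → F} {u : X → F} (a : ℝ)
    (h1 : Tendsto (fun j => eLpNorm (f j - u) 2 μ) atTop (𝓝 0)) :
    Tendsto (fun j => eLpNorm (a • f j - a • u) 2 μ) atTop (𝓝 0) := by
  have h := ENNReal.Tendsto.const_mul (a := ‖a‖ₑ) h1 (Or.inr (by simp))
  rw [mul_zero] at h
  refine h.congr fun j => ?_
  rw [← smul_sub, eLpNorm_const_smul]

section EnergySpace

variable {Ω : Set Plane} {Γ : Interface Ω}

theorem curve_continuousOn (i : Fin Γ.n) : ContinuousOn (Γ.curve i) (Icc 0 (Γ.length i)) :=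
  (Γ.contDiffOn i).continuousOn

theorem aesm_restr {v : Plane → ℝ} (hv : ContinuousOn v Γ.carrier) (i : Fin Γ.n) :
    AEStronglyMeasurable (Γ.restr v i) (volume.restrict (Icc 0 (Γ.length i))) := by
  refine ContinuousOn.aestronglyMeasurable ?_ measurableSet_Icc
  exact hv.comp (curve_continuousOn i) fun s hs => mem_iUnion.2 ⟨i, mem_image_of_mem _ hs⟩

theorem ae_differentiableAt_restr {v : Plane → ℝ} (i : Fin Γ.n)
    (h : AbsolutelyContinuousOnInterval (Γ.restr v i) 0 (Γ.length i)) :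
    ∀ᵐ s ∂(volume.restrict (Icc 0 (Γ.length i))), DifferentiableAt ℝ (Γ.restr v i) s := by
  rw [ae_restrict_iff' measurableSet_Icc]
  have := h.boundedVariationOn.ae_differentiableAt_of_mem_uIcc
  rwa [uIcc_of_le (Γ.length_pos i).le] at this

theorem memEnergySpace_zero (Γ : Interface Ω) : MemEnergySpace Γ 0 where
  eq_zero := fun _ _ => rfl
  memLp := MemLp.zero
  approx := by
    refine ⟨0, ⟨MemLp.zero, by simp⟩, fun _ => 0, fun _ => ⟨contDiff_const, ?_, ?_⟩, ?_, ?_, ?_⟩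
    · exact HasCompactSupport.zero
    · simp [tsupport]
    · simp
    · have : gradient (0 : Plane → ℝ) = 0 := by
        funext x
        simp [gradient]
      simp [this]
    · simp
  continuousOn := continuousOn_const
  absCont := fun i => by
    have : Γ.restr 0 i = fun _ => (0 : ℝ) := rfl
    rw [this]
    exact (LipschitzWith.const (0 : ℝ)).lipschitzOnWith.absolutelyContinuousOnInterval
  memLp_tanDeriv := fun i => by
    have : Γ.tanDeriv 0 i = fun _ => (0 : ℝ) := by
      funext s
      exact deriv_const s (0 : ℝ)
    rw [this]
    exact MemLp.zero

theorem MemEnergySpace.add {u v : Plane → ℝ} (hu : MemEnergySpace Γ u) (hv : MemEnergySpace Γ v) :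
    MemEnergySpace Γ (u + v) where
  eq_zero := fun x hx => by simp [hu.eq_zero x hx, hv.eq_zero x hx]
  memLp := hu.memLp.add hv.memLp
  approx := by
    obtain ⟨G, hG, φ, hφ, h1, h2, h3⟩ := hu.approx
    obtain ⟨K, hK, ψ, hψ, k1, k2, k3⟩ := hv.approx
    refine ⟨G + K, hG.add hu.memLp hv.memLp hK, fun j => φ j + ψ j,
      fun j => (hφ j).add (hψ j), ?_, ?_, fun i => ?_⟩
    · exact tendsto_eLpNorm_add (fun j => ((hφ j).memLp.sub hu.memLp).1)
        (fun j => ((hψ j).memLp.sub hv.memLp).1) h1 k1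
    · simp only [fun j => gradient_add_of_test (hφ j) (hψ j)]
      exact tendsto_eLpNorm_add (fun j => ((hφ j).memLp_gradient.sub hG.memLp).1)
        (fun j => ((hψ j).memLp_gradient.sub hK.memLp).1) h2 k2
    · exact tendsto_eLpNorm_add
        (fun j => (aesm_restr (hφ j).contDiff.continuous.continuousOn i).sub
          (aesm_restr hu.continuousOn i))
        (fun j => (aesm_restr (hψ j).contDiff.continuous.continuousOn i).sub
          (aesm_restr hv.continuousOn i)) (h3 i) (k3 i)
  continuousOn := hu.continuousOn.add hv.continuousOn
  absCont := fun i => (hu.absCont i).add (hv.absCont i)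
  memLp_tanDeriv := fun i => by
    refine (memLp_congr_ae ?_).1 ((hu.memLp_tanDeriv i).add (hv.memLp_tanDeriv i))
    filter_upwards [ae_differentiableAt_restr i (hu.absCont i),
      ae_differentiableAt_restr i (hv.absCont i)] with s h1 h2
    exact (deriv_add h1 h2).symm

theorem MemEnergySpace.smul {u : Plane → ℝ} (hu : MemEnergySpace Γ u) (a : ℝ) :
    MemEnergySpace Γ (a • u) where
  eq_zero := fun x hx => by simp [hu.eq_zero x hx]
  memLp := hu.memLp.const_smul a
  approx := by
    obtain ⟨G, hG, φ, hφ, h1, h2, h3⟩ := hu.approx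
    refine ⟨a • G, hG.smul a, fun j => a • φ j, fun j => (hφ j).smul a,
      tendsto_eLpNorm_smul a h1, ?_, fun i => tendsto_eLpNorm_smul a (h3 i)⟩
    simp only [fun j => gradient_smul_of_test (hφ j) a]
    exact tendsto_eLpNorm_smul a h2
  continuousOn := hu.continuousOn.const_smul a
  absCont := fun i => (hu.absCont i).const_mul a
  memLp_tanDeriv := fun i => by
    refine (memLp_congr_ae ?_).1 ((hu.memLp_tanDeriv i).const_smul a)
    filter_upwards [ae_differentiableAt_restr i (hu.absCont i)] with s h1
    exact (deriv_const_smul a h1).symm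

end EnergySpace

/-- The space `V = H¹₀(Ω) ∩ H¹(Γ)`. -/
def energySpace {Ω : Set Plane} (Γ : Interface Ω) : Submodule ℝ (Plane → ℝ) where
  carrier := {v | MemEnergySpace Γ v}
  zero_mem' := memEnergySpace_zero Γ
  add_mem' := fun hu hv => hu.add hv
  smul_mem' := fun a _ hu => hu.smul a

/-! ### Triangulations, patches and the coarse space -/

/-- The closed triangle with vertex set `t`. -/
def cell (t : Finset Plane) : Set Plane := convexHull ℝ (t : Set Plane)

/-- `𝒯`, a finite set of triangles given by their vertex sets, is a conforming triangulation of `Ω`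
into closed nondegenerate triangles. -/
structure IsTriangulation (Ω : Set Plane) (𝒯 : Finset (Finset Plane)) : Prop where
  card_eq : ∀ t ∈ 𝒯, t.card = 3
  affineIndependent : ∀ t ∈ 𝒯, AffineIndependent ℝ ((↑) : t → Plane)
  conforming : ∀ t ∈ 𝒯, ∀ t' ∈ 𝒯,
    cell t ∩ cell t' = convexHull ℝ ((t : Set Plane) ∩ (t' : Set Plane))
  cover : closure Ω = ⋃ t ∈ 𝒯, cell t

/-- The diameter of the inscribed circle, i.e. of the largest disc contained in the triangle. -/
def inscribedDiam (t : Finset Plane) : ℝ :=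
  2 * sSup {r : ℝ | 0 ≤ r ∧ ∃ x, Metric.closedBall x r ⊆ cell t}

/-- The mesh `𝒯`, of mesh size `H`, is quasi-uniform and shape regular with constant `γ`. -/
structure IsQuasiUniform (𝒯 : Finset (Finset Plane)) (H γ : ℝ) : Prop where
  pos : 0 < H
  diam_le : ∀ t ∈ 𝒯, Metric.diam (cell t) ≤ H
  shapeRegular : ∀ t ∈ 𝒯, H / inscribedDiam t ≤ γ
  ratio_le : ∀ t ∈ 𝒯, ∀ t' ∈ 𝒯, inscribedDiam t' / inscribedDiam t ≤ γ

/-- The element neighbour operator `U`: the union of the elements that intersect `S`. -/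
def neighbors (𝒯 : Finset (Finset Plane)) (S : Set Plane) : Set Plane :=
  ⋃ t ∈ {t : Finset Plane | t ∈ 𝒯 ∧ (cell t ∩ S).Nonempty}, cell t

/-- The patch `U^k(T)`, with `U^0(T) = T`. -/
def patch (𝒯 : Finset (Finset Plane)) (k : ℕ) (t : Finset Plane) : Set Plane :=
  (neighbors 𝒯)^[k] (cell t)

/-- The coarse space `V_H`: the functions in `V` (so with zero boundary values) that are continuous
and piecewise affine on `𝒯`. They are affine on each closed triangle, hence continuous on the
union of the triangles. -/
def coarseSpace {Ω : Set Plane} (Γ : Interface Ω) (𝒯 : Finset (Finset Plane)) :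
    Submodule ℝ (energySpace Γ) where
  carrier := {v | ∀ t ∈ 𝒯, ∃ f : Plane →ᵃ[ℝ] ℝ, EqOn (v : Plane → ℝ) f (cell t)}
  zero_mem' := fun _ _ => ⟨0, fun _ _ => rfl⟩
  add_mem' := fun {u v} hu hv t ht => by
    obtain ⟨f, hf⟩ := hu t ht
    obtain ⟨g, hg⟩ := hv t ht
    exact ⟨f + g, fun x hx => by simp [hf hx, hg hx]⟩
  smul_mem' := fun a u hu t ht => by
    obtain ⟨f, hf⟩ := hu t ht
    exact ⟨a • f, fun x hx => by simp [hf hx]⟩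

/-! ### Coefficients, bilinear forms and correctors -/

/-- The permeabilities `A` on `Ω` and `AΓ` on the interface are measurable and take values
in `[α, β]` almost everywhere. -/
structure IsPermeability {Ω : Set Plane} (Γ : Interface Ω) (A AΓ : Plane → ℝ) (α β : ℝ) :
    Prop where
  measurable_bulk : AEMeasurable A (volume.restrict Ω)
  bounds_bulk : ∀ᵐ x ∂(volume.restrict Ω), α ≤ A x ∧ A x ≤ β
  measurable_interface : ∀ i,
    AEMeasurable (Γ.restr AΓ i) (volume.restrict (Icc 0 (Γ.length i)))
  bounds_interface : ∀ i, ∀ᵐ s ∂(volume.restrict (Icc 0 (Γ.length i))),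
    α ≤ Γ.restr AΓ i s ∧ Γ.restr AΓ i s ≤ β

/-- The bilinear form `(A ∇u, ∇w)_S + (AΓ ∇_τ u, ∇_τ w)_{Γ ∩ S}`. -/
def formOn {Ω : Set Plane} (Γ : Interface Ω) (A AΓ : Plane → ℝ) (S : Set Plane)
    (u w : Plane → ℝ) : ℝ :=
  (∫ x in Ω ∩ S, A x * inner ℝ (weakGrad Ω u x) (weakGrad Ω w x)) +
    Γ.integralOn S fun i s => Γ.restr AΓ i s * (Γ.tanDeriv u i s * Γ.tanDeriv w i s)

/-- The sum of the bulk gradient norm over `S` and of the tangential gradient norm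
over `Γ ∩ S`. -/
def gradNorm {Ω : Set Plane} (Γ : Interface Ω) (S : Set Plane) (v : Plane → ℝ) : ℝ :=
  l2Norm Ω S (weakGrad Ω v) + Γ.l2Norm S (Γ.tanDeriv v)

/-- `I : V → V_H` is a linear projection onto `V_H` that satisfies the local error bound and
the local `H¹` stability bound with constant `CI`. -/
structure IsInterpolation {Ω : Set Plane} (Γ : Interface Ω) (𝒯 : Finset (Finset Plane))
    (H CI : ℝ) (I : energySpace Γ →ₗ[ℝ] coarseSpace Γ 𝒯) : Prop where
  projection : ∀ v : coarseSpace Γ 𝒯, I (v : energySpace Γ) = v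
  error_le : ∀ v : energySpace Γ, ∀ t ∈ 𝒯,
    l2Norm Ω (cell t) ((v : Plane → ℝ) - ((I v : energySpace Γ) : Plane → ℝ)) +
        Γ.l2Norm (cell t) (Γ.restr ((v : Plane → ℝ) - ((I v : energySpace Γ) : Plane → ℝ)))
      ≤ CI * H * gradNorm Γ (patch 𝒯 1 t) v
  stable : ∀ v : energySpace Γ, ∀ t ∈ 𝒯,
    gradNorm Γ (cell t) ((I v : energySpace Γ) : Plane → ℝ) ≤ CI * gradNorm Γ (patch 𝒯 1 t) v

/-- `v` is supported in `S`: it vanishes almost everywhere in `Ω \ S` and on `Γ \ S`. -/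
def SupportedIn {Ω : Set Plane} (Γ : Interface Ω) (S : Set Plane) (v : Plane → ℝ) : Prop :=
  (∀ᵐ x ∂(volume.restrict Ω), x ∉ S → v x = 0) ∧ ∀ x ∈ Γ.carrier, x ∉ S → v x = 0

/-- `φ` is the corrector of the coarse function `v` for the element `t`: it lies in the kernel of `I`
and `a(φ, w) = a_T(v, w)` for all `w` in that kernel. -/
structure IsCorrector {Ω : Set Plane} (Γ : Interface Ω) (𝒯 : Finset (Finset Plane))
    (A AΓ : Plane → ℝ) (I : energySpace Γ →ₗ[ℝ] coarseSpace Γ 𝒯) (v : coarseSpace Γ 𝒯)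
    (t : Finset Plane) (φ : energySpace Γ) : Prop where
  mem_fine : I φ = 0
  eq : ∀ w : energySpace Γ, I w = 0 →
    formOn Γ A AΓ univ φ w = formOn Γ A AΓ (cell t) (v : energySpace Γ) w

/-- `φ` is the corrector of `v` for the element `t`, localized to the patch `U^k(T)`. -/
structure IsLocalCorrector {Ω : Set Plane} (Γ : Interface Ω) (𝒯 : Finset (Finset Plane))
    (A AΓ : Plane → ℝ) (I : energySpace Γ →ₗ[ℝ] coarseSpace Γ 𝒯) (v : coarseSpace Γ 𝒯)
    (t : Finset Plane) (k : ℕ) (φ : energySpace Γ) : Prop where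
  mem_fine : I φ = 0
  supported : SupportedIn Γ (patch 𝒯 k t) φ
  eq : ∀ w : energySpace Γ, I w = 0 → SupportedIn Γ (patch 𝒯 k t) w →
    formOn Γ A AΓ (patch 𝒯 k t) φ w = formOn Γ A AΓ (cell t) (v : energySpace Γ) w

end LODInterface

end

/-!
The corrector problem is elliptic on the kernel of the interpolation operator, and on this kernel
functions are small: their `L²` norm over a triangle is at most `H` times the energy nearby.
The source of the problem lives on one triangle `t`, and the solution decays away from it, by
the Caccioppoli argument.

Let `E(m)` be the energy of `φ` outside the layer `m` of triangles around `t`. Multiply `φ` with a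
cut-off function `η` that is `0` on the layer `m + 3` and `1` outside the layer `m + 4`, and
subtract the interpolant to return to the kernel. The result `w` vanishes near `t`, agrees with
`φ` far from it, and in the ring between the layers `m` and `m + 7` its energy is bounded by that
of `φ`: the slope of order `1 / H` of `η` meets the factor `H` of the interpolation error
(`IsLocalProjection.exists_fine_cutoff`, `isLocalProjection_interpEnd`). Testing the equation of `φ`
with `w` gives `E(m + 7) ≤ C (E(m) - E(m + 7))` (`outerEnergy_hole_filling`), that is,
contraction by the factor `C / (1 + C)` per seven layers (`outerEnergy_le_pow`). On the other
hand `φ - w`, for the last `m` for which it is supported in the patch, is an admissible competitor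
for the localized problem, so that by Galerkin orthogonality the error `φ - φ_k` is bounded by
the energy of `w`, hence by `E(m)` (`localization_error`).

The bulk and the interface enter this argument in the same way. They are therefore treated as one
measure space, the disjoint union of `Ω` and of the parameter intervals of the curves, with one
gradient operator (`gradOp`), and the decay is proved for an abstract measure space covered by
cells with finitely many neighbours. The number of neighbours of a triangle is bounded
by comparing areas (`card_meeting_le`).

The cut-off function is the piecewise affine function with nodal values `0` and `1`. A cut-off
function built from Euclidean distances would not do, since points of triangles that do not touch
can be arbitrarily close across a thin gap in the domain; for the same reason `η` is Lipschitz only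
along paths in the closure of `Ω` (`abs_sub_le_along_path`), which suffices on the curves. The
energy space is defined by approximation with test functions, so that `η v` belongs to it only
after `η` has been smoothed (`tendsto_gradient_mollify_mul`, `MemEnergySpace.mul_cutoff`). Finally,
a curve may meet a triangle in any closed set of parameters; where `η` is constant
its tangential derivative vanishes almost everywhere nevertheless (`ae_deriv_eq_zero_of_eqOn`).
-/

noncomputable section

namespace LODInterface

/-! ### Exponential decay for an abstract localized problem -/

section Abstract

variable {X F V : Type} [MeasurableSpace X] {μ : Measure X} [NormedAddCommGroup F]
  [InnerProductSpace ℝ F] [AddCommGroup V] [Module ℝ V]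

/-- The energy `∫_S ‖D u‖²` of `u` over `S`, for a gradient operator `D` with values in `L²`. -/
def localEnergy (D : V →ₗ[ℝ] Lp F 2 μ) (S : Set X) (u : V) : ℝ :=
  ∫ x in S, ‖D u x‖ ^ 2 ∂μ

variable (D : V →ₗ[ℝ] Lp F 2 μ)

theorem localEnergy_nonneg (S : Set X) (u : V) : 0 ≤ localEnergy D S u :=
  integral_nonneg fun _ => by positivity

theorem integrable_norm_sq (u : V) : Integrable (fun x => ‖D u x‖ ^ 2) μ :=
  (Lp.memLp (D u)).integrable_norm_pow (by norm_num)

theorem localEnergy_mono {S S' : Set X} (h : S ⊆ S') (u : V) :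
    localEnergy D S u ≤ localEnergy D S' u :=
  setIntegral_mono_set (integrable_norm_sq D u).integrableOn
    (ae_of_all _ fun _ => by positivity) h.eventuallyLE

theorem localEnergy_add_le (S : Set X) (u w : V) :
    localEnergy D S (u + w) ≤ 2 * localEnergy D S u + 2 * localEnergy D S w := by
  unfold localEnergy
  rw [← integral_const_mul, ← integral_const_mul, ← integral_add
    ((integrable_norm_sq D u).integrableOn.const_mul 2)
    ((integrable_norm_sq D w).integrableOn.const_mul 2)]
  refine integral_mono_ae (integrable_norm_sq D _).integrableOn
    (((integrable_norm_sq D u).integrableOn.const_mul 2).add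
      ((integrable_norm_sq D w).integrableOn.const_mul 2)) ?_
  refine ae_restrict_of_ae ?_
  rw [map_add]
  filter_upwards [Lp.coeFn_add (D u) (D w)] with x hx
  simp only [hx, Pi.add_apply]
  nlinarith [norm_add_le (D u x) (D w x), sq_nonneg (‖D u x‖ - ‖D w x‖),
    norm_nonneg (D u x + D w x), norm_nonneg (D u x), norm_nonneg (D w x)]

theorem localEnergy_neg (S : Set X) (u : V) : localEnergy D S (-u) = localEnergy D S u := by
  unfold localEnergy
  rw [map_neg]
  refine integral_congr_ae (ae_restrict_of_ae ?_)
  filter_upwards [Lp.coeFn_neg (D u)] with x hx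
  rw [hx, Pi.neg_apply, norm_neg]

theorem localEnergy_sub_le (S : Set X) (u w : V) :
    localEnergy D S (u - w) ≤ 2 * localEnergy D S u + 2 * localEnergy D S w := by
  rw [sub_eq_add_neg, ← localEnergy_neg D S w]
  exact localEnergy_add_le D S u (-w)

theorem ae_eq_zero_of_localEnergy_eq_zero {S : Set X} {u : V} (h : localEnergy D S u = 0) :
    ∀ᵐ x ∂μ.restrict S, D u x = 0 := by
  have := (integral_eq_zero_iff_of_nonneg (fun x => by positivity)
    (integrable_norm_sq D u).integrableOn).1 h
  filter_upwards [this] with x hx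
  simpa using hx

theorem localEnergy_eq_zero_of_ae {S : Set X} {u : V} (h : ∀ᵐ x ∂μ.restrict S, D u x = 0) :
    localEnergy D S u = 0 := by
  refine integral_eq_zero_of_ae ?_
  filter_upwards [h] with x hx
  simp [hx]

/-- The integral `∫_S a ⟨D u, D w⟩`. -/
def weightedForm (a : X → ℝ) (S : Set X) (u w : V) : ℝ :=
  ∫ x in S, a x * inner ℝ (D u x) (D w x) ∂μ

variable {a : X → ℝ} {α β : ℝ}

theorem integrable_weightedForm (ha : AEMeasurable a μ) (hα : 0 < α)
    (hab : ∀ᵐ x ∂μ, α ≤ a x ∧ a x ≤ β) (u w : V) :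
    Integrable (fun x => a x * inner ℝ (D u x) (D w x)) μ := by
  have h1 : Integrable (fun x => inner ℝ (D u x) (D w x)) μ :=
    L2.integrable_inner (𝕜 := ℝ) (D u) (D w)
  refine h1.bdd_mul ha.aestronglyMeasurable (c := β) ?_
  filter_upwards [hab] with x hx
  rw [Real.norm_eq_abs, abs_of_nonneg (hα.le.trans hx.1)]
  exact hx.2

theorem abs_mul_inner_le {c : ℝ} (hc : 0 ≤ c) (hcb : c ≤ β) (p q : F) :
    |c * inner ℝ p q| ≤ β * (‖p‖ * ‖q‖) := by
  rw [abs_mul, abs_of_nonneg hc]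
  exact mul_le_mul hcb (abs_real_inner_le_norm p q) (abs_nonneg _) (hc.trans hcb)

theorem coercive (ha : AEMeasurable a μ) (hα : 0 < α)
    (hab : ∀ᵐ x ∂μ, α ≤ a x ∧ a x ≤ β) (S : Set X) (u : V) :
    α * localEnergy D S u ≤ weightedForm D a S u u := by
  unfold localEnergy weightedForm
  rw [← integral_const_mul]
  refine integral_mono_ae ((integrable_norm_sq D u).integrableOn.const_mul _)
    (integrable_weightedForm D ha hα hab u u).integrableOn (ae_restrict_of_ae ?_)
  filter_upwards [hab] with x hx
  rw [real_inner_self_eq_norm_sq]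
  exact mul_le_mul_of_nonneg_right hx.1 (by positivity)

/-- Boundedness of the form, in the form of Young's inequality with a free parameter `r`. -/
theorem weightedForm_le (ha : AEMeasurable a μ) (hα : 0 < α)
    (hab : ∀ᵐ x ∂μ, α ≤ a x ∧ a x ≤ β) (S : Set X) (u w : V) (r : ℝ) (hr : 0 < r) :
    weightedForm D a S u w ≤ r * localEnergy D S u + β ^ 2 / (4 * r) * localEnergy D S w := by
  unfold localEnergy weightedForm
  rw [← integral_const_mul, ← integral_const_mul, ← integral_add
    ((integrable_norm_sq D u).integrableOn.const_mul _)
    ((integrable_norm_sq D w).integrableOn.const_mul _)]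
  refine integral_mono_ae (integrable_weightedForm D ha hα hab u w).integrableOn
    (((integrable_norm_sq D u).integrableOn.const_mul _).add
      ((integrable_norm_sq D w).integrableOn.const_mul _)) (ae_restrict_of_ae ?_)
  filter_upwards [hab] with x hx
  refine (le_abs_self _).trans ((abs_mul_inner_le (hα.le.trans hx.1) hx.2 _ _).trans ?_)
  have : r * ‖D u x‖ ^ 2 + β ^ 2 / (4 * r) * ‖D w x‖ ^ 2 - β * (‖D u x‖ * ‖D w x‖)
      = r * (‖D u x‖ - β / (2 * r) * ‖D w x‖) ^ 2 := by
    field_simp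
    ring
  have h2 : 0 ≤ r * (‖D u x‖ - β / (2 * r) * ‖D w x‖) ^ 2 := by positivity
  linarith

/-- The a priori estimate for a variational problem with data `w` on `S`. Young's inequality
absorbs half of the energy of `u`, so that no square roots are needed. -/
theorem localEnergy_le_of_le_weightedForm (ha : AEMeasurable a μ) (hα : 0 < α)
    (hab : ∀ᵐ x ∂μ, α ≤ a x ∧ a x ≤ β) (S : Set X) (u w : V)
    (h : α * localEnergy D univ u ≤ weightedForm D a S u w) :
    localEnergy D univ u ≤ (β / α) ^ 2 * localEnergy D S w := by
  have h1 := weightedForm_le D ha hα hab S u w (α / 2) (by positivity)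
  have h2 := localEnergy_mono D (subset_univ S) u
  have h3 : β ^ 2 / (4 * (α / 2)) = α / 2 * (β / α) ^ 2 := by
    field_simp
    norm_num
  rw [h3] at h1
  have h4 : α / 2 * localEnergy D S u ≤ α / 2 * localEnergy D univ u := by gcongr
  have h5 : α / 2 * localEnergy D univ u ≤ α / 2 * ((β / α) ^ 2 * localEnergy D S w) := by
    linarith
  exact le_of_mul_le_mul_left h5 (by positivity)

theorem weightedForm_sub_left (ha : AEMeasurable a μ) (hα : 0 < α)
    (hab : ∀ᵐ x ∂μ, α ≤ a x ∧ a x ≤ β) (S : Set X) (u u' w : V) :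
    weightedForm D a S (u - u') w = weightedForm D a S u w - weightedForm D a S u' w := by
  unfold weightedForm
  rw [← integral_sub (integrable_weightedForm D ha hα hab u w).integrableOn
    (integrable_weightedForm D ha hα hab u' w).integrableOn, map_sub]
  refine integral_congr_ae (ae_restrict_of_ae ?_)
  filter_upwards [Lp.coeFn_sub (D u) (D u')] with x hx
  simp only [hx, Pi.sub_apply, inner_sub_left, mul_sub]

theorem weightedForm_comm (S : Set X) (u w : V) :
    weightedForm D a S u w = weightedForm D a S w u := by
  unfold weightedForm
  simp only [real_inner_comm]

theorem weightedForm_eq_zero {S : Set X} {u w : V} (h : localEnergy D S w = 0) :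
    weightedForm D a S u w = 0 := by
  refine integral_eq_zero_of_ae ?_
  filter_upwards [ae_eq_zero_of_localEnergy_eq_zero D h] with x hx
  simp [hx]

variable {ι : Type}

theorem localEnergy_biUnion_le {K : ι → Set X}
    (P : Finset ι) (u : V) :
    localEnergy D (⋃ s ∈ P, K s) u ≤ ∑ s ∈ P, localEnergy D (K s) u := by
  unfold localEnergy
  have h0 : ∀ S : Set X, ∫ x in S, ‖D u x‖ ^ 2 ∂μ =
      (∫⁻ x in S, ENNReal.ofReal (‖D u x‖ ^ 2) ∂μ).toReal := fun S => by
    rw [integral_eq_lintegral_of_nonneg_ae (ae_of_all _ fun _ => by positivity)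
      (integrable_norm_sq D u).integrableOn.aestronglyMeasurable]
  have hfin : ∀ S : Set X, ∫⁻ x in S, ENNReal.ofReal (‖D u x‖ ^ 2) ∂μ ≠ ⊤ := fun S => by
    exact ((integrable_norm_sq D u).integrableOn (s := S)).lintegral_lt_top.ne
  simp only [h0]
  rw [← ENNReal.toReal_sum fun s _ => hfin _]
  refine ENNReal.toReal_mono (ENNReal.sum_ne_top.2 fun s _ => hfin _) ?_
  classical
  induction P using Finset.induction_on with
  | empty => simp
  | insert s P hs ih =>
    rw [Finset.set_biUnion_insert, Finset.sum_insert hs]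
    exact (lintegral_union_le _ _ _).trans (by gcongr)

/-- Finite overlap: if each point lies in at most `N` of the sets `K s`, then
the sum of the energies over these sets is at most `N` times the energy over their union. -/
theorem sum_localEnergy_le {K : ι → Set X} (hK : ∀ s, MeasurableSet (K s)) {N : ℕ}
    (hN : ∀ x, ∀ Q : Finset ι, (∀ s ∈ Q, x ∈ K s) → Q.card ≤ N) (P : Finset ι) (u : V) :
    ∑ s ∈ P, localEnergy D (K s) u ≤ N * localEnergy D (⋃ s ∈ P, K s) u := by
  classical
  unfold localEnergy
  have hU : MeasurableSet (⋃ s ∈ P, K s) := P.measurableSet_biUnion fun s _ => hK s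
  simp only [← integral_indicator (hK _), ← integral_indicator hU]
  rw [← integral_finsetSum _ fun s _ => (integrable_norm_sq D u).indicator (hK s),
    ← integral_const_mul]
  refine integral_mono (integrable_finsetSum _ fun s _ =>
    (integrable_norm_sq D u).indicator (hK s)) (((integrable_norm_sq D u).indicator hU).const_mul _)
    fun x => ?_
  simp only [indicator_apply]
  rw [← Finset.sum_filter, Finset.sum_const, nsmul_eq_mul]
  rcases (P.filter fun s => x ∈ K s).eq_empty_or_nonempty with h | ⟨s, hs⟩
  · rw [h]
    simp only [Finset.card_empty, Nat.cast_zero, zero_mul]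
    split_ifs <;> positivity
  · have hx : x ∈ ⋃ s ∈ P, K s := by
      simp only [Finset.mem_filter] at hs
      exact mem_biUnion (Finset.mem_coe.2 hs.1) hs.2
    rw [if_pos hx]
    gcongr
    exact hN x _ fun s hs => (Finset.mem_filter.1 hs).2

/-- A decomposition of `X` into finitely many cells, with a neighbour relation, in which each
cell has at most `N` neighbours, and with an increasing sequence of layers of cells. -/
structure CellComplex (μ : Measure X) (ι : Type) (N : ℕ) where
  /-- The cells. -/
  cell : ι → Set X
  measurableSet_cell : ∀ s, MeasurableSet (cell s)
  ae_cover : ∀ᵐ x ∂μ, ∃ s, x ∈ cell s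
  /-- The neighbours of a cell, among them the cell itself. -/
  nb : ι → Finset ι
  mem_nb_self : ∀ s, s ∈ nb s
  mem_nb_comm : ∀ s s', s ∈ nb s' → s' ∈ nb s
  card_nb_le : ∀ s, (nb s).card ≤ N
  mem_nb_of_mem : ∀ x s s', x ∈ cell s → x ∈ cell s' → s' ∈ nb s
  /-- The layers. Only their growth matters: all neighbours of a cell of one layer belong to the
  next. -/
  layer : ℕ → Finset ι
  nb_subset : ∀ j, ∀ s ∈ layer j, nb s ⊆ layer (j + 1)

namespace CellComplex

variable {N : ℕ} (𝒦 : CellComplex μ ι N)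

theorem layer_mono {i j : ℕ} (h : i ≤ j) : 𝒦.layer i ⊆ 𝒦.layer j :=
  monotone_nat_of_le_succ (f := 𝒦.layer)
    (fun j s hs => 𝒦.nb_subset j s hs (𝒦.mem_nb_self s)) h

theorem notMem_layer_of_mem_nb {j : ℕ} {s s' : ι} (hs : s ∉ 𝒦.layer (j + 1)) (h : s' ∈ 𝒦.nb s) :
    s' ∉ 𝒦.layer j :=
  fun h' => hs (𝒦.nb_subset j s' h' (𝒦.mem_nb_comm _ _ h))

theorem card_le_of_mem (x : X) (Q : Finset ι) (h : ∀ s ∈ Q, x ∈ 𝒦.cell s) : Q.card ≤ N := by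
  rcases Q.eq_empty_or_nonempty with rfl | ⟨s, hs⟩
  · simp
  · exact (Finset.card_le_card fun s' hs' => 𝒦.mem_nb_of_mem x s s' (h s hs) (h s' hs')).trans
      (𝒦.card_nb_le s)

/-- A double sum over cells and their neighbours counts each cell at most `N` times. -/
theorem sum_nb_le {f : ι → ℝ} (hf : ∀ s, 0 ≤ f s) {P Q : Finset ι}
    (h : ∀ s ∈ P, 𝒦.nb s ⊆ Q) : ∑ s ∈ P, ∑ s' ∈ 𝒦.nb s, f s' ≤ N * ∑ s ∈ Q, f s := by
  classical
  rw [Finset.sum_comm' (t' := Q) (s' := fun s' => P.filter fun s => s' ∈ 𝒦.nb s)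
    (fun s s' => by
      simp only [Finset.mem_filter]
      exact ⟨fun hh => ⟨hh, h s hh.1 hh.2⟩, fun hh => hh.1⟩), Finset.mul_sum]
  refine Finset.sum_le_sum fun s' _ => ?_
  rw [Finset.sum_const, nsmul_eq_mul]
  gcongr
  · exact hf s'
  · refine (Finset.card_le_card fun s hs => ?_).trans (𝒦.card_nb_le s')
    exact 𝒦.mem_nb_comm _ _ (Finset.mem_filter.1 hs).2

theorem localEnergy_univ_le [Fintype ι] (D : V →ₗ[ℝ] Lp F 2 μ) (u : V) :
    localEnergy D univ u ≤ ∑ s, localEnergy D (𝒦.cell s) u := by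
  have h := localEnergy_biUnion_le D (K := 𝒦.cell) Finset.univ u
  refine le_trans (le_of_eq ?_) h
  unfold localEnergy
  rw [Measure.restrict_congr_set
    (eventuallyEq_univ.2 ?_ : (⋃ s ∈ Finset.univ, 𝒦.cell s) =ᵐ[μ] univ)]
  filter_upwards [𝒦.ae_cover] with x hx
  simpa using hx

variable [Fintype ι] [DecidableEq ι]

/-- The energy outside the layer `m`, cell by cell. -/
def outerEnergy (D : V →ₗ[ℝ] Lp F 2 μ) (φ : V) (m : ℕ) : ℝ :=
  ∑ s ∈ (𝒦.layer m)ᶜ, localEnergy D (𝒦.cell s) φ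

theorem outerEnergy_nonneg (φ : V) (m : ℕ) : 0 ≤ 𝒦.outerEnergy D φ m :=
  Finset.sum_nonneg fun _ _ => localEnergy_nonneg D _ φ

theorem outerEnergy_anti (φ : V) {m n : ℕ} (h : m ≤ n) :
    𝒦.outerEnergy D φ n ≤ 𝒦.outerEnergy D φ m :=
  Finset.sum_le_sum_of_subset_of_nonneg (Finset.compl_subset_compl.2 (𝒦.layer_mono h))
    fun _ _ _ => localEnergy_nonneg D _ φ

theorem sum_ring (φ : V) {m n : ℕ} (h : m ≤ n) :
    ∑ s ∈ 𝒦.layer n \ 𝒦.layer m, localEnergy D (𝒦.cell s) φ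
      = 𝒦.outerEnergy D φ m - 𝒦.outerEnergy D φ n := by
  unfold outerEnergy
  rw [eq_sub_iff_add_eq, ← Finset.sum_union]
  · congr 1
    ext s
    simp only [Finset.mem_union, Finset.mem_sdiff, Finset.mem_compl]
    have : s ∈ 𝒦.layer m → s ∈ 𝒦.layer n := fun hs => 𝒦.layer_mono h hs
    tauto
  · rw [Finset.disjoint_left]
    intro s hs hs'
    simp only [Finset.mem_sdiff, Finset.mem_compl] at hs hs'
    tauto

end CellComplex

/-- The assumptions on a projection `J`, whose kernel is the fine scale space: it is locally stable,
and the cut-off `u` of an element `φ` of the kernel between two consecutive layers has its energy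
controlled locally by that of `φ`. (The function `u` itself need not lie in the kernel.) -/
structure IsLocalProjection {N : ℕ} (𝒦 : CellComplex μ ι N) (J : V →ₗ[ℝ] V) (c₁ c₂ : ℝ) :
    Prop where
  nonneg₁ : 0 ≤ c₁
  nonneg₂ : 0 ≤ c₂
  proj : ∀ u, J (J u) = J u
  stable : ∀ u s, localEnergy D (𝒦.cell s) (J u)
    ≤ c₁ * ∑ s' ∈ 𝒦.nb s, localEnergy D (𝒦.cell s') u
  cutoff : ∀ φ, J φ = 0 → ∀ j, ∃ u,
    (∀ s, localEnergy D (𝒦.cell s) u ≤ c₂ * ∑ s' ∈ 𝒦.nb s, localEnergy D (𝒦.cell s') φ) ∧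
    (∀ s ∈ 𝒦.layer j, localEnergy D (𝒦.cell s) u = 0) ∧
    ∀ s ∉ 𝒦.layer (j + 1), localEnergy D (𝒦.cell s) (φ - u) = 0

variable {D} {N : ℕ} {𝒦 : CellComplex μ ι N} {J : V →ₗ[ℝ] V} {c₁ c₂ : ℝ}

/-- The constant in the ring estimate of `IsLocalProjection.exists_fine_cutoff`. -/
def ringConst (N : ℕ) (c₁ c₂ : ℝ) : ℝ := (2 * c₂ + 2 * (c₁ * c₂)) * N ^ 2

/-- Cutting off an element `φ` of `ker J` and projecting back to `ker J` costs a few layers: the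
result `w` has no energy near the centre, agrees with `φ` far from it, and in between its energy
is controlled by that of `φ`. The complementary part `φ - w` is the projection to
`ker J` of the function `φ - u`, which has no energy outside the layer `m + 4`. -/
theorem IsLocalProjection.exists_fine_cutoff [Fintype ι] [DecidableEq ι]
    (hJ : IsLocalProjection D 𝒦 J c₁ c₂) {φ : V} (hφ : J φ = 0) (m : ℕ) :
    ∃ u w, J w = 0 ∧ φ - w = (φ - u) - J (φ - u) ∧
      (∀ s ∉ 𝒦.layer (m + 4), localEnergy D (𝒦.cell s) (φ - u) = 0) ∧
      (∀ s ∈ 𝒦.layer (m + 2), localEnergy D (𝒦.cell s) w = 0) ∧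
      (∀ s ∉ 𝒦.layer (m + 5), localEnergy D (𝒦.cell s) (φ - w) = 0) ∧
      ∑ s ∈ 𝒦.layer (m + 5) \ 𝒦.layer (m + 2), localEnergy D (𝒦.cell s) w
        ≤ ringConst N c₁ c₂ * (𝒦.outerEnergy D φ m - 𝒦.outerEnergy D φ (m + 7)) := by
  obtain ⟨u, hu, hu0, hu1⟩ := hJ.cutoff φ hφ (m + 3)
  have e0 := fun s u => localEnergy_nonneg D (𝒦.cell s) u
  have hsub : φ - (u - J u) = (φ - u) - J (φ - u) := by
    rw [map_sub, hφ]
    abel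
  refine ⟨u, u - J u, by rw [map_sub, hJ.proj, sub_self], hsub, hu1, fun s hs => ?_,
    fun s hs => ?_, ?_⟩
  · have h1 := localEnergy_sub_le D (𝒦.cell s) u (J u)
    have h2 := hJ.stable u s
    rw [Finset.sum_eq_zero fun s' hs' => hu0 s' (𝒦.nb_subset _ s hs hs')] at h2
    rw [hu0 s (𝒦.layer_mono (by omega) hs)] at h1
    linarith [e0 s (u - J u)]
  · rw [hsub]
    have h1 := localEnergy_sub_le D (𝒦.cell s) (φ - u) (J (φ - u))
    have h2 := hJ.stable (φ - u) s
    rw [Finset.sum_eq_zero fun s' hs' => hu1 s' (𝒦.notMem_layer_of_mem_nb hs hs')] at h2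
    rw [hu1 s fun h => hs (𝒦.layer_mono (by omega) h)] at h1
    linarith [e0 s ((φ - u) - J (φ - u))]
  · set f : ι → ℝ := fun s => ∑ s' ∈ 𝒦.nb s, localEnergy D (𝒦.cell s') φ with hf
    have hf0 : ∀ s, 0 ≤ f s := fun s => Finset.sum_nonneg fun s' _ => e0 s' φ
    have hone : ∀ s, localEnergy D (𝒦.cell s) (u - J u)
        ≤ (2 * c₂ + 2 * (c₁ * c₂)) * ∑ s' ∈ 𝒦.nb s, f s' := fun s => by
      have h1 := localEnergy_sub_le D (𝒦.cell s) u (J u)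
      have h2 := hJ.stable u s
      have h3 : ∑ s' ∈ 𝒦.nb s, localEnergy D (𝒦.cell s') u ≤ c₂ * ∑ s' ∈ 𝒦.nb s, f s' := by
        rw [Finset.mul_sum]
        exact Finset.sum_le_sum fun s' _ => hu s'
      have h4 : f s ≤ ∑ s' ∈ 𝒦.nb s, f s' :=
        Finset.single_le_sum (fun s' _ => hf0 s') (𝒦.mem_nb_self s)
      have h5 := (hu s).trans (mul_le_mul_of_nonneg_left h4 hJ.nonneg₂)
      have h6 := h2.trans (mul_le_mul_of_nonneg_left h3 hJ.nonneg₁)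
      linarith
    have hc : 0 ≤ 2 * c₂ + 2 * (c₁ * c₂) := by
      have := hJ.nonneg₁
      have := hJ.nonneg₂
      positivity
    refine (Finset.sum_le_sum fun s _ => hone s).trans ?_
    rw [← Finset.mul_sum, ← 𝒦.sum_ring D φ (by omega : m ≤ m + 7), ringConst, mul_assoc]
    refine mul_le_mul_of_nonneg_left ?_ hc
    have h1 := 𝒦.sum_nb_le (f := f) hf0 (P := 𝒦.layer (m + 5) \ 𝒦.layer (m + 2))
      (Q := 𝒦.layer (m + 6) \ 𝒦.layer (m + 1)) fun s hs s' hs' => by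
        rw [Finset.mem_sdiff] at hs ⊢
        exact ⟨𝒦.nb_subset _ s hs.1 hs', 𝒦.notMem_layer_of_mem_nb hs.2 hs'⟩
    have h2 := 𝒦.sum_nb_le (f := fun s => localEnergy D (𝒦.cell s) φ) (fun s => e0 s φ)
      (P := 𝒦.layer (m + 6) \ 𝒦.layer (m + 1))
      (Q := 𝒦.layer (m + 7) \ 𝒦.layer m) fun s hs s' hs' => by
        rw [Finset.mem_sdiff] at hs ⊢
        exact ⟨𝒦.nb_subset _ s hs.1 hs', 𝒦.notMem_layer_of_mem_nb hs.2 hs'⟩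
    refine h1.trans ?_
    rw [pow_two, mul_assoc]
    exact mul_le_mul_of_nonneg_left h2 (by positivity)

theorem ringConst_nonneg (hJ : IsLocalProjection D 𝒦 J c₁ c₂) : 0 ≤ ringConst N c₁ c₂ := by
  have := hJ.nonneg₁
  have := hJ.nonneg₂
  unfold ringConst
  positivity

/-- The constant in the estimate `E(m + 7) ≤ C (E(m) - E(m + 7))` for the energies outside the
layers. -/
def decayConst (α β : ℝ) (N : ℕ) (c₁ c₂ : ℝ) : ℝ :=
  N / α * (1 + β ^ 2 / 4 * ringConst N c₁ c₂)

theorem decayConst_nonneg (hα : 0 < α) (hJ : IsLocalProjection D 𝒦 J c₁ c₂) :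
    0 ≤ decayConst α β N c₁ c₂ := by
  have := ringConst_nonneg hJ
  unfold decayConst
  positivity

variable [Fintype ι] [DecidableEq ι]

/-- A hole-filling estimate: an element of `ker J` that is `a`-orthogonal to all
elements of `ker J` without energy on the central cell has outer energy controlled by the
energy in a ring of layers. -/
theorem outerEnergy_hole_filling (hJ : IsLocalProjection D 𝒦 J c₁ c₂) (ha : AEMeasurable a μ)
    (hα : 0 < α) (hab : ∀ᵐ x ∂μ, α ≤ a x ∧ a x ≤ β) {t : ι} (ht : t ∈ 𝒦.layer 0) {φ : V}
    (hφ : J φ = 0)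
    (horth : ∀ w, J w = 0 → localEnergy D (𝒦.cell t) w = 0 → weightedForm D a univ φ w = 0)
    (m : ℕ) :
    𝒦.outerEnergy D φ (m + 7) ≤ decayConst α β N c₁ c₂ *
      (𝒦.outerEnergy D φ m - 𝒦.outerEnergy D φ (m + 7)) := by
  obtain ⟨u, w, hw, -, -, hin, hout, hring⟩ := hJ.exists_fine_cutoff hφ m
  have h0 := horth w hw (hin t (𝒦.layer_mono (Nat.zero_le _) ht))
  set R : Finset ι := 𝒦.layer (m + 5) \ 𝒦.layer (m + 2)
  set O : Set X := ⋃ s ∈ (𝒦.layer (m + 5))ᶜ, 𝒦.cell s with hO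
  have hOm : MeasurableSet O := Finset.measurableSet_biUnion _ fun s _ => 𝒦.measurableSet_cell s
  have hint := integrable_weightedForm D ha hα hab φ w
  -- on the outer cells `w` and `φ` have the same gradient
  have houter : weightedForm D a O φ w = weightedForm D a O φ φ := by
    have hz : localEnergy D O (φ - w) = 0 := by
      refine le_antisymm ((localEnergy_biUnion_le D _ _).trans ?_) (localEnergy_nonneg D _ _)
      exact (Finset.sum_eq_zero fun s hs => hout s (Finset.mem_compl.1 hs)).le
    have h1 := weightedForm_sub_left D ha hα hab O φ w φ
    rw [weightedForm_comm D O (φ - w), weightedForm_eq_zero D hz, weightedForm_comm D O w] at h1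
    linarith
  have hsplit : weightedForm D a O φ w + ∫ x in Oᶜ, a x * inner ℝ (D φ x) (D w x) ∂μ = 0 := by
    rw [← h0]
    unfold weightedForm
    rw [setIntegral_univ, integral_add_compl hOm hint]
  -- the remaining cells either belong to the ring or carry no energy of `w`
  have hlow : -∫ x in Oᶜ, a x * inner ℝ (D φ x) (D w x) ∂μ
      ≤ ∫ x in ⋃ s ∈ R, 𝒦.cell s, ‖D φ x‖ ^ 2 + β ^ 2 / 4 * ‖D w x‖ ^ 2 ∂μ := by
    have hRm : MeasurableSet (⋃ s ∈ R, 𝒦.cell s) :=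
      Finset.measurableSet_biUnion _ fun s _ => 𝒦.measurableSet_cell s
    rw [← integral_neg, ← integral_indicator hOm.compl, ← integral_indicator hRm]
    refine integral_mono_ae (hint.neg.indicator hOm.compl) (((integrable_norm_sq D φ).add
      ((integrable_norm_sq D w).const_mul _)).indicator hRm) ?_
    have hin' : ∀ᵐ x ∂μ, ∀ s, s ∈ 𝒦.layer (m + 2) → x ∈ 𝒦.cell s → D w x = 0 := by
      rw [ae_all_iff]
      intro s
      by_cases hs : s ∈ 𝒦.layer (m + 2)
      · have := ae_eq_zero_of_localEnergy_eq_zero D (hin s hs)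
        rw [ae_restrict_iff' (𝒦.measurableSet_cell s)] at this
        filter_upwards [this] with x hx _ using hx
      · exact ae_of_all _ fun x h => absurd h hs
    filter_upwards [hab, hin', 𝒦.ae_cover] with x hx hx0 hxs
    have hpos : 0 ≤ (⋃ s ∈ R, 𝒦.cell s).indicator
        (fun x => ‖D φ x‖ ^ 2 + β ^ 2 / 4 * ‖D w x‖ ^ 2) x :=
      indicator_nonneg (fun x _ => by positivity) x
    by_cases hxO : x ∈ Oᶜ
    · rw [indicator_of_mem hxO]
      obtain ⟨s, hs⟩ := hxs
      have hs5 : s ∈ 𝒦.layer (m + 5) := by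
        by_contra h
        exact hxO (mem_biUnion (Finset.mem_coe.2 (Finset.mem_compl.2 h)) hs)
      by_cases hs2 : s ∈ 𝒦.layer (m + 2)
      · rw [hx0 s hs2 hs]
        simpa using hpos
      · have hxR : x ∈ ⋃ s ∈ R, 𝒦.cell s :=
          mem_biUnion (Finset.mem_coe.2 (Finset.mem_sdiff.2 ⟨hs5, hs2⟩)) hs
        rw [indicator_of_mem hxR]
        refine (neg_le_abs _).trans ((abs_mul_inner_le (hα.le.trans hx.1) hx.2 _ _).trans ?_)
        nlinarith [sq_nonneg (‖D φ x‖ - β / 2 * ‖D w x‖)]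
    · rw [indicator_of_notMem hxO]
      exact hpos
  have hRint : ∫ x in ⋃ s ∈ R, 𝒦.cell s, ‖D φ x‖ ^ 2 + β ^ 2 / 4 * ‖D w x‖ ^ 2 ∂μ
      ≤ ∑ s ∈ R, localEnergy D (𝒦.cell s) φ
        + β ^ 2 / 4 * ∑ s ∈ R, localEnergy D (𝒦.cell s) w := by
    rw [integral_add (integrable_norm_sq D φ).integrableOn
      ((integrable_norm_sq D w).integrableOn.const_mul _), integral_const_mul]
    have h1 := localEnergy_biUnion_le D (K := 𝒦.cell) R φ
    have h2 := localEnergy_biUnion_le D (K := 𝒦.cell) R w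
    unfold localEnergy at h1 h2 ⊢
    gcongr
  have hco := coercive D ha hα hab O φ
  have hE5 : 𝒦.outerEnergy D φ (m + 5) ≤ N * localEnergy D O φ :=
    sum_localEnergy_le D 𝒦.measurableSet_cell 𝒦.card_le_of_mem _ φ
  have hRφ : ∑ s ∈ R, localEnergy D (𝒦.cell s) φ
      ≤ 𝒦.outerEnergy D φ m - 𝒦.outerEnergy D φ (m + 7) := by
    rw [𝒦.sum_ring D φ (by omega)]
    have := 𝒦.outerEnergy_anti D φ (show m ≤ m + 2 by omega)
    have := 𝒦.outerEnergy_anti D φ (show m + 5 ≤ m + 7 by omega)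
    linarith
  have hE7 := 𝒦.outerEnergy_anti D φ (show m + 5 ≤ m + 7 by omega)
  set Δ := 𝒦.outerEnergy D φ m - 𝒦.outerEnergy D φ (m + 7)
  have hb : β ^ 2 / 4 * ∑ s ∈ R, localEnergy D (𝒦.cell s) w
      ≤ β ^ 2 / 4 * (ringConst N c₁ c₂ * Δ) := by gcongr
  have hfin : localEnergy D O φ ≤ 1 / α * ((1 + β ^ 2 / 4 * ringConst N c₁ c₂) * Δ) := by
    rw [one_div, ← div_eq_inv_mul, le_div_iff₀ hα]
    linarith
  calc 𝒦.outerEnergy D φ (m + 7) ≤ N * localEnergy D O φ := hE7.trans hE5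
    _ ≤ N * (1 / α * ((1 + β ^ 2 / 4 * ringConst N c₁ c₂) * Δ)) := by gcongr
    _ = decayConst α β N c₁ c₂ * Δ := by
      unfold decayConst
      ring

/-- Hole filling turns the estimate by the energy in a ring into a contraction with factor
`C / (1 + C)` per seven layers. -/
theorem outerEnergy_le_pow {C : ℝ} (hC : 0 ≤ C) {φ : V}
    (h : ∀ m, 𝒦.outerEnergy D φ (m + 7)
      ≤ C * (𝒦.outerEnergy D φ m - 𝒦.outerEnergy D φ (m + 7))) (n : ℕ) :
    𝒦.outerEnergy D φ (7 * n) ≤ (C / (1 + C)) ^ n * 𝒦.outerEnergy D φ 0 := by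
  induction n with
  | zero => simp
  | succ n ih =>
    have h1 : 𝒦.outerEnergy D φ (7 * n + 7) ≤ C / (1 + C) * 𝒦.outerEnergy D φ (7 * n) := by
      rw [div_mul_eq_mul_div, le_div_iff₀ (by positivity)]
      linarith [h (7 * n)]
    calc 𝒦.outerEnergy D φ (7 * (n + 1)) ≤ C / (1 + C) * 𝒦.outerEnergy D φ (7 * n) := h1
      _ ≤ C / (1 + C) * ((C / (1 + C)) ^ n * 𝒦.outerEnergy D φ 0) := by gcongr
      _ = _ := by ring

/-- Exponential decay of the localization error: `φ` solves the corrector problem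
with source on the cell `t` in `ker J`, `φk` solves it in a subset `W` of `ker J` that contains
all projections of functions without energy outside the layer `k - 1`. -/
theorem localization_error (hJ : IsLocalProjection D 𝒦 J c₁ c₂) (ha : AEMeasurable a μ)
    (hα : 0 < α) (hab : ∀ᵐ x ∂μ, α ≤ a x ∧ a x ≤ β) {t : ι} (ht : t ∈ 𝒦.layer 0) {v φ φk : V}
    (hφ : J φ = 0)
    (heq : ∀ w, J w = 0 → weightedForm D a univ φ w = weightedForm D a (𝒦.cell t) v w)
    (hφk : J φk = 0) {k : ℕ} (hk : 5 ≤ k) (W : Set V)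
    (hφW : φk ∈ W) (hsub : ∀ u ∈ W, ∀ w ∈ W, u - w ∈ W)
    (hW : ∀ u, (∀ s ∉ 𝒦.layer (k - 1), localEnergy D (𝒦.cell s) u = 0) → u - J u ∈ W)
    (heqk : ∀ w ∈ W, J w = 0 →
      weightedForm D a univ φk w = weightedForm D a (𝒦.cell t) v w) :
    localEnergy D univ (φ - φk) ≤ (β / α) ^ 4 * N * (ringConst N c₁ c₂ + 1) *
      (decayConst α β N c₁ c₂ / (1 + decayConst α β N c₁ c₂)) ^ ((k - 5) / 7) *
        localEnergy D (𝒦.cell t) v := by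
  obtain ⟨m, rfl⟩ : ∃ m, k = m + 5 := ⟨k - 5, by omega⟩
  obtain ⟨u, w, hw, hφw, hu, hin, hout, hring⟩ := hJ.exists_fine_cutoff hφ m
  have hR := ringConst_nonneg hJ
  have hC := decayConst_nonneg (β := β) hα hJ
  -- Galerkin orthogonality and quasi-optimality
  have hw0 : φ - w ∈ W := hφw ▸ hW _ hu
  have hgal : weightedForm D a univ (φ - φk) (φ - w - φk) = 0 := by
    have hJ' : J (φ - w - φk) = 0 := by simp [hφ, hφk, hw]
    rw [weightedForm_sub_left D ha hα hab, heq _ hJ', heqk _ (hsub _ hw0 _ hφW) hJ', sub_self]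
  have herr : localEnergy D univ (φ - φk) ≤ (β / α) ^ 2 * localEnergy D univ w := by
    refine localEnergy_le_of_le_weightedForm D ha hα hab univ _ w ?_
    have h1 := coercive D ha hα hab univ (φ - φk)
    have h2 : weightedForm D a univ (φ - φk) (φ - φk) = weightedForm D a univ (φ - φk) w := by
      have h3 := weightedForm_sub_left D ha hα hab univ (φ - φk) w (φ - φk)
      rw [weightedForm_comm D univ w, weightedForm_comm D univ (φ - φk - w),
        show φ - φk - w = φ - w - φk by abel, hgal] at h3
      linarith
    rwa [h2] at h1
  -- the energy of `w` is controlled by the outer energy of `φ`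
  have hw_le : localEnergy D univ w
      ≤ (ringConst N c₁ c₂ + 1) * 𝒦.outerEnergy D φ m := by
    have h1 := 𝒦.localEnergy_univ_le D w
    have h2 : ∑ s, localEnergy D (𝒦.cell s) w
        = ∑ s ∈ 𝒦.layer (m + 5) \ 𝒦.layer (m + 2), localEnergy D (𝒦.cell s) w
          + ∑ s ∈ (𝒦.layer (m + 5))ᶜ, localEnergy D (𝒦.cell s) w := by
      rw [← Finset.sum_add_sum_compl (𝒦.layer (m + 5)),
        ← Finset.sum_sdiff (𝒦.layer_mono (show m + 2 ≤ m + 5 by omega)),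
        Finset.sum_eq_zero (s := 𝒦.layer (m + 2)) hin, add_zero]
    have h3 : ∑ s ∈ (𝒦.layer (m + 5))ᶜ, localEnergy D (𝒦.cell s) w
        ≤ 𝒦.outerEnergy D φ (m + 5) := by
      refine Finset.sum_le_sum fun s hs => ?_
      have hz := ae_eq_zero_of_localEnergy_eq_zero D (hout s (Finset.mem_compl.1 hs))
      refine le_of_eq (integral_congr_ae ?_)
      rw [map_sub] at hz
      filter_upwards [hz, ae_restrict_of_ae (Lp.coeFn_sub (D φ) (D w))] with x h1 h2
      rw [h2, Pi.sub_apply, sub_eq_zero] at h1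
      rw [h1]
    have h4 := 𝒦.outerEnergy_anti D φ (show m ≤ m + 5 by omega)
    have h5 : ringConst N c₁ c₂ * (𝒦.outerEnergy D φ m - 𝒦.outerEnergy D φ (m + 7))
        ≤ ringConst N c₁ c₂ * 𝒦.outerEnergy D φ m := by
      have := 𝒦.outerEnergy_nonneg D φ (m + 7)
      gcongr
      linarith
    linarith
  have hdecay := fun m => outerEnergy_hole_filling hJ ha hα hab ht hφ (fun w hw hwt => by
    rw [heq w hw, weightedForm_eq_zero D hwt]) m
  have hpow := outerEnergy_le_pow hC hdecay (m / 7)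
  have hm := 𝒦.outerEnergy_anti D φ (show 7 * (m / 7) ≤ m by omega)
  have h0 : 𝒦.outerEnergy D φ 0 ≤ N * localEnergy D univ φ :=
    (sum_localEnergy_le D 𝒦.measurableSet_cell 𝒦.card_le_of_mem _ φ).trans
      (mul_le_mul_of_nonneg_left (localEnergy_mono D (subset_univ _) φ) (by positivity))
  have hφ_le : localEnergy D univ φ ≤ (β / α) ^ 2 * localEnergy D (𝒦.cell t) v := by
    refine localEnergy_le_of_le_weightedForm D ha hα hab _ φ v ?_
    rw [weightedForm_comm D (𝒦.cell t), ← heq φ hφ]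
    exact coercive D ha hα hab univ φ
  set θ := decayConst α β N c₁ c₂ / (1 + decayConst α β N c₁ c₂)
  have hθ : 0 ≤ θ := by positivity
  rw [show m + 5 - 5 = m by omega]
  calc localEnergy D univ (φ - φk) ≤ (β / α) ^ 2 * localEnergy D univ w := herr
    _ ≤ (β / α) ^ 2 * ((ringConst N c₁ c₂ + 1) * (θ ^ (m / 7) *
        (N * ((β / α) ^ 2 * localEnergy D (𝒦.cell t) v)))) := by
      gcongr
      refine hw_le.trans ?_
      gcongr
      refine hm.trans (hpow.trans ?_)
      gcongr
      exact h0.trans (by gcongr)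
    _ = _ := by ring

end Abstract

/-! ### Geometry of shape regular triangulations -/

section Triangulation

theorem isCompact_cell (t : Finset Plane) : IsCompact (cell t) :=
  t.finite_toSet.isCompact_convexHull ℝ

theorem isClosed_cell (t : Finset Plane) : IsClosed (cell t) := (isCompact_cell t).isClosed

theorem convex_cell (t : Finset Plane) : Convex ℝ (cell t) := convex_convexHull ℝ _

theorem volume_frontier_cell (t : Finset Plane) : volume (frontier (cell t)) = 0 :=
  (convex_cell t).addHaar_frontier volume

theorem affineSpan_eq_top_iff {t : Finset Plane} (h : AffineIndependent ℝ ((↑) : t → Plane)) :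
    affineSpan ℝ (t : Set Plane) = ⊤ ↔ t.card = 3 := by
  have := h.affineSpan_eq_top_iff_card_eq_finrank_add_one
  simpa [finrank_euclideanSpace] using this

theorem interior_cell_nonempty {t : Finset Plane} (h : AffineIndependent ℝ ((↑) : t → Plane))
    (hc : t.card = 3) : (interior (cell t)).Nonempty :=
  interior_convexHull_nonempty_iff_affineSpan_eq_top.2 ((affineSpan_eq_top_iff h).2 hc)

/-- By conformity, the intersection of two different triangles is spanned by fewer than three
vertices. -/
theorem IsTriangulation.disjoint_interior {Ω : Set Plane} {𝒯 : Finset (Finset Plane)}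
    (h : IsTriangulation Ω 𝒯) {t t' : Finset Plane} (ht : t ∈ 𝒯) (ht' : t' ∈ 𝒯) (hne : t ≠ t') :
    Disjoint (interior (cell t)) (interior (cell t')) := by
  classical
  rw [disjoint_iff_inter_eq_empty, ← interior_inter, h.conforming t ht t' ht']
  by_contra hn
  rw [← ne_eq, ← nonempty_iff_ne_empty, interior_convexHull_nonempty_iff_affineSpan_eq_top,
    ← Finset.coe_inter] at hn
  have hi : AffineIndependent ℝ ((↑) : ↥(t ∩ t') → Plane) :=
    (h.affineIndependent t ht).mono (by simp)
  rw [affineSpan_eq_top_iff hi] at hn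
  have h1 := Finset.eq_of_subset_of_card_le (Finset.inter_subset_left (s₁ := t) (s₂ := t'))
    (by rw [hn, h.card_eq t ht])
  have h2 := Finset.eq_of_subset_of_card_le (Finset.inter_subset_right (s₁ := t) (s₂ := t'))
    (by rw [hn, h.card_eq t' ht'])
  exact hne (h1.symm.trans h2)

theorem bddAbove_inscribed (t : Finset Plane) :
    BddAbove {r : ℝ | 0 ≤ r ∧ ∃ x, Metric.closedBall x r ⊆ cell t} := by
  refine ⟨Metric.diam (cell t), ?_⟩
  rintro r ⟨hr, x, hx⟩
  have h1 := Metric.diam_mono hx (isCompact_cell t).isBounded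
  rw [Metric.diam_closedBall_eq _ hr] at h1
  linarith

theorem inscribedDiam_pos {t : Finset Plane} (h : AffineIndependent ℝ ((↑) : t → Plane))
    (hc : t.card = 3) : 0 < inscribedDiam t := by
  obtain ⟨x, hx⟩ := interior_cell_nonempty h hc
  obtain ⟨r, hr, hxr⟩ := Metric.nhds_basis_closedBall.mem_iff.1 (mem_interior_iff_mem_nhds.1 hx)
  have := le_csSup (bddAbove_inscribed t) (show r ∈ _ from ⟨hr.le, x, hxr⟩)
  unfold inscribedDiam
  linarith

variable {Ω : Set Plane} {𝒯 : Finset (Finset Plane)} {H γ : ℝ}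

theorem IsQuasiUniform.shape_pos (hT : IsTriangulation Ω 𝒯) (hQ : IsQuasiUniform 𝒯 H γ)
    {t : Finset Plane} (ht : t ∈ 𝒯) : 0 < γ :=
  (div_pos hQ.pos (inscribedDiam_pos (hT.affineIndependent t ht) (hT.card_eq t ht))).trans_le
    (hQ.shapeRegular t ht)

/-- The supremum of the radii of inscribed discs need not be attained by definition, hence the
factor `4` where `2` would do. -/
theorem IsQuasiUniform.exists_closedBall_subset (hT : IsTriangulation Ω 𝒯)
    (hQ : IsQuasiUniform 𝒯 H γ) {t : Finset Plane} (ht : t ∈ 𝒯) :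
    ∃ x, Metric.closedBall x (H / (4 * γ)) ⊆ cell t := by
  have hγ := hQ.shape_pos hT ht
  have hd := inscribedDiam_pos (hT.affineIndependent t ht) (hT.card_eq t ht)
  have hH := hQ.pos
  have h1 : H / (4 * γ) < sSup {r : ℝ | 0 ≤ r ∧ ∃ x, Metric.closedBall x r ⊆ cell t} := by
    have h2 := hQ.shapeRegular t ht
    rw [div_le_iff₀ hd] at h2
    unfold inscribedDiam at h2
    rw [div_lt_iff₀ (by positivity)]
    linarith
  have hne : {r : ℝ | 0 ≤ r ∧ ∃ x, Metric.closedBall x r ⊆ cell t}.Nonempty := by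
    by_contra hn
    rw [not_nonempty_iff_eq_empty] at hn
    simp [inscribedDiam, hn] at hd
  obtain ⟨r, ⟨-, x, hx⟩, hr⟩ := exists_lt_of_lt_csSup hne h1
  exact ⟨x, (Metric.closedBall_subset_closedBall hr.le).trans hx⟩

/-- The bound, in terms of the shape regularity constant, for the number of triangles that meet a
given one. -/
def overlapBound (γ : ℝ) : ℕ := ⌈(8 * γ) ^ 2⌉₊

/-- The neighbours of `t` lie in a disc of radius `2 H`, have disjoint interiors, and contain discs
of radius `H / (4 γ)`; so comparing areas bounds their number. -/
theorem card_meeting_le (hT : IsTriangulation Ω 𝒯) (hQ : IsQuasiUniform 𝒯 H γ)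
    {t : Finset Plane} (ht : t ∈ 𝒯) (P : Finset (Finset Plane)) (hP : P ⊆ 𝒯)
    (hPt : ∀ s ∈ P, (cell t ∩ cell s).Nonempty) : P.card ≤ overlapBound γ := by
  have hγ := hQ.shape_pos hT ht
  have hH := hQ.pos
  set ρ := H / (4 * γ) with hρ
  have hρ0 : 0 < ρ := by positivity
  choose! x hx using fun s (hs : s ∈ 𝒯) => hQ.exists_closedBall_subset hT hs
  have hdist : ∀ s ∈ 𝒯, ∀ p ∈ cell s, ∀ q ∈ cell s, dist p q ≤ H := fun s hs p hp q hq =>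
    (Metric.dist_le_diam_of_mem (isCompact_cell s).isBounded hp hq).trans (hQ.diam_le s hs)
  have hxt : x t ∈ cell t := hx t ht (Metric.mem_closedBall_self hρ0.le)
  have hsub : (⋃ s ∈ P, Metric.ball (x s) ρ) ⊆ Metric.closedBall (x t) (2 * H) := by
    refine iUnion₂_subset fun s hs y hy => ?_
    obtain ⟨z, hzt, hzs⟩ := hPt s hs
    have h1 := hdist s (hP hs) y (hx s (hP hs) (Metric.ball_subset_closedBall hy)) z hzs
    have h2 := hdist t ht z hzt (x t) hxt
    rw [Metric.mem_closedBall]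
    linarith [dist_triangle y z (x t)]
  have hint : ∀ s ∈ P, Metric.ball (x s) ρ ⊆ interior (cell s) := fun s hs =>
    interior_maximal (Metric.ball_subset_closedBall.trans (hx s (hP hs))) Metric.isOpen_ball
  have hvol := measure_mono (μ := (volume : Measure Plane)) hsub
  rw [measure_biUnion_finset (fun s hs s' hs' hne =>
      (hT.disjoint_interior (hP hs) (hP hs') hne).mono (hint s hs) (hint s' hs'))
    (fun s _ => measurableSet_ball),
    Measure.addHaar_closedBall _ _ (by positivity)] at hvol
  simp only [Measure.addHaar_ball volume _ hρ0.le, finrank_euclideanSpace, Fintype.card_fin,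
    Finset.sum_const, nsmul_eq_mul] at hvol
  rw [← mul_assoc, ENNReal.mul_le_mul_iff_left (Metric.measure_ball_pos _ _ one_pos).ne'
    measure_ball_lt_top.ne, ← ENNReal.ofReal_natCast, ← ENNReal.ofReal_mul (by positivity),
    ENNReal.ofReal_le_ofReal_iff (by positivity)] at hvol
  have h8 : (2 * H) ^ 2 = (8 * γ) ^ 2 * ρ ^ 2 := by
    rw [hρ]
    field_simp
    norm_num
  rw [h8] at hvol
  have := le_of_mul_le_mul_right hvol (by positivity)
  exact_mod_cast this.trans (Nat.le_ceil _)

/-! ### Cut-off functions on a triangulation -/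

/-- A function that is `L`-Lipschitz on each of finitely many closed sets is `L`-Lipschitz along
every `M`-Lipschitz path that the sets cover, with respect to the time along the path. By induction
on the number of sets: after the last time that the path is in the set where it starts, this set is
no longer needed. -/
theorem abs_sub_le_along_path {ι : Type} (S : ι → Set Plane) (hS : ∀ s, IsClosed (S s))
    (f : Plane → ℝ) {L M : ℝ} (hL : 0 ≤ L) (g : ℝ → Plane) (b : ℝ) (P : Finset ι)
    (hf : ∀ s ∈ P, ∀ x ∈ S s, ∀ y ∈ S s, |f x - f y| ≤ L * dist x y) (a : ℝ) (hab : a ≤ b)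
    (hg : ∀ x ∈ Icc a b, ∀ y ∈ Icc a b, dist (g x) (g y) ≤ M * |x - y|)
    (hcov : ∀ x ∈ Icc a b, ∃ s ∈ P, g x ∈ S s) :
    |f (g b) - f (g a)| ≤ L * (M * (b - a)) := by
  classical
  induction hn : P.card generalizing P a with
  | zero =>
    obtain ⟨s, hs, -⟩ := hcov a ⟨le_rfl, hab⟩
    rw [Finset.card_eq_zero.1 hn] at hs
    simp at hs
  | succ n ih =>
    obtain ⟨s, hsP, hs⟩ := hcov a ⟨le_rfl, hab⟩
    have hgc : ContinuousOn g (Icc a b) := by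
      have : LipschitzOnWith M.toNNReal g (Icc a b) :=
        LipschitzOnWith.of_dist_le_mul fun x hx y hy => (hg x hx y hy).trans (by
          rw [Real.dist_eq]
          exact mul_le_mul_of_nonneg_right (Real.le_coe_toNNReal M) (abs_nonneg _))
      exact this.continuousOn
    have hE : IsCompact (Icc a b ∩ g ⁻¹' S s) :=
      isCompact_Icc.of_isClosed_subset (hgc.preimage_isClosed_of_isClosed isClosed_Icc (hS s))
        inter_subset_left
    -- `z` is the last parameter of the path in the set it starts from
    obtain ⟨z, ⟨hz, hzs⟩, hmax⟩ := hE.exists_isMaxOn ⟨a, ⟨le_rfl, hab⟩, hs⟩ continuousOn_id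
    have h1 : |f (g z) - f (g a)| ≤ L * (M * (z - a)) := by
      refine (hf s hsP _ hzs _ hs).trans (mul_le_mul_of_nonneg_left ?_ hL)
      have := hg z hz a ⟨le_rfl, hab⟩
      rwa [abs_of_nonneg (by linarith [hz.1])] at this
    rcases hz.2.eq_or_lt with hzb | hzb
    · rwa [hzb] at h1
    have hcov' : ∀ x ∈ Ioc z b, ∃ s' ∈ P.erase s, g x ∈ S s' := fun x hx => by
      have hxI : x ∈ Icc a b := ⟨hz.1.trans hx.1.le, hx.2⟩
      obtain ⟨s', hs', hxs⟩ := hcov x hxI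
      refine ⟨s', Finset.mem_erase.2 ⟨?_, hs'⟩, hxs⟩
      rintro rfl
      exact absurd (hmax ⟨hxI, hxs⟩) (not_le.2 hx.1)
    have hclosed : IsClosed (Icc z b ∩ g ⁻¹' ⋃ s' ∈ P.erase s, S s') :=
      (hgc.mono (Icc_subset_Icc_left hz.1)).preimage_isClosed_of_isClosed isClosed_Icc
        (isClosed_biUnion_finset fun s' _ => hS s')
    have hcov'' : ∀ x ∈ Icc z b, ∃ s' ∈ P.erase s, g x ∈ S s' := fun x hx => by
      have h2 : Ioc z b ⊆ Icc z b ∩ g ⁻¹' ⋃ s' ∈ P.erase s, S s' := fun y hy =>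
        ⟨Ioc_subset_Icc_self hy, by simpa using hcov' y hy⟩
      have h3 := closure_minimal h2 hclosed
      rw [closure_Ioc hzb.ne] at h3
      simpa using (h3 hx).2
    have h2 := ih (P.erase s) (fun s' hs' => hf s' (Finset.mem_of_mem_erase hs')) z hz.2
      (fun x hx y hy => hg x ⟨hz.1.trans hx.1, hx.2⟩ y ⟨hz.1.trans hy.1, hy.2⟩) hcov''
      (by rw [Finset.card_erase_of_mem hsP, hn]; rfl)
    calc |f (g b) - f (g a)| ≤ |f (g b) - f (g z)| + |f (g z) - f (g a)| := abs_sub_le _ _ _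
      _ ≤ L * (M * (b - z)) + L * (M * (z - a)) := add_le_add h2 h1
      _ = L * (M * (b - a)) := by ring

/-- A function with values in `[0, 1]` that on each triangle agrees with an affine function with
Lipschitz constant `L`. Outside the triangulation it is only continuous: the extension serves to
make mollification meaningful. -/
structure IsMeshCutoff (𝒯 : Finset (Finset Plane)) (L : ℝ) (η : Plane → ℝ) : Prop where
  continuous : Continuous η
  mem_Icc : ∀ x, η x ∈ Icc (0 : ℝ) 1
  eqOn : ∀ t ∈ 𝒯, ∃ f : Plane →ᵃ[ℝ] ℝ, (∀ x y, |f x - f y| ≤ L * dist x y) ∧ EqOn η f (cell t)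

theorem exists_affineMap_vertices {t : Finset Plane}
    (h : AffineIndependent ℝ ((↑) : t → Plane)) (hc : t.card = 3) (ν : Plane → ℝ) :
    ∃ f : Plane →ᵃ[ℝ] ℝ, ∀ z ∈ t, f z = ν z := by
  have htop : affineSpan ℝ (range ((↑) : t → Plane)) = ⊤ := by
    simpa using (affineSpan_eq_top_iff h).2 hc
  let b : AffineBasis t ℝ Plane := ⟨(↑), h, htop⟩
  refine ⟨∑ z : t, ν z • b.coord z, fun z hz => ?_⟩
  have happ : ∀ x, (∑ z : t, ν z • b.coord z : Plane →ᵃ[ℝ] ℝ) x = ∑ z : t, ν z * b.coord z x := by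
    intro x
    have : ∀ P : Finset t, (∑ z ∈ P, ν z • b.coord z : Plane →ᵃ[ℝ] ℝ) x
        = ∑ z ∈ P, ν z * b.coord z x := fun P => by
      classical
      induction P using Finset.induction_on with
      | empty => simp
      | insert z P hz ih => simp [Finset.sum_insert hz, ih]
    exact this _
  have hb : ∀ z' : t, b.coord z' z = if z' = ⟨z, hz⟩ then 1 else 0 := fun z' =>
    b.coord_apply z' ⟨z, hz⟩
  rw [happ]
  simp [hb]

/-- Bounds at the vertices carry over to the triangle, by convexity. -/
theorem affineMap_mem_Icc {t : Finset Plane} {f : Plane →ᵃ[ℝ] ℝ} {p q : ℝ}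
    (h : ∀ z ∈ t, f z ∈ Icc p q) : ∀ x ∈ cell t, f x ∈ Icc p q :=
  convexHull_min (s := (t : Set Plane)) (t := f ⁻¹' Icc p q) h ((convex_Icc p q).affine_preimage f)

/-- An affine function with values in `[0, 1]` on a disc of radius `ρ` has Lipschitz constant
`1 / (2 ρ)`. -/
theorem affineMap_lipschitz {f : Plane →ᵃ[ℝ] ℝ} {p : Plane} {ρ : ℝ} (hρ : 0 < ρ)
    (h : ∀ x ∈ Metric.closedBall p ρ, f x ∈ Icc (0 : ℝ) 1) (x y : Plane) :
    |f x - f y| ≤ 1 / (2 * ρ) * dist x y := by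
  have hlin : f x - f y = f.linear (x - y) := by
    rw [← vsub_eq_sub (f x), ← f.linearMap_vsub, vsub_eq_sub]
  rw [hlin, dist_eq_norm]
  set w := x - y
  rcases eq_or_ne w 0 with hw | hw
  · simp [hw]
  have hw' : 0 < ‖w‖ := norm_pos_iff.2 hw
  set c := ρ / ‖w‖ with hc
  have hc0 : 0 < c := by positivity
  have hnorm : ‖c • w‖ = ρ := by
    rw [norm_smul, Real.norm_of_nonneg hc0.le, hc, div_mul_cancel₀ _ hw'.ne']
  have h1 := h (c • w + p) (by simp [hnorm])
  have h2 := h (-(c • w) + p) (by simp [hnorm])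
  have e1 : f (c • w + p) = c * f.linear w + f p := by
    have := f.map_vadd p (c • w)
    simpa using this
  have e2 : f (-(c • w) + p) = -(c * f.linear w) + f p := by
    have := f.map_vadd p (-(c • w))
    simpa using this
  rw [e1] at h1
  rw [e2] at h2
  have h3 : c * |f.linear w| ≤ 1 / 2 := by
    have h4 : |c * f.linear w| = c * |f.linear w| := by rw [abs_mul, abs_of_pos hc0]
    rw [← h4, abs_le]
    constructor <;> linarith [h1.1, h1.2, h2.1, h2.2]
  rw [hc, div_mul_eq_mul_div, div_le_iff₀ hw'] at h3
  rw [div_mul_eq_mul_div, le_div_iff₀ (by positivity)]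
  linarith

/-- The piecewise affine function with prescribed nodal values in `[0, 1]`. Two of its affine pieces
agree on the common vertices, hence, by conformity, on the intersection of their triangles. -/
theorem exists_meshCutoff (hT : IsTriangulation Ω 𝒯) (hQ : IsQuasiUniform 𝒯 H γ)
    (ν : Plane → ℝ) (hν : ∀ z, ν z ∈ Icc (0 : ℝ) 1) :
    ∃ η, IsMeshCutoff 𝒯 (2 * γ / H) η ∧
      ∀ t ∈ 𝒯, ∀ c, (∀ z ∈ t, ν z = c) → ∀ x ∈ cell t, η x = c := by
  classical
  choose! f hf using fun t (ht : t ∈ 𝒯) =>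
    exists_affineMap_vertices (hT.affineIndependent t ht) (hT.card_eq t ht) ν
  have hIcc : ∀ t ∈ 𝒯, ∀ x ∈ cell t, f t x ∈ Icc (0 : ℝ) 1 := fun t ht =>
    affineMap_mem_Icc fun z hz => hf t ht z hz ▸ hν z
  have hagree : ∀ t ∈ 𝒯, ∀ t' ∈ 𝒯, ∀ x ∈ cell t ∩ cell t', f t x = f t' x := by
    intro t ht t' ht' x hx
    rw [hT.conforming t ht t' ht'] at hx
    have hconv : Convex ℝ {x | (f t - f t') x = 0} :=
      (convex_singleton (0 : ℝ)).affine_preimage (f t - f t')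
    have := convexHull_min (s := (t : Set Plane) ∩ t') (t := {x | (f t - f t') x = 0})
      (fun z hz => by simp [hf t ht z hz.1, hf t' ht' z hz.2]) hconv hx
    simpa [sub_eq_zero] using this
  let η₀ : Plane → ℝ := fun x => if h : ∃ t ∈ 𝒯, x ∈ cell t then f h.choose x else 0
  have hη₀ : ∀ t ∈ 𝒯, EqOn η₀ (f t) (cell t) := fun t ht x hx => by
    have h : ∃ t ∈ 𝒯, x ∈ cell t := ⟨t, ht, hx⟩
    simp only [η₀, dif_pos h]
    exact hagree _ h.choose_spec.1 t ht x ⟨h.choose_spec.2, hx⟩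
  have hcov : ∀ x ∈ closure Ω, ∃ t ∈ 𝒯, x ∈ cell t := fun x hx => by
    rw [hT.cover] at hx
    simpa using hx
  have hcl : IsClosed (closure Ω) := isClosed_closure
  have hcont : ContinuousOn η₀ (closure Ω) := by
    have hu : closure Ω = ⋃ t : 𝒯, cell t := by
      rw [hT.cover]
      exact Set.biUnion_eq_iUnion (𝒯 : Set (Finset Plane)) fun t _ => cell t
    rw [hu]
    refine LocallyFinite.continuousOn_iUnion (locallyFinite_of_finite _)
      (fun t => isClosed_cell _) fun t => ?_
    exact ((f t).continuous_of_finiteDimensional.continuousOn).congr (hη₀ t t.2)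
  -- Tietze extension from the closure of the domain to the plane
  obtain ⟨g, hg, hgη⟩ :=
    BoundedContinuousFunction.exists_extension_forall_mem_Icc_of_isClosedEmbedding
    (X := closure Ω) (Y := Plane)
    (BoundedContinuousFunction.ofNormedAddCommGroup (fun x : closure Ω => η₀ x)
      (continuousOn_iff_continuous_domRestrict.1 hcont) 1 (fun x => by
        obtain ⟨t, ht, hxt⟩ := hcov x x.2
        rw [hη₀ t ht hxt, Real.norm_of_nonneg (hIcc t ht x hxt).1]
        exact (hIcc t ht x hxt).2)) (a := 0) (b := 1) (e := (↑))
    (fun x => by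
      obtain ⟨t, ht, hxt⟩ := hcov x x.2
      change η₀ x ∈ Icc 0 1
      exact hη₀ t ht hxt ▸ hIcc t ht x hxt) (by norm_num) hcl.isClosedEmbedding_subtypeVal
  have hgf : ∀ t ∈ 𝒯, EqOn g (f t) (cell t) := fun t ht x hx => by
    have hxΩ : x ∈ closure Ω := hT.cover ▸ mem_biUnion (Finset.mem_coe.2 ht) hx
    have h1 : g x = η₀ x := congrFun hgη ⟨x, hxΩ⟩
    rw [h1, hη₀ t ht hx]
  refine ⟨g, ⟨g.continuous, hg, fun t ht => ⟨f t, ?_, hgf t ht⟩⟩, fun t ht c hc x hx => ?_⟩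
  · obtain ⟨p, hp⟩ := hQ.exists_closedBall_subset hT ht
    have hγ := hQ.shape_pos hT ht
    have hH := hQ.pos
    intro x y
    have h1 := affineMap_lipschitz (f := f t) (p := p) (ρ := H / (4 * γ)) (by positivity)
      (fun x hx => hIcc t ht x (hp hx)) x y
    have e : 1 / (2 * (H / (4 * γ))) = 2 * γ / H := by
      field_simp
      norm_num
    rwa [e] at h1
  · rw [hgf t ht hx]
    have := affineMap_mem_Icc (t := t) (f := f t) (p := c) (q := c)
      (fun z hz => by simp [hf t ht z hz, hc z hz]) x hx
    simpa using this

namespace IsMeshCutoff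

variable {L : ℝ} {η : Plane → ℝ}

theorem abs_sub_le_along_path (hη : IsMeshCutoff 𝒯 L η) (hT : IsTriangulation Ω 𝒯) (hL : 0 ≤ L)
    (g : ℝ → Plane) {a b M : ℝ} (hab : a ≤ b)
    (hg : ∀ x ∈ Icc a b, ∀ y ∈ Icc a b, dist (g x) (g y) ≤ M * |x - y|)
    (hcov : ∀ x ∈ Icc a b, g x ∈ closure Ω) :
    |η (g b) - η (g a)| ≤ L * (M * (b - a)) := by
  refine LODInterface.abs_sub_le_along_path cell isClosed_cell η hL g b 𝒯
    (fun t ht x hx y hy => ?_) a hab hg fun x hx => ?_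
  · obtain ⟨f, hf, he⟩ := hη.eqOn t ht
    rw [he hx, he hy]
    exact hf x y
  · have := hcov x hx
    rw [hT.cover] at this
    simpa using this

theorem dist_le_of_segment (hη : IsMeshCutoff 𝒯 L η) (hT : IsTriangulation Ω 𝒯) (hL : 0 ≤ L)
    {x y : Plane} (h : segment ℝ x y ⊆ closure Ω) : |η y - η x| ≤ L * dist x y := by
  have := hη.abs_sub_le_along_path hT hL (fun s => AffineMap.lineMap x y s) (a := 0) (b := 1)
    (M := dist x y) zero_le_one (fun s _ s' _ => by
      rw [dist_lineMap_lineMap, Real.dist_eq, mul_comm])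
    (fun s hs => h (by rw [segment_eq_image_lineMap]; exact mem_image_of_mem _ hs))
  simpa using this

end IsMeshCutoff

/-! ### Layers of triangles -/

open Classical in
/-- The triangles that meet `s`. -/
def meeting (𝒯 : Finset (Finset Plane)) (s : 𝒯) : Finset 𝒯 :=
  Finset.univ.filter fun s' => (cell s ∩ cell s').Nonempty

/-- The triangles at distance at most `j` from `t` in the graph of meeting triangles. -/
def meshLayer (𝒯 : Finset (Finset Plane)) (t : 𝒯) : ℕ → Finset 𝒯
  | 0 => {t}
  | j + 1 => open Classical in (meshLayer 𝒯 t j).biUnion (meeting 𝒯)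

theorem mem_meeting {s s' : 𝒯} : s' ∈ meeting 𝒯 s ↔ (cell s ∩ cell s').Nonempty := by
  simp [meeting]

theorem neighbors_biUnion (P : Finset 𝒯) :
    neighbors 𝒯 (⋃ s ∈ P, cell s) = open Classical in ⋃ s ∈ P.biUnion (meeting 𝒯), cell s := by
  classical
  ext x
  simp only [neighbors, mem_iUnion, Finset.mem_biUnion, mem_meeting, mem_ofPred_eq, exists_prop]
  constructor
  · rintro ⟨s', ⟨hs', y, hy, hyP⟩, hx⟩
    obtain ⟨s, hs, hys⟩ := mem_iUnion₂.1 hyP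
    exact ⟨⟨s', hs'⟩, ⟨s, hs, y, hys, hy⟩, hx⟩
  · rintro ⟨s', ⟨s, hs, y, hys, hy⟩, hx⟩
    exact ⟨s', ⟨s'.2, y, hy, mem_iUnion₂.2 ⟨s, hs, hys⟩⟩, hx⟩

theorem patch_eq (t : 𝒯) (k : ℕ) : patch 𝒯 k t = ⋃ s ∈ meshLayer 𝒯 t k, cell s := by
  induction k with
  | zero => simp [patch, meshLayer]
  | succ k ih =>
    rw [patch, Function.iterate_succ_apply', ← patch, ih, neighbors_biUnion]
    rfl

theorem patch_one_eq (t : 𝒯) : patch 𝒯 1 t = ⋃ s ∈ meeting 𝒯 t, cell s := by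
  simp [patch_eq, meshLayer]

theorem isClosed_patch (t : 𝒯) (k : ℕ) : IsClosed (patch 𝒯 k t) := by
  rw [patch_eq]
  exact isClosed_biUnion_finset fun s _ => isClosed_cell _

/-- The cut-off function between consecutive layers: its nodal values are `0` at the vertices of the
layer `j` and `1` elsewhere, and a triangle outside the layer `j + 1` has no vertex of the first
kind. -/
theorem exists_layer_cutoff (hT : IsTriangulation Ω 𝒯) (hQ : IsQuasiUniform 𝒯 H γ) (t : 𝒯)
    (j : ℕ) : ∃ η, IsMeshCutoff 𝒯 (2 * γ / H) η ∧
      (∀ s ∈ meshLayer 𝒯 t j, ∀ x ∈ cell s, η x = 0) ∧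
      ∀ s ∉ meshLayer 𝒯 t (j + 1), ∀ x ∈ cell s, η x = 1 := by
  classical
  let ν : Plane → ℝ := fun z => if ∃ s ∈ meshLayer 𝒯 t j, z ∈ (s : Finset Plane) then 0 else 1
  obtain ⟨η, hη, hc⟩ := exists_meshCutoff hT hQ ν fun z => by
    simp only [ν]
    split_ifs <;> simp
  refine ⟨η, hη, fun s hs => hc s s.2 0 fun z hz => ?_, fun s hs => hc s s.2 1 fun z hz => ?_⟩
  · exact if_pos ⟨s, hs, hz⟩
  · refine if_neg ?_
    rintro ⟨s', hs', hz'⟩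
    refine hs (Finset.mem_biUnion.2 ⟨s', hs', mem_meeting.2 ⟨z, ?_, ?_⟩⟩)
    · exact subset_convexHull ℝ _ hz'
    · exact subset_convexHull ℝ _ hz

end Triangulation

/-! ### Weak gradients -/

section WeakGradient

variable {Ω : Set Plane}

theorem gradient_mul_apply {f g : Plane → ℝ} {x : Plane} (hf : DifferentiableAt ℝ f x)
    (hg : DifferentiableAt ℝ g x) :
    gradient (f * g) x = f x • gradient g x + g x • gradient f x := by
  simp only [gradient, fderiv_mul hf hg, map_add, map_smul]

theorem norm_gradient (f : Plane → ℝ) (x : Plane) : ‖gradient f x‖ = ‖fderiv ℝ f x‖ := by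
  simp [gradient]

theorem measurable_gradient (f : Plane → ℝ) : Measurable (gradient f) :=
  (InnerProductSpace.toDual ℝ Plane).symm.continuous.measurable.comp (measurable_fderiv ℝ f)

theorem gradient_eq_zero_of_notMem_tsupport {f : Plane → ℝ} {x : Plane} (hx : x ∉ tsupport f) :
    gradient f x = 0 := by
  have : fderiv ℝ f x = 0 := by
    by_contra h
    exact hx (support_fderiv_subset ℝ h)
  simp [gradient, this]

/-- Weak gradients are local: functions that agree on an open subset have the same weak
gradient there. -/
theorem IsWeakGradient.ae_eq_on {u u' : Plane → ℝ} {G K : Plane → Plane}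
    (h : IsWeakGradient Ω u G) (h' : IsWeakGradient Ω u' K) {O : Set Plane} (hO : IsOpen O)
    (hOΩ : O ⊆ Ω)
    (hu : ∀ᵐ x ∂volume.restrict Ω, x ∈ O → u x = u' x) :
    ∀ᵐ x ∂volume.restrict Ω, x ∈ O → G x = K x := by
  have hloc : LocallyIntegrableOn (G - K) O := by
    refine LocallyIntegrableOn.mono_set ?_ hOΩ
    exact locallyIntegrableOn_of_locallyIntegrable_restrict
      ((h.memLp.sub h'.memLp).locallyIntegrable (by norm_num))
  have key := hO.ae_eq_zero_of_integral_contDiff_smul_eq_zero (μ := volume) hloc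
    fun ψ hψ hψc hψO => by
      have ht : IsTestFunction Ω ψ := ⟨hψ, hψc, hψO.trans hOΩ⟩
      have e0 : ∫ x, ψ x • (G - K) x = ∫ x in Ω, ψ x • (G - K) x :=
        (setIntegral_eq_integral_of_forall_compl_eq_zero fun x hx => by
          rw [image_eq_zero_of_notMem_tsupport fun hx' => hx (ht.tsupport_subset hx'),
            zero_smul]).symm
      have e1 : ∫ x in Ω, ψ x • (G - K) x
          = (∫ x in Ω, ψ x • G x) - ∫ x in Ω, ψ x • K x := by
        rw [← integral_sub]
        · simp [smul_sub]
        · exact memLp_one_iff_integrable.1 (MemLp.smul (p := 2) (q := 2) h.memLp ht.memLp)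
        · exact memLp_one_iff_integrable.1 (MemLp.smul (p := 2) (q := 2) h'.memLp ht.memLp)
      have e2 : ∫ x in Ω, u x • gradient ψ x = ∫ x in Ω, u' x • gradient ψ x := by
        refine integral_congr_ae ?_
        filter_upwards [hu] with x hx
        by_cases hxO : x ∈ O
        · simp only [hx hxO]
        · simp [gradient_eq_zero_of_notMem_tsupport fun hx' => hxO (hψO hx')]
      rw [e0, e1, sub_eq_zero, ← neg_inj, ← h.integral_eq ψ ht, ← h'.integral_eq ψ ht, e2]
  filter_upwards [ae_restrict_of_ae key] with x hx hxO
  exact sub_eq_zero.1 (hx hxO)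

theorem IsWeakGradient.ae_eq {u : Plane → ℝ} {G K : Plane → Plane} (hΩ : IsOpen Ω)
    (h : IsWeakGradient Ω u G) (h' : IsWeakGradient Ω u K) :
    G =ᵐ[volume.restrict Ω] K := by
  filter_upwards [h.ae_eq_on h' hΩ subset_rfl (ae_of_all _ fun _ _ => rfl),
    ae_restrict_mem hΩ.measurableSet] with x hx hxΩ using hx hxΩ

theorem isWeakGradient_weakGrad {u : Plane → ℝ} (h : ∃ G, IsWeakGradient Ω u G) :
    IsWeakGradient Ω u (weakGrad Ω u) := by
  rw [weakGrad, dif_pos h]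
  exact h.choose_spec

theorem IsWeakGradient.weakGrad_ae_eq {u : Plane → ℝ} {G : Plane → Plane} (hΩ : IsOpen Ω)
    (h : IsWeakGradient Ω u G) : weakGrad Ω u =ᵐ[volume.restrict Ω] G :=
  (isWeakGradient_weakGrad ⟨G, h⟩).ae_eq hΩ h

theorem MemEnergySpace.isWeakGradient {Γ : Interface Ω} {v : Plane → ℝ}
    (h : MemEnergySpace Γ v) : IsWeakGradient Ω v (weakGrad Ω v) :=
  isWeakGradient_weakGrad (h.approx.imp fun _ hG => hG.1)

/-- Integration by parts for two test functions, one component at a time. -/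
theorem IsTestFunction.isWeakGradient {χ : Plane → ℝ} (hχ : IsTestFunction Ω χ) :
    IsWeakGradient Ω χ (gradient χ) := by
  refine ⟨hχ.memLp_gradient, fun ψ hψ => ?_⟩
  have hint : ∀ {f g : Plane → ℝ}, IsTestFunction Ω f → IsTestFunction Ω g → ∀ v : Plane,
      Integrable (fun x => f x * fderiv ℝ g x v) volume := fun {f g} hf hg v =>
    Continuous.integrable_of_hasCompactSupport
      (hf.contDiff.continuous.mul ((hg.contDiff.continuous_fderiv (by simp)).clm_apply
        continuous_const))
      (hf.hasCompactSupport.mul_right)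
  have hsupp : ∀ {f : Plane → ℝ}, IsTestFunction Ω f → ∀ x, x ∉ Ω → f x = 0 := fun hf x hx =>
    image_eq_zero_of_notMem_tsupport fun hx' => hx (hf.tsupport_subset hx')
  have i1 : ∀ {f g : Plane → ℝ}, IsTestFunction Ω f → IsTestFunction Ω g →
      Integrable (fun x => f x • gradient g x) (volume.restrict Ω) := fun hf hg =>
    memLp_one_iff_integrable.1 (MemLp.smul (p := 2) (q := 2) hg.memLp_gradient hf.memLp)
  refine ext_inner_left ℝ fun v => ?_
  have hin : ∀ {f g : Plane → ℝ}, IsTestFunction Ω f → IsTestFunction Ω g →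
      inner ℝ v (∫ x in Ω, f x • gradient g x) = ∫ x, f x * fderiv ℝ g x v := fun {f g} hf hg => by
    rw [← integral_inner (i1 hf hg)]
    rw [setIntegral_eq_integral_of_forall_compl_eq_zero fun x hx => by simp [hsupp hf x hx]]
    simp [inner_smul_right, inner_gradient_right]
  rw [inner_neg_right, hin hχ hψ, hin hψ hχ]
  have hd : ∀ {f : Plane → ℝ}, IsTestFunction Ω f → Differentiable ℝ f := fun hf =>
    hf.contDiff.differentiable (by simp)
  rw [integral_mul_fderiv_eq_neg_fderiv_mul_of_integrable]
  · simp only [mul_comm]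
  · simpa only [mul_comm] using hint hψ hχ v
  · exact hint hχ hψ v
  · exact Continuous.integrable_of_hasCompactSupport
      (hχ.contDiff.continuous.mul hψ.contDiff.continuous) hχ.hasCompactSupport.mul_right
  · exact fun x _ => hd hχ x
  · exact fun x _ => hd hψ x

/-- Pairings of an `L²`-convergent sequence with a fixed function of `L²` converge; the fixed factor
may be the scalar or the vector. -/
theorem tendsto_integral_smul {X E : Type} [MeasurableSpace X] [NormedAddCommGroup E]
    [NormedSpace ℝ E] {μ : Measure X} {f : ℕ → X → ℝ} {f₀ : X → ℝ} {g : ℕ → X → E} {g₀ : X → E}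
    (hf : ∀ j, MemLp (f j) 2 μ) (hf₀ : MemLp f₀ 2 μ) (hg : ∀ j, MemLp (g j) 2 μ)
    (hg₀ : MemLp g₀ 2 μ) (h1 : Tendsto (fun j => eLpNorm (f j - f₀) 2 μ) atTop (𝓝 0))
    (h2 : Tendsto (fun j => eLpNorm (g j - g₀) 2 μ) atTop (𝓝 0))
    (h : (∀ j, f j = f₀) ∨ ∀ j, g j = g₀) :
    Tendsto (fun j => ∫ x, f j x • g j x ∂μ) atTop (𝓝 (∫ x, f₀ x • g₀ x ∂μ)) := by
  refine tendsto_integral_of_L1' _ (hf₀.1.smul hg₀.1) (Eventually.of_forall fun j =>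
    memLp_one_iff_integrable.1 (MemLp.smul (p := 2) (q := 2) (hg j) (hf j))) ?_
  rcases h with h | h
  · have h3 := ENNReal.Tendsto.const_mul (a := eLpNorm f₀ 2 μ) h2 (Or.inr hf₀.2.ne)
    rw [mul_zero] at h3
    refine tendsto_of_tendsto_of_tendsto_of_le_of_le tendsto_const_nhds h3 (fun _ => zero_le)
      fun j => ?_
    have e : (fun x => f j x • g j x) - (fun x => f₀ x • g₀ x) = f₀ • (g j - g₀) := by
      funext x
      simp [h j, smul_sub]
    refine (le_of_eq (congrArg (eLpNorm · 1 μ) e)).trans ?_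
    exact eLpNorm_smul_le_mul_eLpNorm ((hg j).sub hg₀).1 hf₀.1
  · have h3 := ENNReal.Tendsto.mul_const (b := eLpNorm g₀ 2 μ) h1 (Or.inr hg₀.2.ne)
    rw [zero_mul] at h3
    refine tendsto_of_tendsto_of_tendsto_of_le_of_le tendsto_const_nhds h3 (fun _ => zero_le)
      fun j => ?_
    have e : (fun x => f j x • g j x) - (fun x => f₀ x • g₀ x) = (f j - f₀) • g₀ := by
      funext x
      simp [h j, sub_smul]
    refine (le_of_eq (congrArg (eLpNorm · 1 μ) e)).trans ?_
    exact eLpNorm_smul_le_mul_eLpNorm hg₀.1 ((hf j).sub hf₀).1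

/-- Weak gradients are closed under `L²` limits of test functions. -/
theorem IsWeakGradient.of_tendsto {u : Plane → ℝ} {G : Plane → Plane} {χ : ℕ → Plane → ℝ}
    (hχ : ∀ j, IsTestFunction Ω (χ j)) (hu : MemLp u 2 (volume.restrict Ω))
    (hG : MemLp G 2 (volume.restrict Ω))
    (h1 : Tendsto (fun j => eLpNorm (χ j - u) 2 (volume.restrict Ω)) atTop (𝓝 0))
    (h2 : Tendsto (fun j => eLpNorm (gradient (χ j) - G) 2 (volume.restrict Ω)) atTop (𝓝 0)) :
    IsWeakGradient Ω u G := by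
  refine ⟨hG, fun ψ hψ => ?_⟩
  have hz : ∀ {E : Type} [NormedAddCommGroup E] (f : Plane → E),
      Tendsto (fun _ : ℕ => eLpNorm (f - f) 2 (volume.restrict Ω)) atTop (𝓝 0) := fun f => by
    simp
  have t1 := tendsto_integral_smul (fun j => (hχ j).memLp) hu (fun _ => hψ.memLp_gradient)
    hψ.memLp_gradient h1 (hz _) (Or.inr fun _ => rfl)
  have t2 := tendsto_integral_smul (fun _ => hψ.memLp) hψ.memLp (fun j => (hχ j).memLp_gradient)
    hG (hz _) h2 (Or.inl fun _ => rfl)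
  have e : ∀ j, ∫ x in Ω, χ j x • gradient ψ x = -∫ x in Ω, ψ x • gradient (χ j) x := fun j =>
    (hχ j).isWeakGradient.integral_eq ψ hψ
  simp only [e] at t1
  exact tendsto_nhds_unique t1 t2.neg

/-- Dominated convergence in `L²` on a finite measure space. -/
theorem tendsto_eLpNorm_zero_of_bounded {X E : Type} [MeasurableSpace X] [NormedAddCommGroup E]
    {μ : Measure X} [IsFiniteMeasure μ] {f : ℕ → X → E} {C : ℝ}
    (hf : ∀ n, AEStronglyMeasurable (f n) μ) (hb : ∀ᶠ n in atTop, ∀ᵐ x ∂μ, ‖f n x‖ ≤ C)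
    (hlim : ∀ᵐ x ∂μ, Tendsto (fun n => f n x) atTop (𝓝 0)) :
    Tendsto (fun n => eLpNorm (f n) 2 μ) atTop (𝓝 0) := by
  have h : Tendsto (fun n => ∫⁻ x, ‖f n x‖ₑ ^ (2 : ℝ) ∂μ) atTop (𝓝 (∫⁻ _, 0 ∂μ)) := by
    refine tendsto_lintegral_filter_of_dominated_convergence'
      (fun _ => ENNReal.ofReal C ^ (2 : ℝ))
      (Eventually.of_forall fun n => (hf n).enorm.pow_const _) ?_ ?_ ?_
    · filter_upwards [hb] with n hn
      filter_upwards [hn] with x hx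
      rw [← ofReal_norm]
      gcongr
    · rw [lintegral_const]
      exact ENNReal.mul_ne_top (by simp) (measure_ne_top _ _)
    · filter_upwards [hlim] with x hx
      have h1 : Tendsto (fun n => ‖f n x‖ₑ) atTop (𝓝 0) := by
        simpa using hx.enorm
      have h2 := ((ENNReal.continuous_rpow_const (y := 2)).tendsto 0).comp h1
      rwa [ENNReal.zero_rpow_of_pos (by norm_num)] at h2
  rw [lintegral_zero] at h
  have h2 := ((ENNReal.continuous_rpow_const (y := 1 / 2)).tendsto 0).comp h
  rw [ENNReal.zero_rpow_of_pos (by norm_num)] at h2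
  refine h2.congr fun n => ?_
  rw [eLpNorm_eq_lintegral_rpow_enorm_toReal (by norm_num) (by norm_num)]
  simp

end WeakGradient

/-! ### Smoothing a cut-off function -/

section Smoothing

section Mollify

open scoped Convolution

/-- The mollification of `η` with a bump function. -/
def mollify (ρ : ContDiffBump (0 : Plane)) (η : Plane → ℝ) : Plane → ℝ :=
  (ρ.normed volume) ⋆[ContinuousLinearMap.lsmul ℝ ℝ, volume] η

variable {ρ : ContDiffBump (0 : Plane)} {η : Plane → ℝ}

theorem contDiff_mollify (hη : Continuous η) : ContDiff ℝ ∞ (mollify ρ η) :=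
  ρ.hasCompactSupport_normed.contDiff_convolution_left _ ρ.contDiff_normed hη.locallyIntegrable

/-- If all differences of `η` with increment `y - x` near `x` are within `B` of `c`, then so is the
difference of the mollification, which is an average of them. -/
theorem abs_mollify_sub_le (hη : Continuous η) {x y : Plane} {c B : ℝ}
    (h : ∀ t ∈ Metric.ball (0 : Plane) ρ.rOut, |η (y - t) - η (x - t) - c| ≤ B) :
    |mollify ρ η y - mollify ρ η x - c| ≤ B := by
  have hint : ∀ z, Integrable (fun t => ρ.normed volume t * η (z - t)) volume := fun z =>
    Continuous.integrable_of_hasCompactSupport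
      (ρ.continuous_normed.mul (hη.comp (continuous_const.sub continuous_id)))
      ρ.hasCompactSupport_normed.mul_right
  have hone : ∀ b : ℝ, ∫ t, ρ.normed volume t * b ∂volume = b := fun b => by
    rw [integral_mul_const, ρ.integral_normed, one_mul]
  have hi : Integrable (ρ.normed volume) volume :=
    ρ.continuous_normed.integrable_of_hasCompactSupport ρ.hasCompactSupport_normed
  have e : mollify ρ η y - mollify ρ η x - c
      = ∫ t, ρ.normed volume t * (η (y - t) - η (x - t) - c) ∂volume := by
    have h1 := integral_sub ((hint y).sub (hint x)) (hi.mul_const c)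
    have h2 := integral_sub (hint y) (hint x)
    simp only [Pi.sub_apply] at h1
    simp only [mul_sub]
    rw [h1, h2, hone c]
    rfl
  rw [e, ← Real.norm_eq_abs]
  refine (norm_integral_le_of_norm_le (hi.mul_const B) (ae_of_all _ fun t => ?_)).trans_eq (hone B)
  rw [norm_mul, Real.norm_of_nonneg (ρ.nonneg_normed t)]
  by_cases ht : t ∈ Metric.ball (0 : Plane) ρ.rOut
  · exact mul_le_mul_of_nonneg_left (h t ht) (ρ.nonneg_normed t)
  · rw [← ρ.support_normed_eq (μ := volume), Function.notMem_support] at ht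
    simp [ht]

end Mollify

/-- A sequence of bump functions whose supports shrink to the origin. -/
def bumpSeq (n : ℕ) : ContDiffBump (0 : Plane) where
  rIn := 1 / (2 * (n + 1))
  rOut := 1 / (n + 1)
  rIn_pos := by positivity
  rIn_lt_rOut := by
    apply one_div_lt_one_div_of_lt <;> linarith [(by positivity : (0 : ℝ) < n + 1)]

theorem tendsto_bumpSeq_rOut : Tendsto (fun n => (bumpSeq n).rOut) atTop (𝓝 0) :=
  tendsto_one_div_add_atTop_nhds_zero_nat

theorem eventually_rOut_lt {δ : ℝ} (hδ : 0 < δ) : ∀ᶠ n in atTop, (bumpSeq n).rOut < δ :=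
  tendsto_bumpSeq_rOut.eventually_lt_const hδ

variable {Ω : Set Plane} {𝒯 : Finset (Finset Plane)} {L : ℝ} {η : Plane → ℝ}

/-- Almost every point lies in the interior of a triangle. -/
theorem IsTriangulation.ae_mem_interior (hT : IsTriangulation Ω 𝒯) :
    ∀ᵐ x ∂volume.restrict Ω, ∃ t ∈ 𝒯, x ∈ interior (cell t) := by
  have h : ∀ᵐ x : Plane, ∀ t ∈ 𝒯, x ∉ frontier (cell t) := by
    exact (ae_ball_iff (S := (𝒯 : Set (Finset Plane))) 𝒯.countable_toSet).2
      fun t _ => measure_eq_zero_iff_ae_notMem.1 (volume_frontier_cell t)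
  refine ae_restrict_of_ae_restrict_of_subset (t := closure Ω) subset_closure ?_
  filter_upwards [ae_restrict_of_ae h, ae_restrict_mem isClosed_closure.measurableSet]
    with x hx hxΩ
  rw [hT.cover] at hxΩ
  obtain ⟨t, ht, hxt⟩ := mem_iUnion₂.1 hxΩ
  refine ⟨t, ht, ?_⟩
  by_contra hn
  exact hx t ht ⟨subset_closure hxt, hn⟩

namespace IsMeshCutoff

theorem norm_gradient_le (hη : IsMeshCutoff 𝒯 L η) (hT : IsTriangulation Ω 𝒯) (hL : 0 ≤ L)
    (hΩ : IsOpen Ω) {x : Plane} (hx : x ∈ Ω) : ‖gradient η x‖ ≤ L := by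
  rw [norm_gradient]
  obtain ⟨r, hr, hball⟩ := Metric.isOpen_iff.1 hΩ x hx
  refine norm_fderiv_le_of_lip' ℝ hL ?_
  filter_upwards [Metric.ball_mem_nhds x hr] with y hy
  rw [Real.norm_eq_abs, ← dist_eq_norm, dist_comm]
  refine hη.dist_le_of_segment hT hL (Subset.trans ?_ (hball.trans subset_closure))
  exact (convex_ball x r).segment_subset (Metric.mem_ball_self hr) hy

/-- In the interior of a triangle the mollifications eventually differ from the cut-off function
by a constant, because the mollification of an affine function is affine with the same slope. -/
theorem gradient_mollify_eq (hη : IsMeshCutoff 𝒯 L η) {t : Finset Plane} (ht : t ∈ 𝒯) {x : Plane}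
    (hx : x ∈ interior (cell t)) :
    ∀ᶠ n in atTop, gradient (mollify (bumpSeq n) η) x = gradient η x := by
  obtain ⟨f, -, hf⟩ := hη.eqOn t ht
  obtain ⟨r, hr, hball⟩ := Metric.isOpen_iff.1 isOpen_interior x hx
  have hball' : Metric.ball x r ⊆ cell t := hball.trans interior_subset
  filter_upwards [eventually_rOut_lt (half_pos hr)] with n hn
  have hlin : ∀ p q, f p - f q = f.linear (p - q) := fun p q => by
    rw [← vsub_eq_sub (f p), ← f.linearMap_vsub, vsub_eq_sub]
  have heq : mollify (bumpSeq n) η =ᶠ[𝓝 x] fun y => η y + (mollify (bumpSeq n) η x - η x) := by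
    filter_upwards [Metric.ball_mem_nhds x (half_pos hr)] with y hy
    have hmem : ∀ s ∈ Metric.ball (0 : Plane) (bumpSeq n).rOut, ∀ z ∈ Metric.ball x (r / 2),
        z - s ∈ cell t := fun s hs z hz => hball' (by
      rw [mem_ball_zero_iff] at hs
      rw [Metric.mem_ball, dist_eq_norm] at hz ⊢
      have := norm_sub_le (z - x) s
      rw [sub_right_comm]
      linarith)
    have hxx := Metric.mem_ball_self (x := x) (half_pos hr)
    have hle := abs_mollify_sub_le (ρ := bumpSeq n) hη.continuous (x := x) (y := y)
      (c := f.linear (y - x)) (B := 0) fun s hs => by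
        rw [hf (hmem s hs y hy), hf (hmem s hs x hxx), hlin]
        simp
    have h1 := abs_nonpos_iff.1 hle
    have h2 : η y - η x = f.linear (y - x) := by
      rw [hf (hball' (Metric.ball_subset_ball (by linarith) hy)),
        hf (hball' (Metric.ball_subset_ball (by linarith) hxx)), hlin]
    linarith
  rw [heq.gradient_eq, gradient, fderiv_add_const, gradient]

variable {K : Set Plane}

/-- Only on compact subsets of the domain: near the boundary the mollification sees values of `η`
outside the triangulation. -/
theorem eventually_norm_gradient_mollify_le (hη : IsMeshCutoff 𝒯 L η) (hT : IsTriangulation Ω 𝒯)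
    (hL : 0 ≤ L) (hΩ : IsOpen Ω) (hK : IsCompact K) (hKΩ : K ⊆ Ω) :
    ∀ᶠ n in atTop, ∀ x ∈ K, ‖gradient (mollify (bumpSeq n) η) x‖ ≤ L := by
  obtain ⟨δ, hδ, hsub⟩ := hK.exists_cthickening_subset_open hΩ hKΩ
  filter_upwards [eventually_rOut_lt (half_pos hδ)] with n hn x hx
  rw [norm_gradient]
  refine norm_fderiv_le_of_lip' ℝ hL ?_
  filter_upwards [Metric.ball_mem_nhds x (half_pos hδ)] with y hy
  have hball : Metric.ball x δ ⊆ Ω :=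
    Metric.ball_subset_closedBall.trans ((Metric.closedBall_subset_cthickening hx δ).trans hsub)
  have := abs_mollify_sub_le (ρ := bumpSeq n) hη.continuous (x := x) (y := y) (c := 0)
    (B := L * ‖y - x‖) fun s hs => by
      have hmem : ∀ z ∈ Metric.ball x (δ / 2), z - s ∈ Metric.ball x δ := fun z hz => by
        rw [mem_ball_zero_iff] at hs
        rw [Metric.mem_ball, dist_eq_norm] at hz ⊢
        have := norm_sub_le (z - x) s
        rw [sub_right_comm]
        linarith
      have h1 := hη.dist_le_of_segment hT hL (x := x - s) (y := y - s)
        (((convex_ball x δ).segment_subset (hmem x (Metric.mem_ball_self (half_pos hδ)))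
          (hmem y hy)).trans (hball.trans subset_closure))
      rw [dist_comm, dist_eq_norm, sub_sub_sub_cancel_right] at h1
      rwa [sub_zero]
  rwa [sub_zero] at this

end IsMeshCutoff

theorem tendsto_mollify (hη : Continuous η) (x : Plane) :
    Tendsto (fun n => mollify (bumpSeq n) η x) atTop (𝓝 (η x)) :=
  ContDiffBump.convolution_tendsto_right_of_continuous tendsto_bumpSeq_rOut hη x

theorem IsMeshCutoff.mollify_mem_Icc (hη : IsMeshCutoff 𝒯 L η) (ρ : ContDiffBump (0 : Plane))
    (x : Plane) : mollify ρ η x ∈ Icc (0 : ℝ) 1 := by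
  have hi : Integrable (ρ.normed volume) volume :=
    ρ.continuous_normed.integrable_of_hasCompactSupport ρ.hasCompactSupport_normed
  refine ⟨integral_nonneg fun t => mul_nonneg (ρ.nonneg_normed t) (hη.mem_Icc _).1, ?_⟩
  rw [← ρ.integral_normed (μ := volume)]
  refine integral_mono (Continuous.integrable_of_hasCompactSupport
      (ρ.continuous_normed.mul (hη.continuous.comp (continuous_const.sub continuous_id)))
      ρ.hasCompactSupport_normed.mul_right) hi fun t => ?_
  exact mul_le_of_le_one_right (ρ.nonneg_normed t) (hη.mem_Icc _).2

/-- The product of a test function with a mollified cut-off function. -/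
theorem IsTestFunction.mollify_mul {ψ : Plane → ℝ} (hψ : IsTestFunction Ω ψ)
    (hη : Continuous η) (ρ : ContDiffBump (0 : Plane)) :
    IsTestFunction Ω (mollify ρ η * ψ) :=
  ⟨(contDiff_mollify hη).mul hψ.contDiff, hψ.hasCompactSupport.mul_left,
    (tsupport_mul_subset_right).trans hψ.tsupport_subset⟩

/-- The gradient of the product of a cut-off function `η` with a function with gradient `G`. -/
def productGradient (η v : Plane → ℝ) (G : Plane → Plane) : Plane → Plane :=
  fun x => η x • G x + v x • gradient η x

theorem isFiniteMeasure_restrict_of_isBounded (hb : Bornology.IsBounded Ω) :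
    IsFiniteMeasure (volume.restrict Ω) :=
  ⟨by simpa using hb.measure_lt_top⟩

theorem IsMeshCutoff.norm_le_one (hη : IsMeshCutoff 𝒯 L η) (x : Plane) : ‖η x‖ ≤ 1 := by
  rw [Real.norm_of_nonneg (hη.mem_Icc x).1]
  exact (hη.mem_Icc x).2

theorem IsMeshCutoff.norm_mollify_sub_le (hη : IsMeshCutoff 𝒯 L η) (ρ : ContDiffBump (0 : Plane))
    (x : Plane) : ‖mollify ρ η x - η x‖ ≤ 1 := by
  have h1 := hη.mollify_mem_Icc ρ x
  have h2 := hη.mem_Icc x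
  rw [Real.norm_eq_abs, abs_le]
  constructor <;> linarith [h1.1, h1.2, h2.1, h2.2]

variable {ψ : Plane → ℝ}

theorem IsTestFunction.exists_bound (hψ : IsTestFunction Ω ψ) :
    ∃ C, 0 ≤ C ∧ ∀ x, ‖ψ x‖ ≤ C ∧ ‖gradient ψ x‖ ≤ C := by
  obtain ⟨C, hC⟩ := hψ.contDiff.continuous.bounded_above_of_compact_support hψ.hasCompactSupport
  obtain ⟨C', hC'⟩ := (hψ.contDiff.continuous_fderiv (by simp)).bounded_above_of_compact_support
    (hψ.hasCompactSupport.fderiv (𝕜 := ℝ))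
  exact ⟨max C C', (norm_nonneg _).trans ((hC 0).trans (le_max_left _ _)), fun x =>
    ⟨(hC x).trans (le_max_left _ _), by
      rw [norm_gradient]
      exact (hC' x).trans (le_max_right _ _)⟩⟩

theorem tendsto_mollify_mul_eLpNorm {X : Type} [MeasurableSpace X] {μ : Measure X}
    [IsFiniteMeasure μ] (hη : IsMeshCutoff 𝒯 L η) (hψ : IsTestFunction Ω ψ) (p : X → Plane)
    (hp : AEMeasurable p μ) :
    Tendsto (fun n => eLpNorm ((mollify (bumpSeq n) η * ψ) ∘ p - (η * ψ) ∘ p) 2 μ)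
      atTop (𝓝 0) := by
  obtain ⟨C, hC0, hC⟩ := hψ.exists_bound
  have e : ∀ n, (mollify (bumpSeq n) η * ψ) ∘ p - (η * ψ) ∘ p
      = fun x => (mollify (bumpSeq n) η (p x) - η (p x)) * ψ (p x) := fun n => by
    funext x
    simp [sub_mul]
  simp only [e]
  refine tendsto_eLpNorm_zero_of_bounded (C := 1 * C) (fun n => ?_)
    (Eventually.of_forall fun n => ae_of_all _ fun x => ?_) (ae_of_all _ fun x => ?_)
  · have hc : Continuous fun x => (mollify (bumpSeq n) η x - η x) * ψ x :=
      ((contDiff_mollify hη.continuous).continuous.sub hη.continuous).mul hψ.contDiff.continuous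
    exact (hc.measurable.comp_aemeasurable hp).aestronglyMeasurable
  · rw [norm_mul]
    exact mul_le_mul (hη.norm_mollify_sub_le _ _) (hC _).1 (norm_nonneg _) zero_le_one
  · have := ((tendsto_mollify hη.continuous (p x)).sub_const (η (p x))).mul_const (ψ (p x))
    simpa using this

/-- For a test function `ψ`, the gradients of the smooth approximations of `η ψ` converge in `L²`:
they converge in the interior of each triangle, and they are bounded on the support of `ψ`
because `η` is Lipschitz continuous near that compact set. -/
theorem tendsto_gradient_mollify_mul (hΩ : IsOpen Ω) (hb : Bornology.IsBounded Ω)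
    (hT : IsTriangulation Ω 𝒯) (hη : IsMeshCutoff 𝒯 L η) (hL : 0 ≤ L)
    (hψ : IsTestFunction Ω ψ) :
    Tendsto (fun n => eLpNorm (gradient (mollify (bumpSeq n) η * ψ)
      - productGradient η ψ (gradient ψ)) 2 (volume.restrict Ω)) atTop (𝓝 0) := by
  have := isFiniteMeasure_restrict_of_isBounded hb
  obtain ⟨C, hC0, hC⟩ := hψ.exists_bound
  have hψd := hψ.contDiff.differentiable (by simp)
  have hmd : ∀ n, Differentiable ℝ (mollify (bumpSeq n) η) := fun n =>
    (contDiff_mollify hη.continuous).differentiable (by simp)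
  have e : ∀ n, gradient (mollify (bumpSeq n) η * ψ) - productGradient η ψ (gradient ψ)
      = fun x => (mollify (bumpSeq n) η x - η x) • gradient ψ x
        + ψ x • (gradient (mollify (bumpSeq n) η) x - gradient η x) := fun n => by
    funext x
    simp only [Pi.sub_apply, productGradient, gradient_mul_apply (hmd n x) (hψd x)]
    module
  simp only [e]
  refine tendsto_eLpNorm_zero_of_bounded (C := 1 * C + C * (L + L)) (fun n => ?_) ?_ ?_
  · exact ((((contDiff_mollify hη.continuous).continuous.sub hη.continuous).measurable.smul
      (measurable_gradient _)).add (hψ.contDiff.continuous.measurable.smul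
      ((measurable_gradient _).sub (measurable_gradient _)))).aestronglyMeasurable
  · filter_upwards [hη.eventually_norm_gradient_mollify_le hT hL hΩ hψ.hasCompactSupport.isCompact
      hψ.tsupport_subset] with n hn
    refine ae_of_all _ fun x => (norm_add_le _ _).trans ?_
    rw [norm_smul, norm_smul]
    refine add_le_add (mul_le_mul (hη.norm_mollify_sub_le _ _) (hC x).2 (norm_nonneg _)
      zero_le_one) ?_
    by_cases hx : x ∈ tsupport ψ
    · refine mul_le_mul (hC x).1 ((norm_sub_le _ _).trans (add_le_add (hn x hx) ?_))
        (norm_nonneg _) hC0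
      exact hη.norm_gradient_le hT hL hΩ (hψ.tsupport_subset hx)
    · rw [image_eq_zero_of_notMem_tsupport hx, norm_zero, zero_mul]
      positivity
  · filter_upwards [hT.ae_mem_interior] with x ⟨t, ht, hx⟩
    have h1 := ((tendsto_mollify hη.continuous x).sub_const (η x)).smul_const (gradient ψ x)
    have h2 : Tendsto (fun n => ψ x • (gradient (mollify (bumpSeq n) η) x - gradient η x)) atTop
        (𝓝 0) := by
      refine tendsto_const_nhds.congr' ?_
      filter_upwards [hη.gradient_mollify_eq ht hx] with n hn
      rw [hn, sub_self, smul_zero]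
    simpa using h1.add h2

end Smoothing

/-! ### Cutting off functions of the energy space -/

section CutOff

variable {Ω : Set Plane} {𝒯 : Finset (Finset Plane)} {L : ℝ} {η : Plane → ℝ} {Γ : Interface Ω}

theorem dist_curve_le (i : Fin Γ.n) {s s' : ℝ} (hs : s ∈ Icc 0 (Γ.length i))
    (hs' : s' ∈ Icc 0 (Γ.length i)) : dist (Γ.curve i s) (Γ.curve i s') ≤ 1 * |s - s'| := by
  rw [dist_eq_norm, ← Real.norm_eq_abs]
  exact (convex_Icc _ _).norm_image_sub_le_of_norm_derivWithin_le
    ((Γ.contDiffOn i).differentiableOn (by simp)) (fun x hx => (Γ.unit_speed i x hx).le) hs' hs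

theorem curve_mem_closure (i : Fin Γ.n) {s : ℝ} (hs : s ∈ Icc 0 (Γ.length i)) :
    Γ.curve i s ∈ closure Ω := by
  have h : MapsTo (Γ.curve i) (Ioo 0 (Γ.length i)) Ω := Γ.mem_domain i
  rw [← closure_Ioo (Γ.length_pos i).ne] at hs
  have hc : ContinuousOn (Γ.curve i) (closure (Ioo 0 (Γ.length i))) := by
    rw [closure_Ioo (Γ.length_pos i).ne]
    exact curve_continuousOn i
  exact h.closure_of_continuousOn hc hs

theorem aemeasurable_curve (i : Fin Γ.n) :
    AEMeasurable (Γ.curve i) (volume.restrict (Icc 0 (Γ.length i))) :=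
  (curve_continuousOn i).aemeasurable measurableSet_Icc

/-- Along a curve the cut-off function is Lipschitz in the arc length, since the curve is itself
a path that the triangles cover. -/
theorem IsMeshCutoff.lipschitzOnWith_restr (hη : IsMeshCutoff 𝒯 L η) (hT : IsTriangulation Ω 𝒯)
    (hL : 0 ≤ L) (i : Fin Γ.n) :
    LipschitzOnWith L.toNNReal (Γ.restr η i) (Icc 0 (Γ.length i)) := by
  have key : ∀ x ∈ Icc 0 (Γ.length i), ∀ y ∈ Icc 0 (Γ.length i), x ≤ y →
      dist (Γ.restr η i y) (Γ.restr η i x) ≤ L * dist y x := fun x hx y hy hxy => by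
    have hsub : Icc x y ⊆ Icc 0 (Γ.length i) := Icc_subset_Icc hx.1 hy.2
    have := hη.abs_sub_le_along_path hT hL (Γ.curve i) hxy
      (fun s hs s' hs' => dist_curve_le i (hsub hs) (hsub hs'))
      (fun s hs => curve_mem_closure i (hsub hs))
    rw [Real.dist_eq y x, abs_of_nonneg (sub_nonneg.2 hxy), Real.dist_eq]
    simpa [Interface.restr] using this
  refine LipschitzOnWith.of_dist_le_mul fun x hx y hy => ?_
  rw [Real.coe_toNNReal L hL]
  rcases le_total x y with h | h
  · rw [dist_comm, dist_comm x y]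
    exact key x hx y hy h
  · exact key y hy x hx h

theorem IsMeshCutoff.absolutelyContinuous_restr (hη : IsMeshCutoff 𝒯 L η)
    (hT : IsTriangulation Ω 𝒯) (hL : 0 ≤ L) (i : Fin Γ.n) :
    AbsolutelyContinuousOnInterval (Γ.restr η i) 0 (Γ.length i) := by
  refine LipschitzOnWith.absolutelyContinuousOnInterval (K := L.toNNReal) ?_
  rw [uIcc_of_le (Γ.length_pos i).le]
  exact hη.lipschitzOnWith_restr hT hL i

theorem ae_mem_Ioo (i : Fin Γ.n) :
    ∀ᵐ s ∂volume.restrict (Icc 0 (Γ.length i)), s ∈ Ioo 0 (Γ.length i) := by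
  rw [Measure.restrict_congr_set Ioo_ae_eq_Icc.symm]
  exact ae_restrict_mem measurableSet_Ioo

theorem IsMeshCutoff.ae_abs_tanDeriv_le (hη : IsMeshCutoff 𝒯 L η) (hT : IsTriangulation Ω 𝒯)
    (hL : 0 ≤ L) (i : Fin Γ.n) :
    ∀ᵐ s ∂volume.restrict (Icc 0 (Γ.length i)), |Γ.tanDeriv η i s| ≤ L := by
  filter_upwards [ae_mem_Ioo i] with s hs
  have := norm_deriv_le_of_lipschitzOn (Icc_mem_nhds hs.1 hs.2)
    (hη.lipschitzOnWith_restr hT hL i)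
  rwa [Real.coe_toNNReal L hL] at this

theorem ae_tanDeriv_mul (hη : IsMeshCutoff 𝒯 L η) (hT : IsTriangulation Ω 𝒯) (hL : 0 ≤ L)
    {v : Plane → ℝ} (hv : MemEnergySpace Γ v) (i : Fin Γ.n) :
    ∀ᵐ s ∂volume.restrict (Icc 0 (Γ.length i)), Γ.tanDeriv (η * v) i s
      = Γ.restr η i s * Γ.tanDeriv v i s + Γ.restr v i s * Γ.tanDeriv η i s := by
  filter_upwards [ae_differentiableAt_restr i (hv.absCont i),
    ae_differentiableAt_restr i (hη.absolutelyContinuous_restr hT hL i)] with s h1 h2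
  have : Γ.tanDeriv (η * v) i s = deriv (fun s => Γ.restr η i s * Γ.restr v i s) s := rfl
  rw [this, deriv_fun_mul h2 h1]
  unfold Interface.tanDeriv
  ring

theorem tendsto_eLpNorm_of_close {X E : Type} [MeasurableSpace X] [NormedAddCommGroup E]
    {μ : Measure X} {a b : ℕ → X → E} {c : X → E}
    (h1 : ∀ j, AEStronglyMeasurable (a j - b j) μ) (h2 : ∀ j, AEStronglyMeasurable (b j - c) μ)
    (hab : ∀ j, eLpNorm (a j - b j) 2 μ ≤ (j : ℝ≥0∞)⁻¹)
    (hbc : Tendsto (fun j => eLpNorm (b j - c) 2 μ) atTop (𝓝 0)) :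
    Tendsto (fun j => eLpNorm (a j - c) 2 μ) atTop (𝓝 0) := by
  have h := ENNReal.tendsto_inv_nat_nhds_zero.add hbc
  rw [add_zero] at h
  refine tendsto_of_tendsto_of_tendsto_of_le_of_le tendsto_const_nhds h (fun _ => zero_le)
    fun j => ?_
  have e : a j - c = (a j - b j) + (b j - c) := by abel
  simp only [e]
  exact (eLpNorm_add_le (h1 j) (h2 j) (by norm_num)).trans (by gcongr; exact hab j)

theorem tendsto_eLpNorm_smul_of_bounded {X E : Type} [MeasurableSpace X] [NormedAddCommGroup E]
    [NormedSpace ℝ E] {μ : Measure X} {g : X → ℝ} {C : ℝ} (hg : ∀ᵐ x ∂μ, ‖g x‖ ≤ C)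
    {f : ℕ → X → E}
    (hf : Tendsto (fun j => eLpNorm (f j) 2 μ) atTop (𝓝 0)) :
    Tendsto (fun j => eLpNorm (g • f j) 2 μ) atTop (𝓝 0) := by
  have h := ENNReal.Tendsto.const_mul (a := ENNReal.ofReal C) hf (Or.inr ENNReal.ofReal_ne_top)
  rw [mul_zero] at h
  refine tendsto_of_tendsto_of_tendsto_of_le_of_le tendsto_const_nhds h (fun _ => zero_le)
    fun j => eLpNorm_le_mul_eLpNorm_of_ae_le_mul ?_ 2
  filter_upwards [hg] with x hx
  rw [Pi.smul_apply', norm_smul]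
  exact mul_le_mul_of_nonneg_right hx (norm_nonneg _)

theorem memLp_productGradient (hΩ : IsOpen Ω) (hT : IsTriangulation Ω 𝒯)
    (hη : IsMeshCutoff 𝒯 L η) (hL : 0 ≤ L) {v : Plane → ℝ} {G : Plane → Plane}
    (hv : MemLp v 2 (volume.restrict Ω)) (hG : MemLp G 2 (volume.restrict Ω)) :
    MemLp (productGradient η v G) 2 (volume.restrict Ω) := by
  refine MemLp.add (hG.of_le_mul (c := 1) (hη.continuous.aestronglyMeasurable.smul hG.1)
    (ae_of_all _ fun x => ?_)) (hv.of_le_mul (c := L)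
    (hv.1.smul (measurable_gradient η).aestronglyMeasurable) ?_)
  · rw [norm_smul]
    exact mul_le_mul_of_nonneg_right (hη.norm_le_one x) (norm_nonneg _)
  · filter_upwards [ae_restrict_mem hΩ.measurableSet] with x hx
    rw [norm_smul, mul_comm]
    exact mul_le_mul_of_nonneg_right (hη.norm_gradient_le hT hL hΩ hx) (norm_nonneg _)

theorem memLp_mul_cutoff (hη : IsMeshCutoff 𝒯 L η) {v : Plane → ℝ}
    (hv : MemLp v 2 (volume.restrict Ω)) : MemLp (η * v) 2 (volume.restrict Ω) :=
  hv.of_le_mul (c := 1) (hη.continuous.aestronglyMeasurable.mul hv.1) (ae_of_all _ fun x => by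
    rw [Pi.mul_apply, norm_mul]
    exact mul_le_mul_of_nonneg_right (hη.norm_le_one x) (norm_nonneg _))

/-- Approximating `v` by test functions and then `η` by smooth functions yields test
functions that approximate `η v` in `H¹(Ω)` and in `L²(Γ)`. -/
theorem exists_approx_mul_cutoff (hΩ : IsOpen Ω) (hb : Bornology.IsBounded Ω)
    (hT : IsTriangulation Ω 𝒯) (hη : IsMeshCutoff 𝒯 L η) (hL : 0 ≤ L) {v : Plane → ℝ}
    (hv : MemEnergySpace Γ v) :
    ∃ G, IsWeakGradient Ω v G ∧ IsWeakGradient Ω (η * v) (productGradient η v G) ∧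
    ∃ χ : ℕ → Plane → ℝ, (∀ j, IsTestFunction Ω (χ j)) ∧
    Tendsto (fun j => eLpNorm (χ j - η * v) 2 (volume.restrict Ω)) atTop (𝓝 0) ∧
    Tendsto (fun j => eLpNorm (gradient (χ j) - productGradient η v G) 2 (volume.restrict Ω))
      atTop (𝓝 0) ∧
    ∀ i, Tendsto (fun j => eLpNorm (Γ.restr (χ j) i - Γ.restr (η * v) i) 2
      (volume.restrict (Icc 0 (Γ.length i)))) atTop (𝓝 0) := by
  have := isFiniteMeasure_restrict_of_isBounded hb
  obtain ⟨G, hG, ψ, hψ, h1, h2, h3⟩ := hv.approx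
  have hsmall : ∀ j : ℕ, ∃ n,
      eLpNorm (mollify (bumpSeq n) η * ψ j - η * ψ j) 2 (volume.restrict Ω) ≤ (j : ℝ≥0∞)⁻¹ ∧
      eLpNorm (gradient (mollify (bumpSeq n) η * ψ j) - productGradient η (ψ j) (gradient (ψ j)))
        2 (volume.restrict Ω) ≤ (j : ℝ≥0∞)⁻¹ ∧
      ∀ i, eLpNorm (Γ.restr (mollify (bumpSeq n) η * ψ j) i - Γ.restr (η * ψ j) i) 2
        (volume.restrict (Icc 0 (Γ.length i))) ≤ (j : ℝ≥0∞)⁻¹ := fun j => by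
    have hpos : (0 : ℝ≥0∞) < (j : ℝ≥0∞)⁻¹ := ENNReal.inv_pos.2 (ENNReal.natCast_ne_top j)
    have e1 := (tendsto_mollify_mul_eLpNorm hη (hψ j) id
      (μ := volume.restrict Ω) aemeasurable_id).eventually_le_const hpos
    have e2 := (tendsto_gradient_mollify_mul hΩ hb hT hη hL (hψ j)).eventually_le_const hpos
    have e3 := eventually_all.2 fun i => (tendsto_mollify_mul_eLpNorm hη (hψ j) _
      (aemeasurable_curve (Γ := Γ) i)).eventually_le_const hpos
    exact (e1.and (e2.and e3)).exists
  choose n hn1 hn2 hn3 using hsmall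
  have hχ : ∀ j, IsTestFunction Ω (mollify (bumpSeq (n j)) η * ψ j) := fun j =>
    (hψ j).mollify_mul hη.continuous _
  have hvm := memLp_mul_cutoff hη hv.memLp
  have hψm := fun j => memLp_mul_cutoff hη (hψ j).memLp
  have hGm := memLp_productGradient hΩ hT hη hL hv.memLp hG.memLp
  have hψGm := fun j => memLp_productGradient hΩ hT hη hL (hψ j).memLp (hψ j).memLp_gradient
  have t1 : Tendsto (fun j => eLpNorm (mollify (bumpSeq (n j)) η * ψ j - η * v) 2
      (volume.restrict Ω)) atTop (𝓝 0) := by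
    refine tendsto_eLpNorm_of_close (fun j => ((hχ j).memLp.sub (hψm j)).1)
      (fun j => ((hψm j).sub hvm).1) hn1 ?_
    have e : ∀ j, η * ψ j - η * v = η • (ψ j - v) := fun j => (mul_sub η (ψ j) v).symm
    simp only [e]
    exact tendsto_eLpNorm_smul_of_bounded (ae_of_all _ hη.norm_le_one) h1
  have t2 : Tendsto (fun j => eLpNorm (gradient (mollify (bumpSeq (n j)) η * ψ j)
      - productGradient η v G) 2 (volume.restrict Ω)) atTop (𝓝 0) := by
    refine tendsto_eLpNorm_of_close (fun j => ((hχ j).memLp_gradient.sub (hψGm j)).1)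
      (fun j => ((hψGm j).sub hGm).1) hn2 ?_
    have k1 := tendsto_eLpNorm_smul_of_bounded (g := η) (C := 1) (ae_of_all _ hη.norm_le_one) h2
    have k2 : Tendsto (fun j => eLpNorm (fun x => (ψ j - v) x • gradient η x) 2
        (volume.restrict Ω)) atTop (𝓝 0) := by
      have h := ENNReal.Tendsto.const_mul (a := ENNReal.ofReal L) h1
        (Or.inr ENNReal.ofReal_ne_top)
      rw [mul_zero] at h
      refine tendsto_of_tendsto_of_tendsto_of_le_of_le tendsto_const_nhds h (fun _ => zero_le)
        fun j => eLpNorm_le_mul_eLpNorm_of_ae_le_mul ?_ 2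
      filter_upwards [ae_restrict_mem hΩ.measurableSet] with x hx
      rw [norm_smul, mul_comm]
      exact mul_le_mul_of_nonneg_right (hη.norm_gradient_le hT hL hΩ hx) (norm_nonneg _)
    have k := k1.add k2
    rw [add_zero] at k
    refine tendsto_of_tendsto_of_tendsto_of_le_of_le tendsto_const_nhds k (fun _ => zero_le)
      fun j => ?_
    have e : productGradient η (ψ j) (gradient (ψ j)) - productGradient η v G
        = η • (gradient (ψ j) - G) + fun x => (ψ j - v) x • gradient η x := by
      funext x
      simp only [productGradient, Pi.sub_apply, Pi.add_apply, Pi.smul_apply']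
      module
    simp only [e]
    exact eLpNorm_add_le
      (hη.continuous.aestronglyMeasurable.smul ((hψ j).memLp_gradient.sub hG.memLp).1)
      (((hψ j).memLp.sub hv.memLp).1.smul (measurable_gradient η).aestronglyMeasurable)
      (by norm_num)
  refine ⟨G, hG, IsWeakGradient.of_tendsto hχ hvm hGm t1 t2, _, hχ, t1, t2, fun i => ?_⟩
  have haes : ∀ {w : Plane → ℝ}, ContinuousOn w Γ.carrier →
      AEStronglyMeasurable (Γ.restr w i) (volume.restrict (Icc 0 (Γ.length i))) :=
    fun hw => aesm_restr hw i
  have hcψ := fun j => (hψ j).contDiff.continuous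
  have hηψ : ∀ j, Continuous (η * ψ j) := fun j => hη.continuous.mul (hcψ j)
  refine tendsto_eLpNorm_of_close
    (fun j => (haes (hχ j).contDiff.continuous.continuousOn).sub (haes (hηψ j).continuousOn))
    (fun j => (haes (hηψ j).continuousOn).sub
      (haes (hη.continuous.continuousOn.mul hv.continuousOn))) (fun j => hn3 j i) ?_
  have e : ∀ j, Γ.restr (η * ψ j) i - Γ.restr (η * v) i
      = Γ.restr η i • (Γ.restr (ψ j) i - Γ.restr v i) := fun j => by
    funext s
    simp [Interface.restr, mul_sub]
  simp only [e]
  exact tendsto_eLpNorm_smul_of_bounded (ae_of_all _ fun s => hη.norm_le_one _) (h3 i)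

theorem exists_bound_restr {v : Plane → ℝ} (hv : ContinuousOn v Γ.carrier) (i : Fin Γ.n) :
    ∃ C, ∀ s ∈ Icc 0 (Γ.length i), ‖Γ.restr v i s‖ ≤ C := by
  have hc : ContinuousOn (Γ.restr v i) (Icc 0 (Γ.length i)) :=
    hv.comp (curve_continuousOn i) fun s hs => mem_iUnion.2 ⟨i, mem_image_of_mem _ hs⟩
  exact isCompact_Icc.exists_bound_of_continuousOn hc

/-- The energy space is stable under multiplication with cut-off functions. -/
theorem MemEnergySpace.mul_cutoff (hΩ : IsOpen Ω) (hb : Bornology.IsBounded Ω)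
    (hT : IsTriangulation Ω 𝒯) (hη : IsMeshCutoff 𝒯 L η) (hL : 0 ≤ L) {v : Plane → ℝ}
    (hv : MemEnergySpace Γ v) : MemEnergySpace Γ (η * v) where
  eq_zero x hx := by simp [hv.eq_zero x hx]
  memLp := memLp_mul_cutoff hη hv.memLp
  approx := by
    obtain ⟨G, -, hG, h⟩ := exists_approx_mul_cutoff hΩ hb hT hη hL hv
    exact ⟨_, hG, h⟩
  continuousOn := hη.continuous.continuousOn.mul hv.continuousOn
  absCont i := (hη.absolutelyContinuous_restr hT hL i).mul (hv.absCont i)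
  memLp_tanDeriv i := by
    obtain ⟨C, hC⟩ := exists_bound_restr hv.continuousOn i
    have hm := hv.memLp_tanDeriv i
    have hηm : AEStronglyMeasurable (Γ.restr η i) (volume.restrict (Icc 0 (Γ.length i))) :=
      aesm_restr hη.continuous.continuousOn i
    refine (memLp_congr_ae (ae_tanDeriv_mul hη hT hL hv i)).2 (MemLp.add
      (hm.of_le_mul (c := 1) (hηm.mul hm.1) (ae_of_all _ fun s => ?_))
      (MemLp.of_bound ((aesm_restr hv.continuousOn i).mul
        (measurable_deriv (Γ.restr η i)).aestronglyMeasurable) (C * L) ?_))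
    · rw [norm_mul]
      exact mul_le_mul_of_nonneg_right (hη.norm_le_one _) (norm_nonneg _)
    · filter_upwards [hη.ae_abs_tanDeriv_le hT hL i, ae_restrict_mem measurableSet_Icc] with s h hs
      rw [norm_mul]
      exact mul_le_mul (hC s hs) h (norm_nonneg _) ((norm_nonneg _).trans (hC s hs))

theorem MemEnergySpace.weakGrad_mul_cutoff (hΩ : IsOpen Ω) (hb : Bornology.IsBounded Ω)
    (hT : IsTriangulation Ω 𝒯) (hη : IsMeshCutoff 𝒯 L η) (hL : 0 ≤ L) {v : Plane → ℝ}
    (hv : MemEnergySpace Γ v) :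
    weakGrad Ω (η * v) =ᵐ[volume.restrict Ω] productGradient η v (weakGrad Ω v) := by
  obtain ⟨G, hG, hG', -⟩ := exists_approx_mul_cutoff hΩ hb hT hη hL hv
  filter_upwards [hG'.weakGrad_ae_eq hΩ, hG.weakGrad_ae_eq hΩ] with x h1 h2
  simp only [h1, h2, productGradient]

/-! ### Derivatives on sets where a function is constant -/

/-- A function that is constant on a set has derivative zero at almost all
points of the set, since all but countably many of them are accumulation points. No regularity
of the function is needed, because the derivative is zero where it does not exist. -/
theorem ae_deriv_eq_zero_of_eqOn {g : ℝ → ℝ} {E : Set ℝ} {c : ℝ} (h : ∀ s ∈ E, g s = c) :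
    ∀ᵐ s, s ∈ E → deriv g s = 0 := by
  have hc := (countable_setOfPred_isolated_right_within (s := E)).ae_notMem (volume : Measure ℝ)
  filter_upwards [hc] with s hs hsE
  by_cases hd : DifferentiableAt ℝ g s
  swap
  · exact deriv_zero_of_not_differentiableAt hd
  have hne : (𝓝[E ∩ Ioi s] s).NeBot := by
    rw [neBot_iff]
    exact fun h' => hs ⟨hsE, h'⟩
  have hacc : AccPt s (𝓟 E) := by
    rw [accPt_principal_iff_nhdsWithin]
    exact hne.mono (nhdsWithin_mono _ fun y hy => ⟨hy.1, (ne_of_gt hy.2 : y ≠ s)⟩)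
  have huniq : UniqueDiffWithinAt ℝ E s := uniqueDiffWithinAt_iff_accPt.2 hacc
  have h1 : HasDerivWithinAt g (deriv g s) E s := hd.hasDerivAt.hasDerivWithinAt
  have h2 : HasDerivWithinAt g 0 E s :=
    (hasDerivWithinAt_const s E c).congr (fun y hy => h y hy) (h s hsE)
  exact huniq.eq_deriv _ h1 h2

theorem ae_gradient_eq_zero_of_eqOn_cell {f : Plane → ℝ} {t : Finset Plane} {c : ℝ}
    (h : ∀ x ∈ cell t, f x = c) : ∀ᵐ x : Plane, x ∈ cell t → gradient f x = 0 := by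
  filter_upwards [measure_eq_zero_iff_ae_notMem.1 (volume_frontier_cell t)] with x hx hxt
  have hi : x ∈ interior (cell t) := by
    by_contra hn
    exact hx ⟨subset_closure hxt, hn⟩
  have he : f =ᶠ[𝓝 x] fun _ => c := by
    filter_upwards [mem_interior_iff_mem_nhds.1 hi] with y hy using h y hy
  rw [he.gradient_eq, gradient_fun_const]

end CutOff

/-! ### The domain and the interface as one measure space -/

section BulkAndInterface

variable {Ω : Set Plane} (Γ : Interface Ω)

/-- The disjoint union of the plane and of the parameter lines of the curves. -/
abbrev BulkInterface : Type := Plane ⊕ (Fin Γ.n × ℝ)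

theorem measurableEmbedding_sumInl :
    MeasurableEmbedding (Sum.inl : Plane → BulkInterface Γ) :=
  ⟨Sum.inl_injective, measurable_inl, fun {_} hs => measurableSet_inl_image.2 hs⟩

theorem measurableEmbedding_sumInr :
    MeasurableEmbedding (Sum.inr : Fin Γ.n × ℝ → BulkInterface Γ) :=
  ⟨Sum.inr_injective, measurable_inr, fun {_} hs => measurableSet_inr_image.2 hs⟩

/-- The parameter line of the curve `i` in the disjoint union. -/
def curveEmb (i : Fin Γ.n) (s : ℝ) : BulkInterface Γ := Sum.inr (i, s)

theorem measurableEmbedding_curveEmb (i : Fin Γ.n) : MeasurableEmbedding (curveEmb Γ i) :=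
  (measurableEmbedding_sumInr Γ).comp (measurableEmbedding_prodMk_left i)

/-- Area on `Ω` plus arc length on each curve, so that an integral with respect to this measure is
the sum of a bulk and an interface integral. -/
def bulkInterfaceMeasure : Measure (BulkInterface Γ) :=
  (volume.restrict Ω).map Sum.inl +
    Measure.sum fun i => (volume.restrict (Icc 0 (Γ.length i))).map (curveEmb Γ i)

variable {Γ}

theorem ae_bulkInterface_iff {P : BulkInterface Γ → Prop} :
    (∀ᵐ x ∂bulkInterfaceMeasure Γ, P x) ↔ (∀ᵐ x ∂volume.restrict Ω, P (Sum.inl x)) ∧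
      ∀ i, ∀ᵐ s ∂volume.restrict (Icc 0 (Γ.length i)), P (curveEmb Γ i s) := by
  unfold bulkInterfaceMeasure
  rw [ae_add_measure_iff, Measure.ae_sum_iff, (measurableEmbedding_sumInl Γ).ae_map_iff]
  simp only [(measurableEmbedding_curveEmb Γ _).ae_map_iff]

theorem aemeasurable_bulkInterface_iff {E : Type} [MeasurableSpace E] {f : BulkInterface Γ → E} :
    AEMeasurable f (bulkInterfaceMeasure Γ) ↔ AEMeasurable (f ∘ Sum.inl) (volume.restrict Ω) ∧
      ∀ i, AEMeasurable (f ∘ curveEmb Γ i) (volume.restrict (Icc 0 (Γ.length i))) := by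
  unfold bulkInterfaceMeasure
  rw [aemeasurable_add_measure_iff, aemeasurable_sum_measure_iff,
    (measurableEmbedding_sumInl Γ).aemeasurable_map_iff]
  simp only [(measurableEmbedding_curveEmb Γ _).aemeasurable_map_iff]

theorem integrable_bulkInterface_iff {f : BulkInterface Γ → ℝ} :
    Integrable f (bulkInterfaceMeasure Γ) ↔ Integrable (f ∘ Sum.inl) (volume.restrict Ω) ∧
      ∀ i, Integrable (f ∘ curveEmb Γ i) (volume.restrict (Icc 0 (Γ.length i))) := by
  unfold bulkInterfaceMeasure
  rw [integrable_add_measure, Measure.sum_fintype, integrable_finsetSum_measure,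
    (measurableEmbedding_sumInl Γ).integrable_map_iff]
  simp only [(measurableEmbedding_curveEmb Γ _).integrable_map_iff, Finset.mem_univ, true_imp_iff]

theorem memLp_bulkInterface {E : Type} [NormedAddCommGroup E] [MeasurableSpace E] [BorelSpace E]
    [SecondCountableTopology E] {f : BulkInterface Γ → E}
    (h1 : MemLp (f ∘ Sum.inl) 2 (volume.restrict Ω))
    (h2 : ∀ i, MemLp (f ∘ curveEmb Γ i) 2 (volume.restrict (Icc 0 (Γ.length i)))) :
    MemLp f 2 (bulkInterfaceMeasure Γ) := by
  have hm : AEMeasurable f (bulkInterfaceMeasure Γ) :=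
    aemeasurable_bulkInterface_iff.2 ⟨h1.1.aemeasurable, fun i => (h2 i).1.aemeasurable⟩
  rw [memLp_two_iff_integrable_sq_norm hm.aestronglyMeasurable]
  exact integrable_bulkInterface_iff.2 ⟨(memLp_two_iff_integrable_sq_norm h1.1).1 h1,
    fun i => (memLp_two_iff_integrable_sq_norm (h2 i).1).1 (h2 i)⟩

theorem integral_bulkInterface {f : BulkInterface Γ → ℝ}
    (hf : Integrable f (bulkInterfaceMeasure Γ)) :
    ∫ x, f x ∂bulkInterfaceMeasure Γ = (∫ x in Ω, f (Sum.inl x)) +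
      ∑ i, ∫ s in Icc 0 (Γ.length i), f (curveEmb Γ i s) := by
  unfold bulkInterfaceMeasure at hf ⊢
  rw [integrable_add_measure] at hf
  rw [integral_add_measure hf.1 hf.2, (measurableEmbedding_sumInl Γ).integral_map]
  rw [Measure.sum_fintype] at hf ⊢
  rw [integral_finsetSum_measure fun i hi => (integrable_finsetSum_measure.1 hf.2) i hi]
  simp only [(measurableEmbedding_curveEmb Γ _).integral_map]

variable (Γ)

/-- The position in the plane of a point of the disjoint union. The curves are
extended by constants outside their parameter intervals, which makes the map measurable. -/
def position : BulkInterface Γ → Plane :=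
  Sum.elim id fun q => IccExtend (Γ.length_pos q.1).le (fun s => Γ.curve q.1 s) q.2

variable {Γ}

theorem position_curveEmb {i : Fin Γ.n} {s : ℝ} (hs : s ∈ Icc 0 (Γ.length i)) :
    position Γ (curveEmb Γ i s) = Γ.curve i s :=
  IccExtend_of_mem (Γ.length_pos i).le (fun s : Icc 0 (Γ.length i) => Γ.curve i s) hs

theorem measurable_position : Measurable (position Γ) := by
  refine Measurable.sumElim measurable_id (measurable_from_prod_countable_right fun i => ?_)
  have h : Continuous fun s : Icc 0 (Γ.length i) => Γ.curve i s :=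
    continuousOn_iff_continuous_domRestrict.1 (curve_continuousOn i)
  exact (h.Icc_extend' (h := (Γ.length_pos i).le)).measurable

/-- Integration over the part of the disjoint union that lies over `S`. -/
theorem setIntegral_position {S : Set Plane} (hS : MeasurableSet S) {f : BulkInterface Γ → ℝ}
    (hf : Integrable f (bulkInterfaceMeasure Γ)) :
    ∫ x in position Γ ⁻¹' S, f x ∂bulkInterfaceMeasure Γ
      = (∫ x in Ω ∩ S, f (Sum.inl x)) + Γ.integralOn S fun i s => f (curveEmb Γ i s) := by
  have hm := measurable_position (Γ := Γ) hS
  rw [← integral_indicator hm, integral_bulkInterface (hf.indicator hm)]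
  congr 1
  · rw [inter_comm, ← Measure.restrict_restrict hS, ← integral_indicator hS]
    rfl
  · refine Finset.sum_congr rfl fun i _ => ?_
    have hm' : MeasurableSet ((position Γ ∘ curveEmb Γ i) ⁻¹' S) :=
      (measurable_position.comp (measurableEmbedding_curveEmb Γ i).measurable) hS
    have he : Icc 0 (Γ.length i) ∩ Γ.curve i ⁻¹' S
        = (position Γ ∘ curveEmb Γ i) ⁻¹' S ∩ Icc 0 (Γ.length i) := by
      ext s
      simp only [mem_inter_iff, mem_preimage, Function.comp_apply]
      rw [and_comm]
      exact and_congr_left fun hs => by rw [position_curveEmb hs]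
    rw [he, ← Measure.restrict_restrict hm', ← integral_indicator hm']
    rfl

/-! ### The gradient operator on the energy space -/

/-- A unit vector that turns the scalar tangential derivative into a vector. -/
def unitVec : Plane := EuclideanSpace.single 0 1

theorem norm_unitVec : ‖unitVec‖ = 1 := by simp [unitVec]

variable (Γ)

/-- The weak gradient on `Ω` and the tangential derivative on the curves, as one vector field. -/
def jointGrad (v : Plane → ℝ) : BulkInterface Γ → Plane :=
  Sum.elim (weakGrad Ω v) fun q => Γ.tanDeriv v q.1 q.2 • unitVec

variable {Γ}

theorem memLp_jointGrad {v : Plane → ℝ} (hv : MemEnergySpace Γ v) :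
    MemLp (jointGrad Γ v) 2 (bulkInterfaceMeasure Γ) := by
  refine memLp_bulkInterface hv.isWeakGradient.memLp fun i => ?_
  have h := hv.memLp_tanDeriv i
  refine h.of_le_mul (c := 1) (h.1.smul_const unitVec) (ae_of_all _ fun s => ?_)
  rw [Function.comp_apply, jointGrad, curveEmb, Sum.elim_inr, norm_smul, norm_unitVec, mul_one,
    one_mul]

theorem jointGrad_add (hΩ : IsOpen Ω) {u v : Plane → ℝ} (hu : MemEnergySpace Γ u)
    (hv : MemEnergySpace Γ v) :
    jointGrad Γ (u + v) =ᵐ[bulkInterfaceMeasure Γ] jointGrad Γ u + jointGrad Γ v := by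
  refine ae_bulkInterface_iff.2
    ⟨(hu.isWeakGradient.add hu.memLp hv.memLp hv.isWeakGradient).weakGrad_ae_eq hΩ, fun i => ?_⟩
  filter_upwards [ae_differentiableAt_restr i (hu.absCont i),
    ae_differentiableAt_restr i (hv.absCont i)] with s h1 h2
  have h : Γ.tanDeriv (u + v) i s = Γ.tanDeriv u i s + Γ.tanDeriv v i s := deriv_add h1 h2
  simp only [jointGrad, curveEmb, Sum.elim_inr, Pi.add_apply, h, add_smul]

theorem jointGrad_smul (hΩ : IsOpen Ω) {u : Plane → ℝ} (hu : MemEnergySpace Γ u) (c : ℝ) :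
    jointGrad Γ (c • u) =ᵐ[bulkInterfaceMeasure Γ] c • jointGrad Γ u := by
  refine ae_bulkInterface_iff.2 ⟨(hu.isWeakGradient.smul c).weakGrad_ae_eq hΩ, fun i => ?_⟩
  filter_upwards [ae_differentiableAt_restr i (hu.absCont i)] with s h1
  have h : Γ.tanDeriv (c • u) i s = c • Γ.tanDeriv u i s := deriv_const_smul c h1
  simp only [jointGrad, curveEmb, Sum.elim_inr, Pi.smul_apply, h, smul_assoc]

/-- The joint gradient as a linear operator from the energy space to `L²`. -/
def gradOp (Γ : Interface Ω) (hΩ : IsOpen Ω) :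
    energySpace Γ →ₗ[ℝ] Lp Plane 2 (bulkInterfaceMeasure Γ) where
  toFun v := (memLp_jointGrad v.2).toLp
  map_add' u v := by
    rw [← MemLp.toLp_add]
    exact (MemLp.toLp_eq_toLp_iff _ _).2 (jointGrad_add hΩ u.2 v.2)
  map_smul' c u := by
    rw [RingHom.id_apply, ← MemLp.toLp_const_smul]
    exact (MemLp.toLp_eq_toLp_iff _ _).2 (jointGrad_smul hΩ u.2 c)

theorem coeFn_gradOp (hΩ : IsOpen Ω) (v : energySpace Γ) :
    gradOp Γ hΩ v =ᵐ[bulkInterfaceMeasure Γ] jointGrad Γ v :=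
  MemLp.coeFn_toLp (memLp_jointGrad v.2)

theorem integralOn_nonneg {S : Set Plane} {f : Fin Γ.n → ℝ → ℝ} (h : ∀ i s, 0 ≤ f i s) :
    0 ≤ Γ.integralOn S f :=
  Finset.sum_nonneg fun i _ => integral_nonneg fun s => h i s

theorem l2Norm_sq {F : Type} [NormedAddCommGroup F] (S : Set Plane) (f : Plane → F) :
    l2Norm Ω S f ^ 2 = ∫ x in Ω ∩ S, ‖f x‖ ^ 2 :=
  Real.sq_sqrt (integral_nonneg fun _ => by positivity)

theorem Interface.l2Norm_sq (S : Set Plane) (f : Fin Γ.n → ℝ → ℝ) :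
    Γ.l2Norm S f ^ 2 = Γ.integralOn S fun i s => f i s ^ 2 :=
  Real.sq_sqrt (integralOn_nonneg fun _ _ => by positivity)

/-- The energy over `S` is the sum of the squares of the two norms that make up `gradNorm`. -/
theorem localEnergy_gradOp (hΩ : IsOpen Ω) {S : Set Plane} (hS : MeasurableSet S)
    (v : energySpace Γ) :
    localEnergy (gradOp Γ hΩ) (position Γ ⁻¹' S) v
      = l2Norm Ω S (weakGrad Ω v) ^ 2 + Γ.l2Norm S (Γ.tanDeriv v) ^ 2 := by
  have h : localEnergy (gradOp Γ hΩ) (position Γ ⁻¹' S) v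
      = ∫ x in position Γ ⁻¹' S, ‖jointGrad Γ v x‖ ^ 2 ∂bulkInterfaceMeasure Γ := by
    refine integral_congr_ae (ae_restrict_of_ae ?_)
    filter_upwards [coeFn_gradOp hΩ v] with x hx
    rw [hx]
  rw [h, setIntegral_position hS ((memLp_jointGrad v.2).integrable_norm_pow (by norm_num)),
    l2Norm_sq, Interface.l2Norm_sq]
  congr 2
  funext i s
  rw [jointGrad, curveEmb, Sum.elim_inr, norm_smul, norm_unitVec, mul_one, Real.norm_eq_abs, sq_abs]

theorem localEnergy_le_gradNorm_sq (hΩ : IsOpen Ω) {S : Set Plane} (hS : MeasurableSet S)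
    (v : energySpace Γ) :
    localEnergy (gradOp Γ hΩ) (position Γ ⁻¹' S) v ≤ gradNorm Γ S v ^ 2 := by
  rw [localEnergy_gradOp hΩ hS, gradNorm]
  have h1 : 0 ≤ l2Norm Ω S (weakGrad Ω v) := Real.sqrt_nonneg _
  have h2 : 0 ≤ Γ.l2Norm S (Γ.tanDeriv v) := Real.sqrt_nonneg _
  nlinarith [mul_nonneg h1 h2]

theorem gradNorm_sq_le (hΩ : IsOpen Ω) {S : Set Plane} (hS : MeasurableSet S)
    (v : energySpace Γ) :
    gradNorm Γ S v ^ 2 ≤ 2 * localEnergy (gradOp Γ hΩ) (position Γ ⁻¹' S) v := by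
  rw [localEnergy_gradOp hΩ hS, gradNorm]
  nlinarith [sq_nonneg (l2Norm Ω S (weakGrad Ω v) - Γ.l2Norm S (Γ.tanDeriv v))]

theorem gradNorm_nonneg (S : Set Plane) (v : Plane → ℝ) : 0 ≤ gradNorm Γ S v :=
  add_nonneg (Real.sqrt_nonneg _) (Real.sqrt_nonneg _)

/-- The permeability on the disjoint union. -/
def jointCoeff (Γ : Interface Ω) (A AΓ : Plane → ℝ) : BulkInterface Γ → ℝ :=
  Sum.elim A fun q => Γ.restr AΓ q.1 q.2

theorem IsPermeability.aemeasurable_jointCoeff {A AΓ : Plane → ℝ} {α β : ℝ}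
    (h : IsPermeability Γ A AΓ α β) :
    AEMeasurable (jointCoeff Γ A AΓ) (bulkInterfaceMeasure Γ) :=
  aemeasurable_bulkInterface_iff.2 ⟨h.measurable_bulk, h.measurable_interface⟩

theorem IsPermeability.ae_bounds {A AΓ : Plane → ℝ} {α β : ℝ}
    (h : IsPermeability Γ A AΓ α β) :
    ∀ᵐ x ∂bulkInterfaceMeasure Γ, α ≤ jointCoeff Γ A AΓ x ∧ jointCoeff Γ A AΓ x ≤ β :=
  ae_bulkInterface_iff.2 ⟨h.bounds_bulk, h.bounds_interface⟩

theorem weightedForm_gradOp (hΩ : IsOpen Ω) {A AΓ : Plane → ℝ} {α β : ℝ} (hα : 0 < α)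
    (hA : IsPermeability Γ A AΓ α β) {S : Set Plane} (hS : MeasurableSet S)
    (u w : energySpace Γ) :
    weightedForm (gradOp Γ hΩ) (jointCoeff Γ A AΓ) (position Γ ⁻¹' S) u w
      = formOn Γ A AΓ S u w := by
  have hae : (fun x => jointCoeff Γ A AΓ x * inner ℝ (gradOp Γ hΩ u x) (gradOp Γ hΩ w x))
      =ᵐ[bulkInterfaceMeasure Γ]
      fun x => jointCoeff Γ A AΓ x * inner ℝ (jointGrad Γ u x) (jointGrad Γ w x) := by
    filter_upwards [coeFn_gradOp hΩ u, coeFn_gradOp hΩ w] with x h1 h2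
    rw [h1, h2]
  have hint := (integrable_weightedForm (gradOp Γ hΩ) hA.aemeasurable_jointCoeff hα
    hA.ae_bounds u w).congr hae
  rw [weightedForm, integral_congr_ae (ae_restrict_of_ae hae), setIntegral_position hS hint, formOn]
  congr 2
  funext i s
  simp only [jointCoeff, jointGrad, curveEmb, Sum.elim_inr, inner_smul_left, inner_smul_right,
    real_inner_self_eq_norm_sq, norm_unitVec, one_pow, mul_one, RCLike.conj_to_real]
  ring

end BulkAndInterface

/-! ### The mesh as a cell complex, and the interpolation operator -/

section Interpolation

variable {Ω : Set Plane} {Γ : Interface Ω} {𝒯 : Finset (Finset Plane)} {H γ CI : ℝ}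

/-- The parts of the domain and of the interface over the triangles, with the layers
around the triangle `t`. -/
def meshComplex (Γ : Interface Ω) (hΩ : IsOpen Ω) (hT : IsTriangulation Ω 𝒯)
    (hQ : IsQuasiUniform 𝒯 H γ) (t : 𝒯) :
    CellComplex (bulkInterfaceMeasure Γ) 𝒯 (overlapBound γ) where
  cell s := position Γ ⁻¹' cell s
  measurableSet_cell s := measurable_position (isClosed_cell _).measurableSet
  ae_cover := by
    have hcl : ∀ x ∈ closure Ω, ∃ s : 𝒯, x ∈ cell s := fun x hx => by
      rw [hT.cover] at hx
      simpa using hx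
    refine ae_bulkInterface_iff.2 ⟨?_, fun i => ?_⟩
    · filter_upwards [ae_restrict_mem hΩ.measurableSet] with x hx
      exact hcl x (subset_closure hx)
    · filter_upwards [ae_restrict_mem measurableSet_Icc] with s hs
      simp only [mem_preimage, position_curveEmb hs]
      exact hcl _ (curve_mem_closure i hs)
  nb := meeting 𝒯
  mem_nb_self s := mem_meeting.2 (by
    obtain ⟨x, hx⟩ := hQ.exists_closedBall_subset hT s.2
    have hH := hQ.pos
    have hγ := hQ.shape_pos hT s.2
    have := hx (Metric.mem_closedBall_self (by positivity))
    exact ⟨x, this, this⟩)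
  mem_nb_comm s s' h := mem_meeting.2 (by
    rw [inter_comm]
    exact mem_meeting.1 h)
  card_nb_le s := by
    rw [← Finset.card_map (Function.Embedding.subtype _)]
    refine card_meeting_le hT hQ s.2 _ (fun s' hs' => ?_) fun s' hs' => ?_
    · obtain ⟨s'', -, rfl⟩ := Finset.mem_map.1 hs'
      exact s''.2
    · obtain ⟨s'', h, rfl⟩ := Finset.mem_map.1 hs'
      exact mem_meeting.1 h
  mem_nb_of_mem x s s' h h' := mem_meeting.2 ⟨position Γ x, h, h'⟩
  layer := meshLayer 𝒯 t
  nb_subset j s hs := by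
    classical
    exact Finset.subset_biUnion_of_mem (meeting 𝒯) hs

/-- The interpolation operator as an endomorphism of the energy space. -/
def interpEnd (I : energySpace Γ →ₗ[ℝ] coarseSpace Γ 𝒯) : energySpace Γ →ₗ[ℝ] energySpace Γ :=
  (coarseSpace Γ 𝒯).subtype ∘ₗ I

theorem interpEnd_eq_zero_iff {I : energySpace Γ →ₗ[ℝ] coarseSpace Γ 𝒯} {u : energySpace Γ} :
    interpEnd I u = 0 ↔ I u = 0 := by
  simp [interpEnd]

/-- The bound of `gradNorm` over the neighbourhood of a triangle by the energies of its cells. -/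
theorem gradNorm_patch_one_sq_le (hΩ : IsOpen Ω) (s : 𝒯) (u : energySpace Γ) :
    gradNorm Γ (patch 𝒯 1 s) u ^ 2
      ≤ 2 * ∑ s' ∈ meeting 𝒯 s, localEnergy (gradOp Γ hΩ) (position Γ ⁻¹' cell s') u := by
  refine (gradNorm_sq_le hΩ (isClosed_patch s 1).measurableSet u).trans ?_
  have h := localEnergy_biUnion_le (gradOp Γ hΩ) (K := fun s' : 𝒯 => position Γ ⁻¹' cell s')
    (meeting 𝒯 s) u
  rw [patch_one_eq, preimage_iUnion₂]
  linarith

theorem stable_interpEnd (hΩ : IsOpen Ω) {I : energySpace Γ →ₗ[ℝ] coarseSpace Γ 𝒯}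
    (hI : IsInterpolation Γ 𝒯 H CI I) (u : energySpace Γ) (s : 𝒯) :
    localEnergy (gradOp Γ hΩ) (position Γ ⁻¹' cell s) (interpEnd I u)
      ≤ 2 * CI ^ 2 * ∑ s' ∈ meeting 𝒯 s,
        localEnergy (gradOp Γ hΩ) (position Γ ⁻¹' cell s') u := by
  refine (localEnergy_le_gradNorm_sq hΩ (isClosed_cell _).measurableSet _).trans ?_
  have h1 := pow_le_pow_left₀ (gradNorm_nonneg _ _) (hI.stable u s s.2) 2
  have h2 := mul_le_mul_of_nonneg_left (gradNorm_patch_one_sq_le hΩ s u) (sq_nonneg CI)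
  rw [mul_pow] at h1
  refine h1.trans (h2.trans_eq ?_)
  ring

/-- The squared interpolation error over a triangle and over the interface in it. -/
theorem interpolation_error_sq_le (hΩ : IsOpen Ω) {I : energySpace Γ →ₗ[ℝ] coarseSpace Γ 𝒯}
    (hI : IsInterpolation Γ 𝒯 H CI I) (u : energySpace Γ) (s : 𝒯) :
    l2Norm Ω (cell s) ((u - interpEnd I u : energySpace Γ) : Plane → ℝ) ^ 2
      + Γ.l2Norm (cell s) (Γ.restr ((u - interpEnd I u : energySpace Γ) : Plane → ℝ)) ^ 2
      ≤ 2 * CI ^ 2 * H ^ 2 * ∑ s' ∈ meeting 𝒯 s,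
        localEnergy (gradOp Γ hΩ) (position Γ ⁻¹' cell s') u := by
  have h0 := hI.error_le u s s.2
  have e : ((u - interpEnd I u : energySpace Γ) : Plane → ℝ)
      = (u : Plane → ℝ) - ((I u : energySpace Γ) : Plane → ℝ) := rfl
  rw [← e] at h0
  set p := l2Norm Ω (cell s) ((u - interpEnd I u : energySpace Γ) : Plane → ℝ)
  set q := Γ.l2Norm (cell s) (Γ.restr ((u - interpEnd I u : energySpace Γ) : Plane → ℝ))
  have hp : 0 ≤ p := Real.sqrt_nonneg _
  have hq : 0 ≤ q := Real.sqrt_nonneg _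
  have h1 := pow_le_pow_left₀ (add_nonneg hp hq) h0 2
  have h2 := mul_le_mul_of_nonneg_left (gradNorm_patch_one_sq_le hΩ s u) (sq_nonneg (CI * H))
  rw [mul_pow] at h1
  calc p ^ 2 + q ^ 2 ≤ (p + q) ^ 2 := by nlinarith [mul_nonneg hp hq]
    _ ≤ _ := h1.trans h2
    _ = _ := by ring

/-! ### Cutting off in the kernel of the interpolation operator -/

theorem memLp_comp_position {v : Plane → ℝ} (hv : MemEnergySpace Γ v) :
    MemLp (v ∘ position Γ) 2 (bulkInterfaceMeasure Γ) := by
  refine memLp_bulkInterface hv.memLp fun i => ?_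
  obtain ⟨C, hC⟩ := exists_bound_restr hv.continuousOn i
  refine (memLp_congr_ae ?_).2 (MemLp.of_bound (aesm_restr hv.continuousOn i) C ?_)
  · filter_upwards [ae_restrict_mem measurableSet_Icc] with s hs
    simp only [Function.comp_apply, position_curveEmb hs]
    rfl
  · filter_upwards [ae_restrict_mem measurableSet_Icc] with s hs using hC s hs

theorem integral_sq_comp_position {v : Plane → ℝ} (hv : MemEnergySpace Γ v) {S : Set Plane}
    (hS : MeasurableSet S) :
    ∫ x in position Γ ⁻¹' S, ‖v (position Γ x)‖ ^ 2 ∂bulkInterfaceMeasure Γ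
      = l2Norm Ω S v ^ 2 + Γ.l2Norm S (Γ.restr v) ^ 2 := by
  have hi : Integrable (fun x => ‖v (position Γ x)‖ ^ 2) (bulkInterfaceMeasure Γ) :=
    (memLp_comp_position hv).integrable_norm_pow (by norm_num)
  -- the position map agrees with the curves on the parameter intervals only
  have hm : ∀ i, MeasurableSet (Icc 0 (Γ.length i) ∩ Γ.curve i ⁻¹' S) := fun i => by
    have he : Icc 0 (Γ.length i) ∩ Γ.curve i ⁻¹' S
        = Icc 0 (Γ.length i) ∩ (position Γ ∘ curveEmb Γ i) ⁻¹' S := by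
      ext s
      simp only [mem_inter_iff, mem_preimage, Function.comp_apply]
      exact and_congr_right fun hs => by rw [position_curveEmb hs]
    rw [he]
    exact measurableSet_Icc.inter
      ((measurable_position.comp (measurableEmbedding_curveEmb Γ i).measurable) hS)
  rw [setIntegral_position hS hi, l2Norm_sq, Interface.l2Norm_sq]
  congr 1
  refine Finset.sum_congr rfl fun i _ => setIntegral_congr_fun (hm i) fun s hs => ?_
  simp only [position_curveEmb hs.1, Interface.restr, Real.norm_eq_abs, sq_abs]

variable {L : ℝ} {η : Plane → ℝ}

/-- The gradient of a cut-off function on the disjoint union. It is classical on `Ω`, so this is not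
`jointGrad`. -/
def cutoffGrad (Γ : Interface Ω) (η : Plane → ℝ) : BulkInterface Γ → Plane :=
  Sum.elim (gradient η) fun q => Γ.tanDeriv η q.1 q.2 • unitVec

theorem IsMeshCutoff.ae_norm_cutoffGrad_le (hη : IsMeshCutoff 𝒯 L η) (hΩ : IsOpen Ω)
    (hT : IsTriangulation Ω 𝒯) (hL : 0 ≤ L) :
    ∀ᵐ x ∂bulkInterfaceMeasure Γ, ‖cutoffGrad Γ η x‖ ≤ L := by
  refine ae_bulkInterface_iff.2 ⟨?_, fun i => ?_⟩
  · filter_upwards [ae_restrict_mem hΩ.measurableSet] with x hx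
    exact hη.norm_gradient_le hT hL hΩ hx
  · filter_upwards [hη.ae_abs_tanDeriv_le hT hL i] with s hs
    rwa [cutoffGrad, curveEmb, Sum.elim_inr, norm_smul, norm_unitVec, mul_one]

/-- Along the interface this uses that a function of one variable has derivative zero almost
everywhere on a set where it is constant: a curve may meet a triangle in any closed set. -/
theorem ae_cutoffGrad_eq_zero {t : Finset Plane} {c : ℝ} (h : ∀ x ∈ cell t, η x = c) :
    ∀ᵐ x ∂bulkInterfaceMeasure Γ, position Γ x ∈ cell t → cutoffGrad Γ η x = 0 := by
  refine ae_bulkInterface_iff.2 ⟨ae_restrict_of_ae (ae_gradient_eq_zero_of_eqOn_cell h),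
    fun i => ?_⟩
  have h0 : ∀ᵐ s, s ∈ Γ.curve i ⁻¹' cell t → deriv (Γ.restr η i) s = 0 :=
    ae_deriv_eq_zero_of_eqOn fun s hs => h _ hs
  filter_upwards [ae_restrict_of_ae h0, ae_restrict_mem measurableSet_Icc] with s hs hsI hst
  rw [position_curveEmb hsI] at hst
  rw [cutoffGrad, curveEmb, Sum.elim_inr, Interface.tanDeriv, hs hst, zero_smul]

theorem ae_jointGrad_mul_cutoff (hΩ : IsOpen Ω) (hb : Bornology.IsBounded Ω)
    (hT : IsTriangulation Ω 𝒯) (hη : IsMeshCutoff 𝒯 L η) (hL : 0 ≤ L) {v : Plane → ℝ}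
    (hv : MemEnergySpace Γ v) :
    ∀ᵐ x ∂bulkInterfaceMeasure Γ, jointGrad Γ (η * v) x
      = η (position Γ x) • jointGrad Γ v x + v (position Γ x) • cutoffGrad Γ η x := by
  refine ae_bulkInterface_iff.2 ⟨hv.weakGrad_mul_cutoff hΩ hb hT hη hL, fun i => ?_⟩
  filter_upwards [ae_tanDeriv_mul hη hT hL hv i, ae_restrict_mem measurableSet_Icc] with s hs hsI
  rw [position_curveEmb hsI]
  simp only [jointGrad, cutoffGrad, curveEmb, Sum.elim_inr, hs, add_smul, mul_smul]
  rfl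

/-- The product rule, squared: the energy of the cut-off function contributes the squared `L²` norm
of `v` with the factor `L²`, which for functions in the kernel of the interpolation operator
the interpolation error estimate compensates. -/
theorem localEnergy_mul_cutoff_le (hΩ : IsOpen Ω) (hb : Bornology.IsBounded Ω)
    (hT : IsTriangulation Ω 𝒯) (hη : IsMeshCutoff 𝒯 L η) (hL : 0 ≤ L) {v u : energySpace Γ}
    (hu : (u : Plane → ℝ) = η * v) {S : Set Plane} (hS : MeasurableSet S) :
    localEnergy (gradOp Γ hΩ) (position Γ ⁻¹' S) u
      ≤ 2 * localEnergy (gradOp Γ hΩ) (position Γ ⁻¹' S) v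
        + 2 * L ^ 2 * (l2Norm Ω S (v : Plane → ℝ) ^ 2 + Γ.l2Norm S (Γ.restr v) ^ 2) := by
  have hi : Integrable (fun x => ‖(v : Plane → ℝ) (position Γ x)‖ ^ 2) (bulkInterfaceMeasure Γ) :=
    (memLp_comp_position v.2).integrable_norm_pow (by norm_num)
  rw [← integral_sq_comp_position v.2 hS]
  unfold localEnergy
  rw [← integral_const_mul, ← integral_const_mul, ← integral_add
    ((integrable_norm_sq _ v).integrableOn.const_mul 2) (hi.integrableOn.const_mul (2 * L ^ 2))]
  refine integral_mono_ae (integrable_norm_sq _ u).integrableOn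
    (((integrable_norm_sq _ v).integrableOn.const_mul 2).add
      (hi.integrableOn.const_mul (2 * L ^ 2))) (ae_restrict_of_ae ?_)
  filter_upwards [coeFn_gradOp hΩ u, coeFn_gradOp hΩ v,
    ae_jointGrad_mul_cutoff hΩ hb hT hη hL v.2, hη.ae_norm_cutoffGrad_le (Γ := Γ) hΩ hT hL]
    with x h1 h2 h3 h4
  simp only [h1, h2, hu, h3]
  set p := jointGrad Γ v x
  set q := (v : Plane → ℝ) (position Γ x)
  have k1 : ‖η (position Γ x) • p‖ ≤ ‖p‖ := by
    rw [norm_smul]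
    exact mul_le_of_le_one_left (norm_nonneg _) (hη.norm_le_one _)
  have k2 : ‖q • cutoffGrad Γ η x‖ ≤ L * ‖q‖ := by
    rw [norm_smul, mul_comm]
    exact mul_le_mul_of_nonneg_right h4 (norm_nonneg _)
  have k3 := (norm_add_le (η (position Γ x) • p) (q • cutoffGrad Γ η x)).trans (add_le_add k1 k2)
  calc _ ≤ (‖p‖ + L * ‖q‖) ^ 2 := pow_le_pow_left₀ (norm_nonneg _) k3 2
    _ ≤ 2 * ‖p‖ ^ 2 + 2 * L ^ 2 * ‖q‖ ^ 2 := by nlinarith [sq_nonneg (‖p‖ - L * ‖q‖)]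

/-- On a cell where the cut-off function has the constant value `c`, the gradient of `η v` is
`c` times the gradient of `v`. -/
theorem ae_gradOp_mul_cutoff_of_const (hΩ : IsOpen Ω) (hb : Bornology.IsBounded Ω)
    (hT : IsTriangulation Ω 𝒯) (hη : IsMeshCutoff 𝒯 L η) (hL : 0 ≤ L) {v u : energySpace Γ}
    (hu : (u : Plane → ℝ) = η * v) {t : Finset Plane} {c : ℝ} (h : ∀ x ∈ cell t, η x = c) :
    ∀ᵐ x ∂(bulkInterfaceMeasure Γ).restrict (position Γ ⁻¹' cell t),
      gradOp Γ hΩ u x = c • gradOp Γ hΩ v x := by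
  rw [ae_restrict_iff' (measurable_position (isClosed_cell _).measurableSet)]
  filter_upwards [coeFn_gradOp hΩ u, coeFn_gradOp hΩ v,
    ae_jointGrad_mul_cutoff hΩ hb hT hη hL v.2, ae_cutoffGrad_eq_zero (Γ := Γ) h]
    with x h1 h2 h3 h4 hx
  rw [h1, hu, h3, h2, h4 hx, h _ hx, smul_zero, add_zero]

/-- The interpolation operator satisfies the assumptions of the abstract theory, with constants that
are free of the mesh size: the Lipschitz constant `2 γ / H` of the cut-off function
meets the factor `H` in the interpolation error. -/
theorem isLocalProjection_interpEnd (hΩ : IsOpen Ω) (hb : Bornology.IsBounded Ω)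
    (hT : IsTriangulation Ω 𝒯) (hQ : IsQuasiUniform 𝒯 H γ)
    {I : energySpace Γ →ₗ[ℝ] coarseSpace Γ 𝒯} (hI : IsInterpolation Γ 𝒯 H CI I) (t : 𝒯) :
    IsLocalProjection (gradOp Γ hΩ) (meshComplex Γ hΩ hT hQ t) (interpEnd I) (2 * CI ^ 2)
      (2 + 16 * γ ^ 2 * CI ^ 2) where
  nonneg₁ := by positivity
  nonneg₂ := by positivity
  proj u := by
    simp only [interpEnd, LinearMap.comp_apply, Submodule.subtype_apply]
    rw [hI.projection]
  stable := stable_interpEnd hΩ hI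
  cutoff φ hφ j := by
    have hH := hQ.pos
    have hγ := hQ.shape_pos hT t.2
    have hL : 0 ≤ 2 * γ / H := by positivity
    obtain ⟨η, hη, h0, h1⟩ := exists_layer_cutoff hT hQ t j
    let u : energySpace Γ := ⟨η * φ, φ.2.mul_cutoff hΩ hb hT hη hL⟩
    have hu : (u : Plane → ℝ) = η * φ := rfl
    refine ⟨u, fun s => ?_, fun s hs => localEnergy_eq_zero_of_ae _ ?_,
      fun s hs => localEnergy_eq_zero_of_ae _ ?_⟩
    · have k1 := localEnergy_mul_cutoff_le hΩ hb hT hη hL hu (isClosed_cell s).measurableSet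
      have k2 := interpolation_error_sq_le hΩ hI φ s
      rw [hφ, sub_zero] at k2
      have k3 : localEnergy (gradOp Γ hΩ) (position Γ ⁻¹' cell s) φ
          ≤ ∑ s' ∈ meeting 𝒯 s, localEnergy (gradOp Γ hΩ) (position Γ ⁻¹' cell s') φ :=
        Finset.single_le_sum
          (f := fun s' : 𝒯 => localEnergy (gradOp Γ hΩ) (position Γ ⁻¹' cell s') φ)
          (fun s' _ => localEnergy_nonneg _ _ φ) ((meshComplex Γ hΩ hT hQ t).mem_nb_self s)
      have k4 := mul_le_mul_of_nonneg_left k2 (show 0 ≤ 2 * (2 * γ / H) ^ 2 by positivity)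
      have e : ∀ x : ℝ, 2 * (2 * γ / H) ^ 2 * (2 * CI ^ 2 * H ^ 2 * x)
          = 16 * γ ^ 2 * CI ^ 2 * x := fun x => by
        field_simp
        ring
      rw [e] at k4
      change localEnergy (gradOp Γ hΩ) (position Γ ⁻¹' cell s) u ≤ (2 + 16 * γ ^ 2 * CI ^ 2) *
        ∑ s' ∈ meeting 𝒯 s, localEnergy (gradOp Γ hΩ) (position Γ ⁻¹' cell s') φ
      linarith
    · filter_upwards [ae_gradOp_mul_cutoff_of_const hΩ hb hT hη hL hu (h0 s hs)] with x hx
      rw [hx, zero_smul]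
    · rw [map_sub]
      filter_upwards [ae_gradOp_mul_cutoff_of_const hΩ hb hT hη hL hu (h1 s hs),
        ae_restrict_of_ae (Lp.coeFn_sub (gradOp Γ hΩ φ) (gradOp Γ hΩ u))] with x hx h2
      rw [h2, Pi.sub_apply, hx, one_smul, sub_self]

/-! ### Functions supported in a patch -/

theorem SupportedIn.sub {S : Set Plane} {u w : Plane → ℝ} (hu : SupportedIn Γ S u)
    (hw : SupportedIn Γ S w) : SupportedIn Γ S (u - w) := by
  refine ⟨?_, fun x hx hxS => by simp [hu.2 x hx hxS, hw.2 x hx hxS]⟩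
  filter_upwards [hu.1, hw.1] with x h1 h2 hxS
  simp [h1 hxS, h2 hxS]

/-- Outside a closed set that contains its support, a function has no gradient, neither in the bulk,
by locality of weak gradients, nor along the curves. -/
theorem SupportedIn.ae_gradOp_eq_zero (hΩ : IsOpen Ω) {S : Set Plane} (hS : IsClosed S)
    {u : energySpace Γ} (hu : SupportedIn Γ S u) :
    ∀ᵐ x ∂bulkInterfaceMeasure Γ, position Γ x ∉ S → gradOp Γ hΩ u x = 0 := by
  have h : ∀ᵐ x ∂bulkInterfaceMeasure Γ, position Γ x ∉ S → jointGrad Γ u x = 0 := by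
    refine ae_bulkInterface_iff.2 ⟨?_, fun i => ?_⟩
    · have hz : IsWeakGradient Ω 0 0 := ⟨MemLp.zero, by simp⟩
      have := u.2.isWeakGradient.ae_eq_on hz (O := Ω \ S) (hΩ.sdiff hS) sdiff_subset (by
        filter_upwards [hu.1] with x hx hxO using hx hxO.2)
      filter_upwards [this, ae_restrict_mem hΩ.measurableSet] with x hx hxΩ hxS
      exact hx ⟨hxΩ, hxS⟩
    · filter_upwards [ae_mem_Ioo i] with s hs hsS
      rw [position_curveEmb (Ioo_subset_Icc_self hs)] at hsS
      have hcont : ContinuousAt (Γ.curve i) s :=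
        (curve_continuousOn i).continuousAt (Icc_mem_nhds hs.1 hs.2)
      have hev : Γ.restr u i =ᶠ[𝓝 s] fun _ => 0 := by
        filter_upwards [hcont.preimage_mem_nhds (hS.isOpen_compl.mem_nhds hsS),
          Icc_mem_nhds hs.1 hs.2] with s' h1 h2
        exact hu.2 _ (mem_iUnion.2 ⟨i, mem_image_of_mem _ h2⟩) h1
      have hd : Γ.tanDeriv u i s = 0 := by
        rw [Interface.tanDeriv, hev.deriv_eq, deriv_const]
      rw [jointGrad, curveEmb, Sum.elim_inr, hd, zero_smul]
  filter_upwards [h, coeFn_gradOp hΩ u] with x h1 h2 hx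
  rw [h2, h1 hx]

/-- If `v` vanishes almost everywhere on the part of the disjoint union outside a closed set `S`,
then it vanishes everywhere on `Γ \ S`, by continuity. -/
theorem supportedIn_of_ae {S : Set Plane} (hS : IsClosed S) (hne : S.Nonempty) {v : Plane → ℝ}
    (hv : MemEnergySpace Γ v)
    (h : ∀ᵐ x ∂bulkInterfaceMeasure Γ, position Γ x ∉ S → v (position Γ x) = 0) :
    SupportedIn Γ S v := by
  obtain ⟨h1, h2⟩ := ae_bulkInterface_iff.1 h
  refine ⟨h1, fun x hx hxS => ?_⟩
  obtain ⟨i, s, hs, rfl⟩ := mem_iUnion.1 hx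
  -- the product with the distance to `S` is continuous and vanishes almost everywhere
  have hc := curve_continuousOn (Γ := Γ) i
  have hcv : ContinuousOn (Γ.restr v i) (Icc 0 (Γ.length i)) :=
    hv.continuousOn.comp hc fun s hs => mem_iUnion.2 ⟨i, mem_image_of_mem _ hs⟩
  have hcd : ContinuousOn (fun s => Γ.restr v i s * Metric.infDist (Γ.curve i s) S)
      (Icc 0 (Γ.length i)) :=
    hcv.mul ((Metric.continuous_infDist_pt S).comp_continuousOn hc)
  have hae : (fun s => Γ.restr v i s * Metric.infDist (Γ.curve i s) S)
      =ᵐ[volume.restrict (Icc 0 (Γ.length i))] fun _ => 0 := by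
    filter_upwards [h2 i, ae_restrict_mem measurableSet_Icc] with s hs hsI
    rw [position_curveEmb hsI] at hs
    by_cases hsS : Γ.curve i s ∈ S
    · rw [Metric.infDist_zero_of_mem hsS, mul_zero]
    · rw [Interface.restr, hs hsS, zero_mul]
  have := Measure.eqOn_Icc_of_ae_eq volume (Γ.length_pos i).ne hae hcd continuousOn_const hs
  have hd : Metric.infDist (Γ.curve i s) S ≠ 0 := fun h0 =>
    hxS ((hS.mem_iff_infDist_zero hne).2 h0)
  exact (mul_eq_zero.1 this).resolve_right hd

/-- The interpolation error of a function without energy outside the layer `k - 1` is supported in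
the patch of order `k`. -/
theorem supportedIn_sub_interpEnd (hΩ : IsOpen Ω)
    (hT : IsTriangulation Ω 𝒯) (hQ : IsQuasiUniform 𝒯 H γ)
    {I : energySpace Γ →ₗ[ℝ] coarseSpace Γ 𝒯} (hI : IsInterpolation Γ 𝒯 H CI I) (t : 𝒯)
    {k : ℕ} (hk : 1 ≤ k) {u : energySpace Γ}
    (hu : ∀ s ∉ meshLayer 𝒯 t (k - 1),
      localEnergy (gradOp Γ hΩ) (position Γ ⁻¹' cell s) u = 0) :
    SupportedIn Γ (patch 𝒯 k t) ((u - interpEnd I u : energySpace Γ) : Plane → ℝ) := by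
  set 𝒦 := meshComplex Γ hΩ hT hQ t
  set w := u - interpEnd I u
  have hzero : ∀ s ∉ meshLayer 𝒯 t k, ∀ᵐ x ∂bulkInterfaceMeasure Γ,
      position Γ x ∈ cell s → (w : Plane → ℝ) (position Γ x) = 0 := fun s hs => by
    have hm : MeasurableSet (cell s) := (isClosed_cell _).measurableSet
    have h1 := interpolation_error_sq_le hΩ hI u s
    have hsum : ∑ s' ∈ meeting 𝒯 s, localEnergy (gradOp Γ hΩ) (position Γ ⁻¹' cell s') u = 0 :=
      Finset.sum_eq_zero fun s' hs' => hu s' (𝒦.notMem_layer_of_mem_nb (j := k - 1) (s := s)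
        (by rw [Nat.sub_add_cancel hk]; exact hs) hs')
    rw [hsum, mul_zero, ← integral_sq_comp_position w.2 hm] at h1
    have h2 := (integral_eq_zero_iff_of_nonneg (fun x => by positivity)
      ((memLp_comp_position w.2).integrable_norm_pow (by norm_num)).integrableOn).1
      (le_antisymm h1 (integral_nonneg fun x => by positivity))
    filter_upwards [(ae_restrict_iff' (measurable_position hm)).1 h2] with x hx hxs
    simpa using hx hxs
  have hne : (patch 𝒯 k t).Nonempty := by
    obtain ⟨x, -, hx⟩ := mem_meeting.1 (𝒦.mem_nb_self t)
    refine ⟨x, ?_⟩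
    rw [patch_eq]
    exact mem_biUnion (Finset.mem_coe.2 (𝒦.layer_mono (Nat.zero_le k)
      (Finset.mem_singleton_self t))) hx
  refine supportedIn_of_ae (isClosed_patch t k) hne w.2 ?_
  have hall : ∀ᵐ x ∂bulkInterfaceMeasure Γ, ∀ s, s ∉ meshLayer 𝒯 t k →
      position Γ x ∈ cell s → (w : Plane → ℝ) (position Γ x) = 0 := by
    rw [ae_all_iff]
    intro s
    by_cases hs : s ∈ meshLayer 𝒯 t k
    · exact ae_of_all _ fun x h => absurd hs h
    · filter_upwards [hzero s hs] with x hx _ using hx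
  filter_upwards [hall, 𝒦.ae_cover] with x hx ⟨s, hs⟩ hxP
  refine hx s (fun h => hxP ?_) hs
  rw [patch_eq]
  exact mem_biUnion (Finset.mem_coe.2 h) hs

/-- For a function supported in `S` it makes no difference whether the form is taken over `S` or
over the whole domain. -/
theorem SupportedIn.weightedForm_univ (hΩ : IsOpen Ω) {S : Set Plane} (hS : IsClosed S)
    {u : energySpace Γ} (hu : SupportedIn Γ S u) (a : BulkInterface Γ → ℝ) (w : energySpace Γ) :
    weightedForm (gradOp Γ hΩ) a univ u w
      = weightedForm (gradOp Γ hΩ) a (position Γ ⁻¹' S) u w := by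
  unfold weightedForm
  rw [setIntegral_univ, setIntegral_eq_integral_of_ae_compl_eq_zero]
  filter_upwards [hu.ae_gradOp_eq_zero hΩ hS] with x hx hxS
  rw [hx hxS, inner_zero_left, mul_zero]

/-! ### From geometric decay in the layers to exponential decay -/

/-- A geometric factor gained once per seven layers, starting from the fifth, is an exponential
factor in the number of layers. The constant `11 = 5 + 6` makes up for the rounding in the
exponent. -/
theorem pow_div_seven_le {θ : ℝ} (h0 : 0 < θ) (h1 : θ < 1) {k : ℕ} (hk : 5 ≤ k) :
    θ ^ ((k - 5) / 7)
      ≤ Real.exp (-(Real.log θ) / 7 * 11) * Real.exp (-(-(Real.log θ) / 7 * k)) := by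
  have hlog : Real.log θ < 0 := Real.log_neg h0 h1
  rw [← Real.exp_add, ← Real.exp_log h0, ← Real.exp_nat_mul, Real.exp_le_exp, Real.exp_log h0]
  have hm : k ≤ 7 * ((k - 5) / 7) + 11 := by omega
  have hm' : (k : ℝ) ≤ 7 * (((k - 5) / 7 : ℕ) : ℝ) + 11 := by exact_mod_cast hm
  nlinarith

end Interpolation

end LODInterface

end

open LODInterface in
theorem theorem2 (α β γ CI : ℝ) (hα : 0 < α) :
    ∃ C c : ℝ, 0 < C ∧ 0 < c ∧
      ∀ (Ω : Set Plane), IsPolygonalDomain Ω →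
      ∀ (Γ : Interface Ω) (A AΓ : Plane → ℝ), IsPermeability Γ A AΓ α β →
      ∀ (𝒯 : Finset (Finset Plane)) (H : ℝ), IsTriangulation Ω 𝒯 → IsQuasiUniform 𝒯 H γ →
      ∀ (I : energySpace Γ →ₗ[ℝ] coarseSpace Γ 𝒯), IsInterpolation Γ 𝒯 H CI I →
      ∀ (v : coarseSpace Γ 𝒯), ∀ t ∈ 𝒯,
      ∀ (φ : energySpace Γ), IsCorrector Γ 𝒯 A AΓ I v t φ →
      ∀ k : ℕ, 7 ≤ k →
      ∀ (φk : energySpace Γ), IsLocalCorrector Γ 𝒯 A AΓ I v t k φk →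
        gradNorm Γ univ ((φ - φk : energySpace Γ) : Plane → ℝ)
          ≤ C * Real.exp (-(c * k)) * gradNorm Γ (cell t) (v : energySpace Γ) := by
  set N := overlapBound γ
  set c₁ := 2 * CI ^ 2
  set c₂ := 2 + 16 * γ ^ 2 * CI ^ 2
  have hR : 0 ≤ ringConst N c₁ c₂ := by
    unfold ringConst
    positivity
  have hD : 0 ≤ decayConst α β N c₁ c₂ := by
    unfold decayConst
    positivity
  set d := decayConst α β N c₁ c₂
  -- a decay factor that is also positive, so that it has a logarithm
  set θ := (d + 1) / (d + 2) with hθ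
  have hθ0 : 0 < θ := by positivity
  have hθ1 : θ < 1 := by
    rw [hθ, div_lt_one (by positivity)]
    linarith
  have hdθ : d / (1 + d) ≤ θ := by
    rw [hθ, div_le_div_iff₀ (by positivity) (by positivity)]
    nlinarith
  have hlog : Real.log θ < 0 := Real.log_neg hθ0 hθ1
  set M := (β / α) ^ 4 * N * (ringConst N c₁ c₂ + 1)
  have hM : 0 ≤ M := by positivity
  set b := -(Real.log θ) / 7 with hb
  have hb0 : 0 < b := by
    rw [hb]
    linarith
  -- the energies decay with rate `b`; the square root halves the rate, and `+ 1` makes the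
  -- constant positive
  refine ⟨Real.sqrt (2 * M * Real.exp (b * 11)) + 1, b / 2, by positivity, by positivity, ?_⟩
  intro Ω hΩ Γ A AΓ hA 𝒯 H hT hQ I hI v t ht φ hφ k hk φk hφk
  have hO := hΩ.isOpen
  have hJ := isLocalProjection_interpEnd hO hΩ.isBounded hT hQ hI ⟨t, ht⟩
  have hcell : MeasurableSet (cell t) := (isClosed_cell t).measurableSet
  have hpatch : IsClosed (patch 𝒯 k t) := isClosed_patch ⟨t, ht⟩ k
  have key := localization_error hJ hA.aemeasurable_jointCoeff hα hA.ae_bounds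
    (t := ⟨t, ht⟩) (Finset.mem_singleton_self _) (v := (v : energySpace Γ)) (φ := φ) (φk := φk)
    (interpEnd_eq_zero_iff.2 hφ.mem_fine)
    (fun w hw => by
      have h := hφ.eq w (interpEnd_eq_zero_iff.1 hw)
      rw [← weightedForm_gradOp hO hα hA MeasurableSet.univ,
        ← weightedForm_gradOp hO hα hA hcell, preimage_univ] at h
      exact h)
    (interpEnd_eq_zero_iff.2 hφk.mem_fine) (k := k) (by omega)
    {w : energySpace Γ | SupportedIn Γ (patch 𝒯 k t) w} hφk.supported
    (fun u hu w hw => SupportedIn.sub hu hw)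
    (fun u hu => supportedIn_sub_interpEnd hO hT hQ hI ⟨t, ht⟩ (by omega) hu)
    (fun w hwS hw => by
      have h := hφk.eq w (interpEnd_eq_zero_iff.1 hw) hwS
      rw [← weightedForm_gradOp hO hα hA hpatch.measurableSet,
        ← weightedForm_gradOp hO hα hA hcell,
        ← hφk.supported.weightedForm_univ hO hpatch] at h
      exact h)
  have hE0 : 0 ≤ localEnergy (gradOp Γ hO) (position Γ ⁻¹' cell t) (v : energySpace Γ) :=
    localEnergy_nonneg _ _ _
  have hpow : (d / (1 + d)) ^ ((k - 5) / 7)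
      ≤ Real.exp (b * 11) * Real.exp (-(b * k)) :=
    (pow_le_pow_left₀ (by positivity) hdθ _).trans (pow_div_seven_le hθ0 hθ1 (by omega))
  have hsq : gradNorm Γ univ ((φ - φk : energySpace Γ) : Plane → ℝ) ^ 2
      ≤ 2 * M * Real.exp (b * 11) * (Real.exp (-(b / 2 * k)) *
        gradNorm Γ (cell t) (v : energySpace Γ)) ^ 2 := by
    have h1 := gradNorm_sq_le hO MeasurableSet.univ (φ - φk)
    rw [preimage_univ] at h1
    have h2 := localEnergy_le_gradNorm_sq hO hcell (v : energySpace Γ)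
    have hexp : Real.exp (-(b / 2 * k)) ^ 2 = Real.exp (-(b * k)) := by
      rw [← Real.exp_nat_mul]
      congr 1
      push_cast
      ring
    calc _ ≤ _ := h1
      _ ≤ 2 * (M * (Real.exp (b * 11) * Real.exp (-(b * k))) *
          gradNorm Γ (cell t) (v : energySpace Γ) ^ 2) := by
        refine mul_le_mul_of_nonneg_left (key.trans ?_) zero_le_two
        exact mul_le_mul (mul_le_mul_of_nonneg_left hpow hM) h2 hE0 (by positivity)
      _ = _ := by
        rw [mul_pow, hexp]
        ring
  have hg := gradNorm_nonneg (Γ := Γ) (cell t) (v : energySpace Γ)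
  have h3 := Real.le_sqrt_of_sq_le hsq
  rw [Real.sqrt_mul (by positivity), Real.sqrt_sq (by positivity), ← mul_assoc] at h3
  refine h3.trans (mul_le_mul_of_nonneg_right (mul_le_mul_of_nonneg_right ?_ (by positivity)) hg)
  linarith
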